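/- Proposition (Element-wise mean mass preserving operator). Let $\ell\ge 2$ be an integer. There is a nondecreasing, nonnegative function $c$ of a real variable, depending only on $\ell$, with the following property. Let $\Omega\subset\mathbb{R}^2$ be an open set with $\Omega=\operatorname{int}\overline\Omega$ (for instance a bounded polygonal Lipschitz domain) and let $\mathcal M$ be a face-to-face triangulation of $\overline\Omega$ by finitely many nondegenerate closed triangles. Let $\sigma(\mathcal M)=\max_{K\in\mathcal M} h_K/\rho_K$ be its shape parameter, where $h_K$ is the diameter of $K$ and $\rho_K$ the diameter of the largest disc contained in $K$. Let $\mathcal F$ be the set of edges and $\mathcal F_\Omega$ the set of interior edges (those shared by two triangles). Orient each $F\in\mathcal F$ by a unit normal $n_F$, pointing out of $\Omega$ on boundary edges; let $[\![v]\!]_{|F}$ be the jump of $v$ across $F$ in direction $n_F$, understood as the trace of $v$ if $F$ is a boundary edge, and let $h_F=|F|$ be the length of $F$. Let $\mathbb P_{k}$ denote polynomials of total degree at most $k$ and put $$ CR_\ell=\Big\{v\in L^2(\Omega) : v_{|K}\in\mathbb P_\ell(K)\ \forall K\in\mathcal M,\ \int_F [\![v]\!]\,r=0\ \ \forall F\in\mathcal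 F,\ r\in\mathbb P_{\ell-1}(F)\Big\},$$ $$ S_k=\{v\in H^1_0(\Omega): v_{|K}\in\mathbb P_k(K)\ \forall K\in\mathcal M\},\qquad \|w\|_{cr}^2=\sum_{K\in\mathcal M}\|\nabla w\|_{L^2(K)}^2+\sum_{F\in\mathcal F}h_F^{-1}\|[\![w]\!]\|_{L^2(F)}^2 $$ for $w\in H^1_0(\Omega)^2+CR_\ell^2$. Let $\mathcal N_{k,\Omega}$ be the set of Lagrange nodes of degree $k$ of $\mathcal M$ that lie in $\Omega$ and, for $\nu\in\mathcal N_{k,\Omega}$, let $\Phi_k^\nu\in S_k$ be the Lagrange basis function, $\Phi_k^\nu(\nu')=\delta_{\nu\nu'}$ for all $\nu'\in\mathcal N_{k,\Omega}$. For every $\nu\in\mathcal N_{\ell,\Omega}$ choose any $K_\nu\in\mathcal M$ with $\nu\in K_\nu$. For $v_h\in CR_\ell^2$ set $$ A_h^{cr}v_h=\sum_{\nu\in\mathcal N_{\ell,\Omega}} v_{h|K_\nu}(\nu)\,\Phi_\ell^\nu,\qquad B_h^{cr}v_h=\sum_{F\in\mathcal F_\Omega}\Big(\int_F v_h\Big)\frac{3}{2|F|}\Phi_2^{m_F},\qquad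 M_h^{cr}v_h=A_h^{cr}v_h+B_h^{cr}(v_h-A_h^{cr}v_h),$$ where $m_F$ is the midpoint of $F$ (and $\int_F v_h$ is the same from both sides of $F$, because $[\![v_h]\!]$ has mean zero). Then $M_h^{cr}$ is a linear operator from $CR_\ell^2$ to $S_\ell^2$, and for all $v_h\in CR_\ell^2$ and $K\in\mathcal M$ $$\int_K \operatorname{div} M_h^{cr}v_h=\int_K\operatorname{div} v_h\qquad\text{and}\qquad \|v_h-M_h^{cr}v_h\|_{cr}\le c(\sigma(\mathcal M))\,\inf_{v\in H^1_0(\Omega)^2}\|v-v_h\|_{cr}.$$ -/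

import Mathlib

open MeasureTheory Set Filter Topology
open scoped ContDiff

noncomputable section

namespace CrouzeixRaviart

/-- The Euclidean plane. -/
abbrev Plane : Type := EuclideanSpace ℝ (Fin 2)

/-- The Lebesgue space `L²(Ω)`. -/
abbrev L2 (Ω : Set Plane) : Type := Lp ℝ 2 ((volume : Measure Plane).restrict Ω)

/-- The classical partial derivative `∂ᵢ f`. -/
def pderiv (i : Fin 2) (f : Plane → ℝ) (x : Plane) : ℝ :=
  fderiv ℝ f x (EuclideanSpace.single i 1)

/-- Test functions in `C_c^∞(U)`. -/
def IsTestFunction (U : Set Plane) (φ : Plane → ℝ) : Prop :=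
  ContDiff ℝ ∞ φ ∧ HasCompactSupport φ ∧ tsupport φ ⊆ U

/-- `g ∈ L²(U)` is the `i`-th weak partial derivative of `w` in the open set `U`. -/
def IsWeakPartial (U : Set Plane) (i : Fin 2) (w g : Plane → ℝ) : Prop :=
  MemLp g 2 (volume.restrict U) ∧
    ∀ φ : Plane → ℝ, IsTestFunction U φ →
      ∫ x in U, w x * pderiv i φ x = - ∫ x in U, g x * φ x

open Classical in
/-- The `i`-th weak partial derivative of `w` in the open set `U`. It is unique up to null sets;
the value `0` is used if there is none in `L²(U)`. -/
def weakPartial (U : Set Plane) (i : Fin 2) (w : Plane → ℝ) : Plane → ℝ :=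
  if h : ∃ g : Plane → ℝ, IsWeakPartial U i w g then h.choose else 0

/-- The (weak) divergence in the open set `U` of a vector field. -/
def weakDiv (U : Set Plane) (v : Fin 2 → Plane → ℝ) (x : Plane) : ℝ :=
  ∑ i, weakPartial U i (v i) x

/-- The functions `φ n` converge to `w` in `L²(S)` and their gradients converge to `G` in
`L²(S)²`, i.e. there is `H¹(S)`-convergence. -/
def TendstoH1 (S : Set Plane) (φ : ℕ → Plane → ℝ) (w : Plane → ℝ) (G : Fin 2 → Plane → ℝ) :
    Prop :=
  Tendsto (fun n => eLpNorm (φ n - w) 2 (volume.restrict S)) atTop (𝓝 0) ∧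
    ∀ i, MemLp (G i) 2 (volume.restrict S) ∧
      Tendsto (fun n => eLpNorm (pderiv i (φ n) - G i) 2 (volume.restrict S)) atTop (𝓝 0)

/-- The Sobolev space `H¹₀(Ω)`: the closure of `C_c^∞(Ω)` in `H¹(Ω)`. -/
def H10 (Ω : Set Plane) : Set (L2 Ω) :=
  {v | ∃ (φ : ℕ → Plane → ℝ) (G : Fin 2 → Plane → ℝ),
    (∀ n, IsTestFunction Ω (φ n)) ∧ TendstoH1 Ω φ v G}

/-- A simplex with vertex set `s`, as a closed set. -/
def hull (s : Finset Plane) : Set Plane := convexHull ℝ (s : Set Plane)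

/-- Length measure on the segment spanned by the two points of `F`. -/
def edgeMeasure (F : Finset Plane) : Measure Plane :=
  (Measure.hausdorffMeasure 1 : Measure Plane).restrict (hull F)

/-- `g ∈ L²(F)` is the trace on the edge `F` of the restriction of `w` to the triangle `K`: the
trace operator is the extension by continuity, from the smooth functions to `H¹(K)`, of the
restriction to `F`. -/
def IsTrace (K F : Finset Plane) (w g : Plane → ℝ) : Prop :=
  MemLp g 2 (edgeMeasure F) ∧
    ∃ (φ : ℕ → Plane → ℝ) (G : Fin 2 → Plane → ℝ),
      (∀ n, ContDiff ℝ ∞ (φ n)) ∧ TendstoH1 (hull K) φ w G ∧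
        Tendsto (fun n => eLpNorm (φ n - g) 2 (edgeMeasure F)) atTop (𝓝 0)

open Classical in
/-- The trace on the edge `F` of the restriction of `w` to the triangle `K` (unique up to null
sets of `F`; `0` is used if there is none). -/
def trace (K F : Finset Plane) (w : Plane → ℝ) : Plane → ℝ :=
  if h : ∃ g : Plane → ℝ, IsTrace K F w g then h.choose else 0

/-- An oriented face-to-face triangulation of `closure Ω`. Triangles are given by their sets of
vertices. Every edge `F` is oriented by the choice of a triangle `plus F` containing it: the unit
normal `n_F` is the normal pointing out of `plus F`. In particular `n_F` points out of the meshed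
region if `F` belongs to only one triangle. -/
structure Triangulation (Ω : Set Plane) where
  cells : Finset (Finset Plane)
  card_eq : ∀ K ∈ cells, K.card = 3
  indep : ∀ K ∈ cells, AffineIndependent ℝ ((↑) : K → Plane)
  face_to_face : ∀ K ∈ cells, ∀ K' ∈ cells,
    hull K ∩ hull K' = convexHull ℝ ((K : Set Plane) ∩ (K' : Set Plane))
  cover : ⋃ K ∈ cells, hull K = closure Ω
  plus : Finset Plane → Finset Plane
  plus_spec : ∀ K ∈ cells, ∀ F ⊆ K, F.card = 2 → plus F ∈ cells ∧ F ⊆ plus F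

namespace Triangulation

variable {Ω : Set Plane} (T : Triangulation Ω)

open Classical in
/-- The edges of the triangulation, given by their pairs of endpoints. -/
def edges : Finset (Finset Plane) := T.cells.biUnion fun K => K.powersetCard 2

open Classical in
/-- The interior edges: those shared by two triangles. -/
def interiorEdges : Finset (Finset Plane) :=
  T.edges.filter fun F => ∃ K ∈ T.cells, ∃ K' ∈ T.cells, K ≠ K' ∧ F ⊆ K ∧ F ⊆ K'

open Classical in
/-- The jump of `w` on `F` in direction `n_F`: the trace from `plus F` minus the trace from the
triangle on the other side; on a boundary edge there is no such triangle and the jump is the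
trace. -/
def jump (F : Finset Plane) (w : Plane → ℝ) (x : Plane) : ℝ :=
  trace (T.plus F) F w x -
    ∑ K ∈ T.cells.filter (fun K => F ⊆ K ∧ K ≠ T.plus F), trace K F w x

/-- The restriction of `v` to the triangle `K` is a polynomial of total degree at most `l`. -/
def IsPolyOn (l : ℕ) (K : Finset Plane) (v : Plane → ℝ) : Prop :=
  ∃ p : MvPolynomial (Fin 2) ℝ, p.totalDegree ≤ l ∧
    ∀ᵐ x ∂(volume.restrict (hull K)), v x = MvPolynomial.eval (fun i => x i) p

open Classical in
/-- The value `v_{|K}(x)` at `x` of the polynomial that coincides with `v` on `K`. -/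
def cellValue (K : Finset Plane) (v : Plane → ℝ) (x : Plane) : ℝ :=
  if h : ∃ p : MvPolynomial (Fin 2) ℝ,
      ∀ᵐ y ∂(volume.restrict (hull K)), v y = MvPolynomial.eval (fun i => y i) p
  then MvPolynomial.eval (fun i => x i) h.choose else 0

/-- The space of element-wise polynomials of degree at most `l` in `H¹₀(Ω)`. -/
def polyH10 (l : ℕ) : Set (L2 Ω) := {v | v ∈ H10 Ω ∧ ∀ K ∈ T.cells, IsPolyOn l K v}

/-- The nonconforming Crouzeix-Raviart space of degree `l`, with homogeneous boundary conditions.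
For `l = 0` the truncated subtraction plays no role, as only `l ≥ 1` is considered. -/
def crSpace (l : ℕ) : Set (L2 Ω) :=
  {v | (∀ K ∈ T.cells, IsPolyOn l K v) ∧
    ∀ F ∈ T.edges, ∀ r : MvPolynomial (Fin 2) ℝ, r.totalDegree ≤ l - 1 →
      ∫ x, T.jump F v x * MvPolynomial.eval (fun i => x i) r ∂(edgeMeasure F) = 0}

/-- The broken `H¹`-norm of a vector field on `Ω`, augmented with scaled jumps. -/
def crNorm (w : Fin 2 → L2 Ω) : ℝ :=
  Real.sqrt
    ((∑ K ∈ T.cells, ∑ i, ∑ j,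
        ∫ x in hull K, (weakPartial (interior (hull K)) j (w i) x) ^ 2) +
      ∑ F ∈ T.edges, (Metric.diam (hull F))⁻¹ *
        ∑ i, ∫ x, (T.jump F (w i) x) ^ 2 ∂(edgeMeasure F))

open Classical in
/-- The interior Lagrange nodes of degree `l`: the points of `Ω` whose barycentric coordinates in
some triangle are multiples of `1 / l`. -/
def interiorNodes (l : ℕ) : Finset Plane :=
  (T.cells.biUnion fun K =>
    (K.piAntidiag l).image fun a : Plane → ℕ => ∑ z ∈ K, ((a z : ℝ) / l) • z).filter (· ∈ Ω)

/-- `φ` is a continuous element-wise polynomial of degree at most `l`, zero on the boundary, with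
value `1` at the node `ν` and `0` at the other interior nodes. -/
def IsLagrangeBasis (l : ℕ) (ν : Plane) (φ : L2 Ω) : Prop :=
  φ ∈ T.polyH10 l ∧ ∀ ν' ∈ T.interiorNodes l, ∀ K ∈ T.cells, ν' ∈ hull K →
    (ν' = ν → cellValue K φ ν' = 1) ∧ (ν' ≠ ν → cellValue K φ ν' = 0)

open Classical in
/-- The Lagrange basis function of degree `l` associated with the interior node `ν`. -/
def lagrangeBasis (l : ℕ) (ν : Plane) : L2 Ω :=
  if h : ∃ φ : L2 Ω, T.IsLagrangeBasis l ν φ then h.choose else 0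

/-- `κ` selects, for each interior Lagrange node of degree `l`, a triangle containing it. -/
def IsNodeSelection (l : ℕ) (κ : Plane → Finset Plane) : Prop :=
  ∀ ν ∈ T.interiorNodes l, κ ν ∈ T.cells ∧ ν ∈ hull (κ ν)

/-- The simplified nodal averaging operator. -/
def averaging (l : ℕ) (κ : Plane → Finset Plane) (v : Fin 2 → L2 Ω) : Fin 2 → L2 Ω :=
  fun i => ∑ ν ∈ T.interiorNodes l, cellValue (κ ν) (v i) ν • T.lagrangeBasis l ν

/-- The midpoint of an edge. -/
def midpt (F : Finset Plane) : Plane := (1 / 2 : ℝ) • ∑ z ∈ F, z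

/-- The normalized quadratic bubble function of an interior edge. -/
def edgeBubble (F : Finset Plane) : L2 Ω :=
  (3 / (2 * Metric.diam (hull F))) • T.lagrangeBasis 2 (midpt F)

/-- The bubble operator. The integral over `F` is that of the trace from `plus F`; on the
Crouzeix-Raviart space of degree at least `1` the trace from the other side has the same
integral. -/
def bubbleOp (v : Fin 2 → L2 Ω) : Fin 2 → L2 Ω :=
  fun i => ∑ F ∈ T.interiorEdges,
    (∫ x, trace (T.plus F) F (v i) x ∂(edgeMeasure F)) • T.edgeBubble F

/-- The operator `M = A + B (Id - A)`. -/
def meanOp (l : ℕ) (κ : Plane → Finset Plane) (v : Fin 2 → L2 Ω) : Fin 2 → L2 Ω :=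
  T.averaging l κ v + T.bubbleOp (v - T.averaging l κ v)

/-- The diameter of the largest disc contained in a triangle. -/
def inDiam (K : Finset Plane) : ℝ :=
  sSup {d : ℝ | ∃ (z : Plane) (r : ℝ), 0 ≤ r ∧ d = 2 * r ∧ Metric.closedBall z r ⊆ hull K}

/-- The shape parameter of the triangulation: the maximum over the triangles of the ratio between
the diameter and the diameter of the largest inscribed disc. -/
def shapeParameter : ℝ := ⨆ K : T.cells, Metric.diam (hull K.1) / inDiam K.1

end Triangulation

end CrouzeixRaviart

end

open CrouzeixRaviart

noncomputable section

namespace CrouzeixRaviart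

/-! ### Barycentric coordinates -/

/-! Write m = Mv. Everything rests on two facts: m lies in H¹₀, so subtracting it does not change
the jumps of v; and the bubbles correct the nodal averages so that v - m has mean zero on every edge
of every triangle.

Divergence. A smooth function with vanishing means on the three edges of a triangle has a gradient
with vanishing mean there: the integral of a derivative along one edge is a difference of integrals
over the other two (`integral_pderiv_eq_zero`). The edge means of v - m vanish because the quadratic
Lagrange function of a midpoint has, by Simpson's rule, mean 2/3 on its own edge and mean 0 on every
other edge. On boundary edges the nodal average is zero and v itself has mean zero.

Stability. For u in H¹₀ the jumps of u - v are those of -v, so the distance from v to H¹₀ is at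
least the jump seminorm of v (`sqrt_jumpEnergy_le_crNorm`). The jump part of the norm of v - m is
exactly this seminorm, hence only the element-wise gradient of v - m has to be bounded by jumps. At
an interior Lagrange node of a triangle K, v - Av is the difference of the values of v from two
triangles at the node; at a boundary node it is the value of v from K. Walking through triangles
that share edges at the node, either to the selected triangle or to a boundary edge, turns this into
a sum of jumps (`value_bound`). Each jump is bounded by its L² norm through an inverse inequality,
and the number of steps is O(σ²) because the triangles at a point contain, after shrinking towards
it, disjoint discs of comparable size. Nodal values control the polynomial v - Av and its gradient,
edge means of v - Av control the bubbles, and each edge touches O(σ²) triangles. In total the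
squared constant is 1 + Cσ⁸.

The walk needs topology: the triangles around an interior vertex are connected through edges, and at
a boundary vertex every connected family reaches a boundary edge. Both follow from one clopen
argument (`cones_cover`): if all edges at z of a connected family are shared, the cones of the
family fill the plane.

Traces, weak derivatives, cell values and Lagrange functions are defined by choice. Traces are
identified a.e. through the trace inequality and weak derivatives through their uniqueness a.e. For
Lagrange functions only existence is proved, by gluing explicit polynomials and showing that
Lipschitz functions vanishing off Ω lie in H¹₀. The values needed later hold for whichever function
is chosen, because an element-wise polynomial in H¹₀ has zero jumps and is therefore continuous and
zero on the boundary. -/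

/-- `K` is the vertex set of a nondegenerate triangle. -/
def IsTri (K : Finset Plane) : Prop :=
  K.card = 3 ∧ AffineIndependent ℝ ((↑) : K → Plane)

/-- The affine basis given by the vertices of a triangle. -/
def triBasis {K : Finset Plane} (h : IsTri K) : AffineBasis K ℝ Plane :=
  ⟨((↑) : K → Plane), h.2, by
    rw [h.2.affineSpan_eq_top_iff_card_eq_finrank_add_one]
    simp [h.1]⟩

open Classical in
/-- The barycentric coordinate of the triangle `K` associated with `z`, and `0` if `z` is not a
vertex of `K`. -/
def bary (K : Finset Plane) (z : Plane) : Plane →ᵃ[ℝ] ℝ :=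
  if h : IsTri K ∧ z ∈ K then (triBasis h.1).coord ⟨z, h.2⟩ else 0

variable {K : Finset Plane}

lemma bary_of_mem (hK : IsTri K) {z : Plane} (hz : z ∈ K) :
    bary K z = (triBasis hK).coord ⟨z, hz⟩ := by
  simp [bary, hK, hz]

lemma bary_notMem {z : Plane} (hz : z ∉ K) (x : Plane) : bary K z x = 0 := by
  simp [bary, hz]

lemma continuous_bary (K : Finset Plane) (z : Plane) : Continuous (bary K z) :=
  (bary K z).continuous_of_finiteDimensional

lemma sum_bary (hK : IsTri K) (x : Plane) : ∑ z ∈ K, bary K z x = 1 := by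
  rw [← (triBasis hK).sum_coord_apply_eq_one x, ← Finset.sum_coe_sort]
  exact Finset.sum_congr rfl fun z _ => by rw [bary_of_mem hK z.2]

lemma sum_bary_smul (hK : IsTri K) (x : Plane) : ∑ z ∈ K, bary K z x • z = x := by
  conv_rhs => rw [← (triBasis hK).linear_combination_coord_eq_self x]
  rw [← Finset.sum_coe_sort]
  exact Finset.sum_congr rfl fun z _ => by rw [bary_of_mem hK z.2]; rfl

lemma bary_self (hK : IsTri K) {z : Plane} (hz : z ∈ K) : bary K z z = 1 := by
  rw [bary_of_mem hK hz]; exact (triBasis hK).coord_apply_eq ⟨z, hz⟩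

lemma bary_of_ne (hK : IsTri K) {z w : Plane} (hw : w ∈ K) (h : z ≠ w) : bary K z w = 0 := by
  by_cases hz : z ∈ K
  · rw [bary_of_mem hK hz]
    exact (triBasis hK).coord_apply_ne (i := ⟨z, hz⟩) (j := ⟨w, hw⟩) (by simpa using h)
  · exact bary_notMem hz w

lemma affine_sum_smul {ι : Type*} (f : Plane →ᵃ[ℝ] ℝ) (s : Finset ι) (w : ι → ℝ) (p : ι → Plane)
    (hw : ∑ i ∈ s, w i = 1) : f (∑ i ∈ s, w i • p i) = ∑ i ∈ s, w i * f (p i) := by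
  have h (x : Plane) : f x = f.linear x + f 0 := by
    have := congrFun f.decomp x
    simpa using this
  rw [h, map_sum]
  simp only [map_smul, smul_eq_mul]
  have : ∀ i, w i * f (p i) = w i * f.linear (p i) + w i * f 0 := fun i => by rw [h (p i)]; ring
  simp only [this, Finset.sum_add_distrib, ← Finset.sum_mul, hw, one_mul]

lemma affine_add (f : Plane →ᵃ[ℝ] ℝ) (x v : Plane) : f (x + v) = f x + f.linear v := by
  have := f.map_vadd x v
  simpa [add_comm] using this

lemma affine_combo (f : Plane →ᵃ[ℝ] ℝ) (x y : Plane) (t : ℝ) :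
    f ((1 - t) • x + t • y) = (1 - t) * f x + t * f y := by
  have := affine_sum_smul f (Finset.univ : Finset (Fin 2)) ![1 - t, t] ![x, y] (by simp)
  simpa using this

lemma bary_sum_smul (hK : IsTri K) {w : Plane → ℝ} (hw : ∑ y ∈ K, w y = 1) {z : Plane}
    (hz : z ∈ K) : bary K z (∑ y ∈ K, w y • y) = w z := by
  classical
  rw [affine_sum_smul _ _ _ _ hw, Finset.sum_eq_single_of_mem z hz, bary_self hK hz, mul_one]
  intro y hy hyz
  rw [bary_of_ne hK hy hyz.symm, mul_zero]

lemma hull_eq_range (hK : IsTri K) : hull K = convexHull ℝ (range (triBasis hK)) := by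
  have : range (triBasis hK) = (K : Set Plane) := by
    change range ((↑) : K → Plane) = _
    simp
  rw [this, hull]

lemma mem_hull_iff (hK : IsTri K) {x : Plane} : x ∈ hull K ↔ ∀ z, 0 ≤ bary K z x := by
  rw [hull_eq_range hK, (triBasis hK).convexHull_eq_nonneg_coord]
  refine ⟨fun h z => ?_, fun h z => ?_⟩
  · by_cases hz : z ∈ K
    · rw [bary_of_mem hK hz]; exact h _
    · rw [bary_notMem hz]
  · rw [← bary_of_mem hK z.2]; exact h _

lemma mem_interior_hull_iff (hK : IsTri K) {x : Plane} :
    x ∈ interior (hull K) ↔ ∀ z ∈ K, 0 < bary K z x := by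
  rw [hull_eq_range hK, (triBasis hK).interior_convexHull]
  refine ⟨fun h z hz => ?_, fun h z => ?_⟩
  · rw [bary_of_mem hK hz]; exact h _
  · rw [← bary_of_mem hK z.2]; exact h _ z.2

lemma mem_convexHull_face_iff (hK : IsTri K) {s : Set Plane} (hs : s ⊆ K) {x : Plane} :
    x ∈ convexHull ℝ s ↔ x ∈ hull K ∧ ∀ z, z ∉ s → bary K z x = 0 := by
  classical
  constructor
  · intro h
    refine ⟨convexHull_mono hs h, fun z hz => ?_⟩
    have hc : Convex ℝ {y | bary K z y = 0} := by
      have : {y | bary K z y = 0} = (bary K z) ⁻¹' {0} := rfl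
      rw [this]
      exact (convex_singleton (0 : ℝ)).affine_preimage (bary K z)
    refine convexHull_min (fun y hy => ?_) hc h
    exact bary_of_ne hK (hs hy) (fun e => hz (e ▸ hy))
  · rintro ⟨hx, h0⟩
    have hx' := (mem_hull_iff hK).1 hx
    have e : ∑ z ∈ K.filter (· ∈ s), bary K z x • z = x := by
      conv_rhs => rw [← sum_bary_smul hK x]
      rw [Finset.sum_filter]
      refine Finset.sum_congr rfl fun z _ => ?_
      split_ifs with h
      · rfl
      · simp [h0 z h]
    have e1 : ∑ z ∈ K.filter (· ∈ s), bary K z x = 1 := by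
      rw [← sum_bary hK x, Finset.sum_filter]
      refine Finset.sum_congr rfl fun z _ => ?_
      split_ifs with h
      · rfl
      · simp [h0 z h]
    rw [← e]
    exact (convex_convexHull ℝ s).sum_mem (fun z _ => hx' z) e1
      fun z hz => subset_convexHull ℝ s (Finset.mem_filter.1 hz).2

lemma mem_hull_face_iff (hK : IsTri K) {F : Finset Plane} (hF : F ⊆ K) {x : Plane} :
    x ∈ hull F ↔ x ∈ hull K ∧ ∀ z, z ∉ F → bary K z x = 0 := by
  rw [hull, mem_convexHull_face_iff hK (by exact_mod_cast hF)]
  simp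

lemma hull_mono {F : Finset Plane} (hF : F ⊆ K) : hull F ⊆ hull K :=
  convexHull_mono (by exact_mod_cast hF)

lemma convex_hull (K : Finset Plane) : Convex ℝ (hull K) := convex_convexHull ℝ _

lemma isCompact_hull (K : Finset Plane) : IsCompact (hull K) :=
  K.finite_toSet.isCompact_convexHull ℝ

lemma isClosed_hull (K : Finset Plane) : IsClosed (hull K) := (isCompact_hull K).isClosed

lemma vertex_mem_hull {z : Plane} (hz : z ∈ K) : z ∈ hull K :=
  subset_convexHull ℝ _ (by exact_mod_cast hz)

lemma interior_hull_nonempty (hK : IsTri K) : (interior (hull K)).Nonempty := by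
  rw [hull_eq_range hK]
  exact ⟨_, (triBasis hK).centroid_mem_interior_convexHull⟩

lemma closure_interior_hull (hK : IsTri K) : closure (interior (hull K)) = hull K := by
  rw [(convex_hull K).closure_interior_eq_closure_of_nonempty_interior (interior_hull_nonempty hK),
    (isClosed_hull K).closure_eq]

lemma volume_frontier_hull (K : Finset Plane) : volume (frontier (hull K)) = 0 :=
  (convex_hull K).addHaar_frontier _

lemma restrict_hull_eq_interior (K : Finset Plane) :
    (volume : Measure Plane).restrict (hull K) = volume.restrict (interior (hull K)) := by
  refine Measure.restrict_congr_set ?_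
  exact (interior_ae_eq_of_null_frontier (volume_frontier_hull K)).symm

lemma volume_hull_lt_top (K : Finset Plane) : volume (hull K) < ⊤ := (isCompact_hull K).measure_lt_top

/-- The three vertices of a triangle containing an edge. -/
lemma exists_triple_of_edge {F : Finset Plane} (hK : IsTri K) (hF : F ⊆ K) (h2 : F.card = 2) :
    ∃ a b c : Plane, a ≠ b ∧ c ≠ a ∧ c ≠ b ∧ F = {a, b} ∧ K = {c, a, b} := by
  classical
  obtain ⟨a, b, hab, rfl⟩ := Finset.card_eq_two.1 h2
  have : (K \ {a, b}).card = 1 := by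
    rw [Finset.card_sdiff_of_subset hF, hK.1, h2]
  obtain ⟨c, hc⟩ := Finset.card_eq_one.1 this
  have hc' : c ∈ K \ {a, b} := by simp [hc]
  simp only [Finset.mem_sdiff, Finset.mem_insert, Finset.mem_singleton, not_or] at hc'
  refine ⟨a, b, c, hab, hc'.2.1, hc'.2.2, rfl, ?_⟩
  rw [← Finset.sdiff_union_of_subset hF, hc]
  rfl

/-! ### Consequences of the face-to-face property. -/

namespace Triangulation

variable {Ω : Set Plane} (T : Triangulation Ω)

lemma isTri {K : Finset Plane} (hK : K ∈ T.cells) : IsTri K := ⟨T.card_eq K hK, T.indep K hK⟩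

variable {T}
variable {K K' : Finset Plane} {x z : Plane}

/-- By the face-to-face property a common point is a convex combination of common vertices, so all
its other coordinates vanish. -/
lemma mem_of_bary_ne_zero (hK : K ∈ T.cells) (hK' : K' ∈ T.cells) (hx : x ∈ hull K)
    (hx' : x ∈ hull K') (h : bary K z x ≠ 0) : z ∈ K' := by
  have h1 : x ∈ convexHull ℝ ((K : Set Plane) ∩ (K' : Set Plane)) := by
    rw [← T.face_to_face K hK K' hK']; exact ⟨hx, hx'⟩
  by_contra hz
  exact h (((mem_convexHull_face_iff (T.isTri hK) inter_subset_left).1 h1).2 z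
    fun hz' => hz (by exact_mod_cast hz'.2))

/-- The representation of `x` in `K` only involves vertices of `K ∩ K'`, so it is also a
representation in `K'`, where coordinates are unique. This makes functions of the barycentric
coordinates fit together across triangles. -/
lemma bary_eq (hK : K ∈ T.cells) (hK' : K' ∈ T.cells) (hx : x ∈ hull K) (hx' : x ∈ hull K')
    (z : Plane) : bary K z x = bary K' z x := by
  classical
  by_cases hz : z ∈ K'
  · have key (S : Finset Plane) (hS : S ⊆ K) (h0 : ∀ y ∈ K, y ∉ S → bary K y x = 0) :
        ∑ y ∈ S, bary K y x = 1 ∧ ∑ y ∈ S, bary K y x • y = x := by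
      constructor
      · rw [← sum_bary (T.isTri hK) x]
        exact Finset.sum_subset hS h0
      · conv_rhs => rw [← sum_bary_smul (T.isTri hK) x]
        exact Finset.sum_subset hS fun y hy hy' => by simp [h0 y hy hy']
    obtain ⟨e1, e2⟩ := key (K ∩ K') Finset.inter_subset_left fun y hy hy' => by
      by_contra h
      exact hy' (Finset.mem_inter.2 ⟨hy, mem_of_bary_ne_zero hK hK' hx hx' h⟩)
    have f1 : ∑ y ∈ K', bary K y x = 1 := by
      rw [← e1]; symm
      exact Finset.sum_subset Finset.inter_subset_right fun y hy hy' =>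
        bary_notMem (fun h => hy' (Finset.mem_inter.2 ⟨h, hy⟩)) x
    have f2 : ∑ y ∈ K', bary K y x • y = x := by
      conv_rhs => rw [← e2]
      symm
      exact Finset.sum_subset Finset.inter_subset_right fun y hy hy' => by
        rw [bary_notMem (fun h => hy' (Finset.mem_inter.2 ⟨h, hy⟩)) x, zero_smul]
    have := bary_sum_smul (T.isTri hK') (w := fun y => bary K y x) f1 hz
    rw [f2] at this
    exact this.symm
  · rw [bary_notMem hz]
    by_contra h
    exact hz (mem_of_bary_ne_zero hK hK' hx hx' h)

/-- All three coordinates of an interior point are nonzero, so every vertex of `K` is a vertex of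
`K'`. -/
lemma cell_eq_of_interior (hK : K ∈ T.cells) (hK' : K' ∈ T.cells) (hx : x ∈ interior (hull K))
    (hx' : x ∈ hull K') : K = K' := by
  refine Finset.eq_of_subset_of_card_le (fun z hz => ?_) ?_
  · exact mem_of_bary_ne_zero hK hK' (interior_subset hx) hx'
      ((mem_interior_hull_iff (T.isTri hK)).1 hx z hz).ne'
  · rw [T.card_eq K hK, T.card_eq K' hK']

lemma hull_subset_closure (hK : K ∈ T.cells) : hull K ⊆ closure Ω := by
  rw [← T.cover]; exact subset_biUnion_of_mem (u := fun K => hull K) hK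

lemma exists_cell_of_mem (hx : x ∈ Ω) : ∃ K ∈ T.cells, x ∈ hull K := by
  have : x ∈ ⋃ K ∈ T.cells, hull K := by rw [T.cover]; exact subset_closure hx
  simpa using this

variable (T) in
lemma eventually_mem_hull (x : Plane) :
    ∀ᶠ y in 𝓝 x, ∀ K ∈ T.cells, y ∈ hull K → x ∈ hull K := by
  rw [Finset.eventually_all]
  intro K _
  by_cases hx : x ∈ hull K
  · exact Eventually.of_forall fun _ _ => hx
  · filter_upwards [(isClosed_hull K).isOpen_compl.mem_nhds hx] with y hy h using absurd h hy

/-- Near a point of `Ω`, all points lie in a triangle containing this point. -/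
lemma eventually_exists_cell (hΩ : IsOpen Ω) (hx : x ∈ Ω) :
    ∀ᶠ y in 𝓝 x, ∃ K ∈ T.cells, y ∈ hull K ∧ x ∈ hull K := by
  filter_upwards [hΩ.mem_nhds hx, T.eventually_mem_hull x] with y hy h
  obtain ⟨K, hK, hyK⟩ := exists_cell_of_mem (T := T) hy
  exact ⟨K, hK, hyK, h K hK hyK⟩

lemma interior_hull_subset (hΩ' : interior (closure Ω) = Ω) (hK : K ∈ T.cells) :
    interior (hull K) ⊆ Ω := by
  rw [← hΩ']; exact interior_mono (hull_subset_closure hK)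

/-- This is how the hypothesis that `Ω` is the interior of its closure turns local covering by
triangles into membership in `Ω`. -/
lemma mem_of_eventually_exists_cell (hΩ' : interior (closure Ω) = Ω)
    (h : ∀ᶠ y in 𝓝 x, ∃ K ∈ T.cells, y ∈ hull K) : x ∈ Ω := by
  rw [← hΩ', mem_interior_iff_mem_nhds]
  filter_upwards [h] with y ⟨K, hK, hy⟩ using hull_subset_closure hK hy

lemma mem_edges {F : Finset Plane} : F ∈ T.edges ↔ ∃ K ∈ T.cells, F ⊆ K ∧ F.card = 2 := by
  simp [edges]

lemma mem_interiorEdges {F : Finset Plane} : F ∈ T.interiorEdges ↔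
    F.card = 2 ∧ ∃ K ∈ T.cells, ∃ K' ∈ T.cells, K ≠ K' ∧ F ⊆ K ∧ F ⊆ K' := by
  simp only [interiorEdges, Finset.mem_filter, mem_edges]
  constructor
  · rintro ⟨⟨K, hK, h1, h2⟩, h⟩; exact ⟨h2, h⟩
  · rintro ⟨h2, K, hK, K', hK', hne, h, h'⟩; exact ⟨⟨K, hK, h, h2⟩, K, hK, K', hK', hne, h, h'⟩

end Triangulation

namespace Triangulation

variable {Ω : Set Plane} {T : Triangulation Ω} {K K' F : Finset Plane} {x z : Plane}

/-! ### Local topology of a triangulation -/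

lemma combo_mem_nhds {U : Set Plane} (hU : U ∈ 𝓝 x) (y : Plane) :
    ∃ t : ℝ, 0 < t ∧ t < 1 ∧ (1 - t) • x + t • y ∈ U := by
  have hc : ContinuousAt (fun t : ℝ => (1 - t) • x + t • y) 0 := by fun_prop
  have h1 : ∀ᶠ t : ℝ in 𝓝[>] 0, (1 - t) • x + t • y ∈ U := by
    refine nhdsWithin_le_nhds (hc ?_)
    simpa using hU
  have h2 : ∀ᶠ t : ℝ in 𝓝[>] 0, t ∈ Ioo (0 : ℝ) 1 := Ioo_mem_nhdsGT one_pos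
  obtain ⟨t, ht, ht'⟩ := (h1.and h2).exists
  exact ⟨t, ht'.1, ht'.2, ht⟩

lemma eventually_bary_pos (s : Finset Plane) (h : ∀ w ∈ s, 0 < bary K w x) :
    ∀ᶠ y in 𝓝 x, ∀ w ∈ s, 0 < bary K w y := by
  rw [Finset.eventually_all]
  exact fun w hw => (continuous_bary K w).continuousAt.eventually (lt_mem_nhds (h w hw))

/-- If the smallest face containing `x` also contains a point of `Ω`, then `x ∈ Ω`. -/
lemma mem_of_support_subset (hΩ : IsOpen Ω) (hΩ' : interior (closure Ω) = Ω) (hK : K ∈ T.cells)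
    {ν : Plane} (hx : x ∈ hull K) (hν : ν ∈ hull K) (hνΩ : ν ∈ Ω)
    (h : ∀ z, bary K z x = 0 → bary K z ν = 0) : x ∈ Ω := by
  have hKt := T.isTri hK
  -- Moving `ν` slightly towards `x` keeps it in `Ω` and gives it the same nonzero coordinates as
  -- `x`. The translation by `ν' - x` then compares neighbourhoods of `x` and `ν'`.
  obtain ⟨t, ht0, ht1, hν'⟩ := combo_mem_nhds (hΩ.mem_nhds hνΩ) x
  set ν' := (1 - t) • ν + t • x with hν'd
  have hν'K : ν' ∈ hull K := (convex_hull K) hν hx (by linarith) ht0.le (by ring)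
  have hb : ∀ z, bary K z ν' = (1 - t) * bary K z ν + t * bary K z x := fun z => affine_combo _ _ _ _
  have e1 : ∀ᶠ y in 𝓝 x, ∃ K ∈ T.cells, y + (ν' - x) ∈ hull K ∧ ν' ∈ hull K := by
    have hc : Tendsto (fun y => y + (ν' - x)) (𝓝 x) (𝓝 ν') := by
      have : ContinuousAt (fun y => y + (ν' - x)) x := by fun_prop
      simpa [ContinuousAt] using this
    exact hc.eventually (eventually_exists_cell hΩ hν')
  have e2 : ∀ᶠ y in 𝓝 x, ∀ K' ∈ T.cells, ∀ z ∈ K', 0 < bary K' z x → 0 < bary K' z y := by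
    rw [Finset.eventually_all]; intro K' _
    rw [Finset.eventually_all]; intro z _
    by_cases hp : 0 < bary K' z x
    · filter_upwards [(continuous_bary K' z).continuousAt.eventually (lt_mem_nhds hp)] with y hy _
        using hy
    · exact Eventually.of_forall fun _ h => absurd h hp
  refine mem_of_eventually_exists_cell (T := T) hΩ' ?_
  filter_upwards [e1, e2] with y ⟨K', hK', hy, hν'K'⟩ h2
  refine ⟨K', hK', ?_⟩
  have hK't := T.isTri hK'
  have hxK' : x ∈ hull K' := by
    have : x ∈ convexHull ℝ ((K : Set Plane) ∩ K') := by
      rw [mem_convexHull_face_iff hKt inter_subset_left]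
      refine ⟨hx, fun z hz => ?_⟩
      by_contra hne
      have hpos : 0 < bary K z x := lt_of_le_of_ne ((mem_hull_iff hKt).1 hx z) (Ne.symm hne)
      have : bary K z ν' ≠ 0 := by
        rw [hb]
        have := (mem_hull_iff hKt).1 hν z
        have : 0 < t * bary K z x := by positivity
        have : 0 ≤ (1 - t) * bary K z ν := mul_nonneg (by linarith) ‹_›
        linarith
      have hzK' := mem_of_bary_ne_zero hK hK' hν'K hν'K' this
      have hzK : z ∈ K := by by_contra h'; exact hne (bary_notMem h' x)
      exact hz ⟨by exact_mod_cast hzK, by exact_mod_cast hzK'⟩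
    exact convexHull_mono inter_subset_right this
  rw [mem_hull_iff hK't]
  intro z
  by_cases hz : z ∈ K'
  · rcases ((mem_hull_iff hK't).1 hxK' z).lt_or_eq with hp | h0
    · exact (h2 K' hK' z hz hp).le
    -- This coordinate vanishes at both `x` and `ν'`, so it is unchanged by the translation, and the
    -- translated point lies in `K'`.
    · have hx0 : bary K z x = 0 := by rw [bary_eq hK hK' hx hxK', ← h0]
      have hν0 : bary K' z ν' = 0 := by
        rw [← bary_eq hK hK' hν'K hν'K', hb, hx0, h z hx0]; ring
      have l0 : (bary K' z).linear (ν' - x) = 0 := by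
        have := affine_add (bary K' z) x (ν' - x)
        rw [add_sub_cancel, hν0, ← h0] at this
        linarith
      have := (mem_hull_iff hK't).1 hy z
      rwa [affine_add, l0, add_zero] at this
  · rw [bary_notMem hz]

lemma eq_triple {c : Plane} (hK : IsTri K) (hF : F ⊆ K) (h2 : F.card = 2) (hc : c ∈ K)
    (hcF : c ∉ F) : insert c F = K := by
  classical
  refine Finset.eq_of_subset_of_card_le (Finset.insert_subset hc hF) ?_
  rw [Finset.card_insert_of_notMem hcF, h2, hK.1]

lemma exists_opposite (hK : IsTri K) (h2 : F.card = 2) : ∃ c ∈ K, c ∉ F := by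
  by_contra! h
  have := Finset.card_le_card (show K ⊆ F from h)
  rw [hK.1, h2] at this; omega

lemma bary_midpt (hK : IsTri K) (hF : F ⊆ K) (h2 : F.card = 2) (z : Plane) (hz : z ∈ K) :
    bary K z (midpt F) = if z ∈ F then 1 / 2 else 0 := by
  classical
  have e : midpt F = ∑ y ∈ F, (1 / 2 : ℝ) • y := by rw [midpt, Finset.smul_sum]
  rw [e, affine_sum_smul _ _ _ _ (by rw [Finset.sum_const, h2]; norm_num)]
  split_ifs with h
  · rw [Finset.sum_eq_single_of_mem z h, bary_self hK hz, mul_one]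
    intro y hy hyz
    rw [bary_of_ne hK (hF hy) hyz.symm, mul_zero]
  · exact Finset.sum_eq_zero fun y hy => by
      rw [bary_of_ne hK (hF hy) (ne_of_mem_of_not_mem hy h).symm, mul_zero]

lemma midpt_mem_hull (h2 : F.card = 2) : midpt F ∈ hull F := by
  have e : midpt F = ∑ y ∈ F, (1 / 2 : ℝ) • y := by rw [midpt, Finset.smul_sum]
  rw [e]
  exact (convex_hull F).sum_mem (fun _ _ => by norm_num)
    (by rw [Finset.sum_const, h2]; norm_num) fun z hz => vertex_mem_hull hz

/-- An edge meeting `Ω` is shared. -/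
lemma exists_other_cell (hΩ : IsOpen Ω) (hK : K ∈ T.cells) (hF : F ⊆ K) (h2 : F.card = 2)
    (hx : x ∈ hull F) (hxΩ : x ∈ Ω) : ∃ K' ∈ T.cells, K' ≠ K ∧ F ⊆ K' := by
  have hKt := T.isTri hK
  -- Pushing `x` towards the midpoint reaches the relative interior of the edge without leaving `Ω`;
  -- any triangle containing the new point contains both endpoints.
  obtain ⟨t, ht0, ht1, hx'⟩ := combo_mem_nhds (hΩ.mem_nhds hxΩ) (midpt F)
  obtain ⟨x', hx'd⟩ : ∃ x', x' = (1 - t) • x + t • midpt F := ⟨_, rfl⟩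
  rw [← hx'd] at hx'
  have hxK := ((mem_hull_face_iff hKt hF).1 hx).1
  have hx'F : x' ∈ hull F := hx'd ▸
    (convex_hull F) hx (midpt_mem_hull h2) (by linarith) ht0.le (by ring)
  have hpos : ∀ z ∈ F, bary K z x' ≠ 0 := fun z hz => by
    rw [hx'd, affine_combo, bary_midpt hKt hF h2 z (hF hz), if_pos hz]
    have : 0 ≤ (1 - t) * bary K z x :=
      mul_nonneg (by linarith) ((mem_hull_iff hKt).1 hxK z)
    linarith
  obtain ⟨c, hc, hcF⟩ := exists_opposite (F := F) hKt h2
  -- The reflection of the opposite vertex `c` in `x'` has negative `c`-coordinate, so a small step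
  -- towards it leaves `K` while staying in `Ω`.
  obtain ⟨s, hs0, hs1, K', hK', hy, hx'K'⟩ :=
    combo_mem_nhds (eventually_exists_cell (T := T) hΩ hx') ((2 : ℝ) • x' - c)
  have hx'K := ((mem_hull_face_iff hKt hF).1 hx'F)
  refine ⟨K', hK', ?_, fun z hz => mem_of_bary_ne_zero hK hK' hx'K.1 hx'K' (hpos z hz)⟩
  rintro rfl
  have e : (2 : ℝ) • x' - c = ((1 : ℝ) - 2) • c + (2 : ℝ) • x' := by
    module
  have := (mem_hull_iff hKt).1 hy c
  rw [affine_combo, e, affine_combo, hx'K.2 c hcF, bary_self hKt hc] at this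
  linarith

/-- Both sides are affine in `y`, vanish on `F` and agree at `c'`. Hence only the sign of `bary K c
c'` decides whether the two opposite vertices lie on the same side of the edge. -/
lemma bary_eq_mul {c c' : Plane} (hK : IsTri K) (hK' : IsTri K') (hF : F ⊆ K) (hF' : F ⊆ K')
    (h2 : F.card = 2) (hcF : c ∉ F) (hc' : c' ∈ K') (hc'F : c' ∉ F) (y : Plane) :
    bary K c y = bary K' c' y * bary K c c' := by
  classical
  conv_lhs => rw [← sum_bary_smul hK' y, affine_sum_smul _ _ _ _ (sum_bary hK' y)]
  refine Finset.sum_eq_single_of_mem c' hc' fun z hz hzc => ?_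
  rw [← eq_triple hK' hF' h2 hc' hc'F] at hz
  have hzF := (Finset.mem_insert.1 hz).resolve_left hzc
  rw [bary_of_ne hK (hF hzF) (ne_of_mem_of_not_mem hzF hcF).symm, mul_zero]

/-- Two triangles sharing an edge lie on opposite sides of it. -/
lemma bary_opposite_neg {c c' : Plane} (hK : K ∈ T.cells) (hK' : K' ∈ T.cells) (hne : K ≠ K')
    (hF : F ⊆ K) (hF' : F ⊆ K') (h2 : F.card = 2) (hc : c ∈ K) (hcF : c ∉ F) (hc' : c' ∈ K')
    (hc'F : c' ∉ F) : bary K c c' < 0 := by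
  have hKt := T.isTri hK
  have hK't := T.isTri hK'
  by_contra! hge
  have hm : ∀ᶠ y in 𝓝 (midpt F), ∀ w ∈ F, 0 < bary K w y :=
    eventually_bary_pos F fun w hw => by rw [bary_midpt hKt hF h2 w (hF hw), if_pos hw]; norm_num
  -- Were `c'` on the same side as `c`, a point slightly off the midpoint towards `c'` would lie in
  -- both triangles with nonzero `c'`-coordinate, making `c'` a vertex of `K`.
  obtain ⟨s, hs0, hs1, hy⟩ := combo_mem_nhds hm c'
  set y := (1 - s) • midpt F + s • c' with hyd
  have hyK' : y ∈ hull K' := (convex_hull K') (hull_mono hF' (midpt_mem_hull h2))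
    (vertex_mem_hull hc') (by linarith) hs0.le (by ring)
  have hyK : y ∈ hull K := by
    rw [mem_hull_iff hKt]
    intro z
    by_cases hz : z ∈ K
    · rw [← eq_triple hKt hF h2 hc hcF] at hz
      rcases Finset.mem_insert.1 hz with rfl | hz
      · rw [hyd, affine_combo, bary_midpt hKt hF h2 z hc, if_neg hcF]
        have : 0 ≤ s * bary K z c' := mul_nonneg hs0.le hge
        linarith
      · exact (hy z hz).le
    · rw [bary_notMem hz]
  have hc'K : c' ∈ K := mem_of_bary_ne_zero hK' hK hyK' hyK (by
    rw [hyd, affine_combo, bary_midpt hK't hF' h2 c' hc', if_neg hc'F, bary_self hK't hc']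
    linarith)
  exact hne ((eq_triple hKt hF h2 hc'K hc'F).symm.trans (eq_triple hK't hF' h2 hc' hc'F))

/-- The relative interior of a shared edge is contained in `Ω`. -/
lemma mem_of_shared (hΩ' : interior (closure Ω) = Ω) (hK : K ∈ T.cells) (hK' : K' ∈ T.cells)
    (hne : K ≠ K') (hF : F ⊆ K) (hF' : F ⊆ K') (h2 : F.card = 2) (hx : x ∈ hull F)
    (hpos : ∀ z ∈ F, bary K z x ≠ 0) : x ∈ Ω := by
  have hKt := T.isTri hK
  have hK't := T.isTri hK'
  have hxK := ((mem_hull_face_iff hKt hF).1 hx).1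
  have hxK' := ((mem_hull_face_iff hK't hF').1 hx).1
  obtain ⟨c, hc, hcF⟩ := exists_opposite (F := F) hKt h2
  obtain ⟨c', hc', hc'F⟩ := exists_opposite (F := F) hK't h2
  have hp : ∀ z ∈ F, 0 < bary K z x := fun z hz =>
    lt_of_le_of_ne ((mem_hull_iff hKt).1 hxK z) (hpos z hz).symm
  have hneg := bary_opposite_neg hK hK' hne hF hF' h2 hc hcF hc' hc'F
  refine mem_of_eventually_exists_cell (T := T) hΩ' ?_
  filter_upwards [eventually_bary_pos (K := K) F hp, eventually_bary_pos (K := K') F fun z hz => by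
    rw [← bary_eq hK hK' hxK hxK']; exact hp z hz] with y h1 h1'
  have aux {K : Finset Plane} {c : Plane} (hKt : IsTri K) (hF : F ⊆ K) (hc : c ∈ K) (hcF : c ∉ F)
      (h1 : ∀ w ∈ F, 0 < bary K w y) (h : 0 ≤ bary K c y) : y ∈ hull K := by
    rw [mem_hull_iff hKt]
    intro z
    by_cases hz : z ∈ K
    · rw [← eq_triple hKt hF h2 hc hcF] at hz
      rcases Finset.mem_insert.1 hz with rfl | hz
      · exact h
      · exact (h1 z hz).le
    · rw [bary_notMem hz]
  by_cases h : 0 ≤ bary K c y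
  · exact ⟨K, hK, aux hKt hF hc hcF h1 h⟩
  · refine ⟨K', hK', aux hK't hF' hc' hc'F h1' ?_⟩
    rw [bary_eq_mul hKt hK't hF hF' h2 hcF hc' hc'F y] at h
    by_contra! h0
    exact h (mul_pos_of_neg_of_neg h0 hneg).le

/-- Three opposite vertices cannot lie pairwise on opposite sides of a line: multiplying two of the
negative coordinates contradicts the sign of the third. -/
lemma two_cells_per_edge {K₁ K₂ K₃ : Finset Plane} (h1 : K₁ ∈ T.cells) (h2 : K₂ ∈ T.cells)
    (h3 : K₃ ∈ T.cells) (hF1 : F ⊆ K₁) (hF2 : F ⊆ K₂) (hF3 : F ⊆ K₃) (hc : F.card = 2)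
    (h12 : K₁ ≠ K₂) (h13 : K₁ ≠ K₃) : K₂ = K₃ := by
  by_contra h23
  obtain ⟨c1, hc1, hc1F⟩ := exists_opposite (F := F) (T.isTri h1) hc
  obtain ⟨c2, hc2, hc2F⟩ := exists_opposite (F := F) (T.isTri h2) hc
  obtain ⟨c3, hc3, hc3F⟩ := exists_opposite (F := F) (T.isTri h3) hc
  have n12 := bary_opposite_neg h1 h2 h12 hF1 hF2 hc hc1 hc1F hc2 hc2F
  have n13 := bary_opposite_neg h1 h3 h13 hF1 hF3 hc hc1 hc1F hc3 hc3F
  have n23 := bary_opposite_neg h2 h3 h23 hF2 hF3 hc hc2 hc2F hc3 hc3F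
  have := bary_eq_mul (T.isTri h1) (T.isTri h2) hF1 hF2 hc hc1F hc2 hc2F c3
  nlinarith [mul_pos_of_neg_of_neg n23 n12]

/-! ### The triangles around a vertex -/

variable (T) in
/-- Triangles around `z` are adjacent if they share an edge that contains `z`. -/
def fanGraph (z : Plane) : SimpleGraph (Finset Plane) where
  Adj K K' := K ≠ K' ∧ K ∈ T.cells ∧ K' ∈ T.cells ∧
    ∃ F : Finset Plane, F.card = 2 ∧ z ∈ F ∧ F ⊆ K ∧ F ⊆ K'
  symm := ⟨fun _ _ ⟨h, h1, h2, F, hF, hz, h3, h4⟩ => ⟨h.symm, h2, h1, F, hF, hz, h4, h3⟩⟩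
  loopless := ⟨fun _ h => h.1 rfl⟩

/-- The cone with apex `z` spanned by `K`. -/
def cone (K : Finset Plane) (z : Plane) : Set Plane := {x | ∀ w, w ≠ z → 0 ≤ bary K w x}

lemma isClosed_cone (K : Finset Plane) (z : Plane) : IsClosed (cone K z) := by
  have : cone K z = ⋂ w, ⋂ _ : w ≠ z, {x | 0 ≤ bary K w x} := by ext; simp [cone]
  rw [this]
  exact isClosed_iInter fun w => isClosed_iInter fun _ =>
    isClosed_le continuous_const (continuous_bary K w)

lemma reachable_mem {K₀ : Finset Plane} (hK₀ : K₀ ∈ T.cells) (hz : z ∈ K₀)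
    (h : (T.fanGraph z).Reachable K₀ K) : K ∈ T.cells ∧ z ∈ K := by
  rw [SimpleGraph.reachable_iff_reflTransGen] at h
  induction h with
  | refl => exact ⟨hK₀, hz⟩
  | tail _ hadj _ =>
    obtain ⟨_, _, h, F, _, hzF, _, hF⟩ := hadj
    exact ⟨h, hF hzF⟩

/-- The coordinates of `F` other than the one at the apex stay positive near `x`, so only the side
of the edge matters: one side belongs to the cone of `K`, the other to that of `K'`. -/
lemma cone_nhds_edge {b c' : Plane} (hK : K ∈ T.cells) (hK' : K' ∈ T.cells)
    (hne : K ≠ K') (hF : F ⊆ K) (hF' : F ⊆ K') (h2 : F.card = 2) (hb : b ∈ K)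
    (hbF : b ∉ F) (hc' : c' ∈ K') (hc'F : c' ∉ F) (hx : ∀ w ∈ F, w ≠ z → 0 < bary K w x)
    (hx0 : bary K b x = 0) : ∀ᶠ y in 𝓝 x, y ∈ cone K z ∪ cone K' z := by
  classical
  have hKt := T.isTri hK
  have hK't := T.isTri hK'
  have hneg := bary_opposite_neg hK hK' hne hF hF' h2 hb hbF hc' hc'F
  have hx' : ∀ w ∈ F, w ≠ z → 0 < bary K' w x := by
    intro w hw hwz
    have e : ∑ y ∈ F, bary K y x • y = x ∧ ∑ y ∈ F, bary K y x = 1 := by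
      constructor
      · conv_rhs => rw [← sum_bary_smul hKt x, ← eq_triple hKt hF h2 hb hbF,
          Finset.sum_insert hbF]
        rw [eq_triple hKt hF h2 hb hbF, hx0, zero_smul, zero_add]
      · rw [← sum_bary hKt x]
        conv_rhs => rw [← eq_triple hKt hF h2 hb hbF, Finset.sum_insert hbF]
        rw [eq_triple hKt hF h2 hb hbF, hx0, zero_add]
    rw [← e.1, affine_sum_smul _ _ _ _ e.2, Finset.sum_eq_single_of_mem w hw,
      bary_self hK't (hF' hw), mul_one]
    · exact hx w hw hwz
    · intro y hy hyw
      rw [bary_of_ne hK't (hF' hy) hyw.symm, mul_zero]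
  filter_upwards [eventually_bary_pos (K := K) (F.erase z) fun w hw =>
      hx w (Finset.mem_of_mem_erase hw) (Finset.ne_of_mem_erase hw),
    eventually_bary_pos (K := K') (F.erase z) fun w hw =>
      hx' w (Finset.mem_of_mem_erase hw) (Finset.ne_of_mem_erase hw)] with y h1 h1'
  have aux {K : Finset Plane} {c : Plane} (hKt : IsTri K) (hF : F ⊆ K) (hc : c ∈ K) (hcF : c ∉ F)
      (h1 : ∀ w ∈ F.erase z, 0 < bary K w y) (h : 0 ≤ bary K c y) : y ∈ cone K z := by
    intro w hwz
    by_cases hz : w ∈ K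
    · rw [← eq_triple hKt hF h2 hc hcF] at hz
      rcases Finset.mem_insert.1 hz with rfl | hz
      · exact h
      · exact (h1 w (Finset.mem_erase.2 ⟨hwz, hz⟩)).le
    · rw [bary_notMem hz]
  by_cases h : 0 ≤ bary K b y
  · exact Or.inl (aux hKt hF hb hbF h1 h)
  · refine Or.inr (aux hK't hF' hc' hc'F h1' ?_)
    rw [bary_eq_mul hKt hK't hF hF' h2 hbF hc' hc'F y] at h
    by_contra! h0
    exact h (mul_pos_of_neg_of_neg h0 hneg).le

/-- If all edges at `z` of the triangles reachable from `K₀` are shared, then these triangles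
surround `z`. -/
lemma cones_cover {K₀ : Finset Plane} (hK₀ : K₀ ∈ T.cells) (hz : z ∈ K₀)
    (H : ∀ K, (T.fanGraph z).Reachable K₀ K → ∀ F ⊆ K, F.card = 2 → z ∈ F →
      ∃ K' ∈ T.cells, K' ≠ K ∧ F ⊆ K') (x : Plane) :
    ∃ K, (T.fanGraph z).Reachable K₀ K ∧ x ∈ cone K z := by
  classical
  set C : Finset (Finset Plane) := T.cells.filter fun K => (T.fanGraph z).Reachable K₀ K with hC
  set U : Set Plane := ⋃ K ∈ C, cone K z with hU
  have hUc : IsClosed U := isClosed_biUnion_finset fun K _ => isClosed_cone K z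
  have hmem : ∀ K, (T.fanGraph z).Reachable K₀ K → K ∈ C := fun K h =>
    Finset.mem_filter.2 ⟨(reachable_mem hK₀ hz h).1, h⟩
  -- `U` is closed as a finite union of cones. It is also a neighbourhood of each of its points
  -- except possibly the apex, because a point on the side of a cone lies on a shared edge direction
  -- and the neighbouring cone continues there.
  have hopen : ∀ y ∈ U, y ≠ z → U ∈ 𝓝 y := by
    intro y hy hyz
    obtain ⟨K, hKC, hyK⟩ := mem_iUnion₂.1 hy
    obtain ⟨hK, hr⟩ := Finset.mem_filter.1 hKC
    have hzK := (reachable_mem hK₀ hz hr).2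
    have hKt := T.isTri hK
    have hsub : cone K z ⊆ U := subset_biUnion_of_mem (u := fun K => cone K z) hKC
    by_cases hall : ∀ w ∈ K.erase z, 0 < bary K w y
    · filter_upwards [eventually_bary_pos _ hall] with v hv
      refine hsub fun w hw => ?_
      by_cases hwK : w ∈ K
      · exact (hv w (Finset.mem_erase.2 ⟨hw, hwK⟩)).le
      · rw [bary_notMem hwK]
    · push Not at hall
      obtain ⟨b, hb, hb0⟩ := hall
      obtain ⟨hbz, hbK⟩ := Finset.mem_erase.1 hb
      have hb0 : bary K b y = 0 := le_antisymm hb0 (hyK b hbz)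
      have hF : K.erase b ⊆ K := Finset.erase_subset _ _
      have h2 : (K.erase b).card = 2 := by rw [Finset.card_erase_of_mem hbK, hKt.1]
      have hzF : z ∈ K.erase b := Finset.mem_erase.2 ⟨hbz.symm, hzK⟩
      obtain ⟨K', hK', hne, hF'⟩ := H K hr _ hF h2 hzF
      obtain ⟨c', hc', hc'F⟩ := exists_opposite (F := K.erase b) (T.isTri hK') h2
      -- If both coordinates away from the apex vanished, `y` would be the apex.
      have hpos : ∀ w ∈ K.erase b, w ≠ z → 0 < bary K w y := by
        intro w hw hwz
        refine lt_of_le_of_ne (hyK w hwz) fun h0 => hyz ?_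
        rw [← sum_bary_smul hKt y]
        have hz1 : bary K z y = 1 := by
          rw [← sum_bary hKt y]
          symm
          apply Finset.sum_eq_single_of_mem z hzK
          intro u hu huz
          by_cases hub : u = b
          · rw [hub, hb0]
          · by_cases huw : u = w
            · rw [huw, ← h0]
            · exfalso
              have h3 : ({z, b, w, u} : Finset Plane) ⊆ K := by
                intro v; simp only [Finset.mem_insert, Finset.mem_singleton]
                rintro (rfl | rfl | rfl | rfl) <;> first | assumption | exact hF hw
              have := Finset.card_le_card h3
              rw [hKt.1, Finset.card_insert_of_notMem, Finset.card_insert_of_notMem,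
                Finset.card_insert_of_notMem, Finset.card_singleton] at this
              · omega
              · simpa using Ne.symm huw
              · simp only [Finset.mem_insert, Finset.mem_singleton, not_or]
                exact ⟨(Finset.ne_of_mem_erase hw).symm, Ne.symm hub⟩
              · simp only [Finset.mem_insert, Finset.mem_singleton, not_or]
                exact ⟨hbz.symm, hwz.symm, huz.symm⟩
        have hw0 : ∀ u ∈ K, u ≠ z → bary K u y = 0 := by
          have hs := sum_bary hKt y
          rw [← Finset.add_sum_erase _ _ hzK, hz1] at hs
          have hs' : ∑ u ∈ K.erase z, bary K u y = 0 := by linarith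
          rw [Finset.sum_eq_zero_iff_of_nonneg fun u hu => hyK u (Finset.ne_of_mem_erase hu)] at hs'
          exact fun u hu huz => hs' u (Finset.mem_erase.2 ⟨huz, hu⟩)
        rw [Finset.sum_eq_single_of_mem z hzK fun u hu huz => by rw [hw0 u hu huz, zero_smul], hz1,
          one_smul]
      have hK'C : K' ∈ C := hmem K' (hr.trans (SimpleGraph.Adj.reachable
        ⟨hne.symm, hK, hK', _, h2, hzF, hF, hF'⟩))
      filter_upwards [cone_nhds_edge hK hK' hne.symm hF hF' h2 hbK (Finset.notMem_erase b K) hc'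
        hc'F hpos hb0] with v hv
      rcases hv with hv | hv
      · exact hsub hv
      · exact subset_biUnion_of_mem (u := fun K => cone K z) hK'C hv
  have hzU : z ∈ U := mem_iUnion₂.2 ⟨K₀, hmem K₀ (SimpleGraph.Reachable.refl _), fun w hw => by
    rw [bary_of_ne (T.isTri hK₀) hz hw]⟩
  have hrank : 1 < Module.rank ℝ Plane := by
    rw [← Module.finrank_eq_rank, finrank_euclideanSpace_fin]; norm_num
  have hconn := (isConnected_compl_singleton_of_one_lt_rank hrank z).isPreconnected
  -- The punctured plane is connected, and `U` is relatively clopen and nonempty in it.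
  have hsub : ({z}ᶜ : Set Plane) ⊆ interior U := by
    refine hconn.subset_of_closure_inter_subset isOpen_interior ?_ ?_
    · obtain ⟨a, ha, haz⟩ : ∃ a ∈ K₀, a ≠ z := by
        have : 1 < K₀.card := by rw [T.card_eq K₀ hK₀]; norm_num
        exact Finset.exists_mem_ne this z
      refine ⟨a, haz, mem_interior_iff_mem_nhds.2 (hopen a ?_ haz)⟩
      refine mem_iUnion₂.2 ⟨K₀, hmem K₀ (SimpleGraph.Reachable.refl _), fun w _ => ?_⟩
      exact (mem_hull_iff (T.isTri hK₀)).1 (vertex_mem_hull ha) w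
    · rintro y ⟨hy, hyz⟩
      have : y ∈ U := hUc.closure_subset_iff.2 interior_subset hy
      exact mem_interior_iff_mem_nhds.2 (hopen y this hyz)
  have hxU : x ∈ U := by
    by_cases hxz : x = z
    · rw [hxz]; exact hzU
    · exact interior_subset (hsub hxz)
  obtain ⟨K, hKC, hxK⟩ := mem_iUnion₂.1 hxU
  exact ⟨K, (Finset.mem_filter.1 hKC).2, hxK⟩

-- Close to the apex its own coordinate is close to 1, so the cone inequalities are the only ones
-- left to satisfy.
variable (T) in
lemma eventually_cone_subset (z : Plane) :
    ∀ᶠ y in 𝓝 z, ∀ K ∈ T.cells, z ∈ K → y ∈ cone K z → y ∈ hull K := by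
  rw [Finset.eventually_all]
  intro K hK
  by_cases hz : z ∈ K
  · filter_upwards [eventually_bary_pos (K := K) {z} (x := z) (by
      simp [bary_self (T.isTri hK) hz])] with y hy _ hyc
    rw [mem_hull_iff (T.isTri hK)]
    intro w
    by_cases hw : w = z
    · rw [hw]; exact (hy z (Finset.mem_singleton_self z)).le
    · exact hyc w hw
  · exact Eventually.of_forall fun _ h => absurd h hz

/-- The triangles around an interior vertex are connected. -/
lemma reachable_of_mem (hΩ : IsOpen Ω) (hz : z ∈ Ω) (hK : K ∈ T.cells) (hzK : z ∈ K)
    (hK' : K' ∈ T.cells) (hzK' : z ∈ K') : (T.fanGraph z).Reachable K K' := by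
  have H : ∀ L, (T.fanGraph z).Reachable K L → ∀ F ⊆ L, F.card = 2 → z ∈ F →
      ∃ K' ∈ T.cells, K' ≠ L ∧ F ⊆ K' := fun L hr F hF h2 hzF =>
    exists_other_cell hΩ (reachable_mem hK hzK hr).1 hF h2 (vertex_mem_hull hzF) hz
  have hK't := T.isTri hK'
  obtain ⟨p, hp⟩ := interior_hull_nonempty hK't
  rw [mem_interior_hull_iff hK't] at hp
  obtain ⟨L, hr, hpL⟩ := cones_cover hK hzK H p
  obtain ⟨hL, hzL⟩ := reachable_mem hK hzK hr
  -- Shrinking `p` towards `z` puts it into the reachable triangle `L` while keeping it in the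
  -- interior of `K'`, so the two triangles are equal.
  obtain ⟨t, ht0, ht1, hy⟩ := combo_mem_nhds (T.eventually_cone_subset z) p
  have hyL := hy L hL hzL fun w hw => by
    rw [affine_combo, bary_of_ne (T.isTri hL) hzL hw]
    have := mul_nonneg ht0.le (hpL w hw)
    linarith
  have hyK' : (1 - t) • z + t • p ∈ interior (hull K') := by
    rw [mem_interior_hull_iff hK't]
    intro w hw
    rw [affine_combo]
    have h1 := mul_pos ht0 (hp w hw)
    have h2 := mul_nonneg (sub_nonneg.2 ht1.le)
      ((mem_hull_iff hK't).1 (vertex_mem_hull hzK') w)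
    linarith
  rw [cell_eq_of_interior hK' hL hyK' hyL]
  exact hr

/-- From each triangle at a boundary vertex one reaches a boundary edge. -/
lemma exists_reachable_boundary_edge (hΩ' : interior (closure Ω) = Ω) (hz : z ∉ Ω)
    (hK : K ∈ T.cells) (hzK : z ∈ K) :
    ∃ L, (T.fanGraph z).Reachable K L ∧ ∃ F ⊆ L, F.card = 2 ∧ z ∈ F ∧
      ∀ K' ∈ T.cells, F ⊆ K' → K' = L := by
  by_contra! hcon
  refine hz (mem_of_eventually_exists_cell (T := T) hΩ' ?_)
  filter_upwards [T.eventually_cone_subset z] with y hy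
  obtain ⟨L, hr, hyL⟩ := cones_cover hK hzK (fun L hr F hF h2 hzF => by
    obtain ⟨K', h1, h2, h3⟩ := hcon L hr F hF h2 hzF
    exact ⟨K', h1, h3, h2⟩) y
  obtain ⟨hL, hzL⟩ := reachable_mem hK hzK hr
  exact ⟨L, hL, hy L hL hzL hyL⟩

open Classical in
variable (T) in
/-- The triangles containing the point `x`. -/
def cellsAt (x : Plane) : Finset (Finset Plane) := T.cells.filter fun K => x ∈ hull K

lemma mem_cellsAt : K ∈ T.cellsAt x ↔ K ∈ T.cells ∧ x ∈ hull K := by simp [cellsAt]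

/-- Telescoping along a path without repeated triangles, which has one step less than there are
triangles at `z`. The spare `a` on the left leaves room for the value at a boundary edge in
`value_bound`. -/
lemma sub_le_of_reachable {K₀ : Finset Plane} (hK₀ : K₀ ∈ T.cells) (hz : z ∈ K₀)
    (h : (T.fanGraph z).Reachable K₀ K) (g : Finset Plane → ℝ) {a : ℝ} (ha : 0 ≤ a)
    (hg : ∀ K K', (T.fanGraph z).Adj K K' → |g K - g K'| ≤ a) :
    |g K₀ - g K| + a ≤ (T.cellsAt z).card * a := by
  classical
  obtain ⟨p, hp⟩ := h.exists_isPath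
  have h1 : |g K₀ - g K| ≤ p.length * a := by
    clear hp h hz hK₀
    induction p with
    | nil => simp
    | @cons u v w huv p ih =>
      rw [SimpleGraph.Walk.length_cons]
      push_cast
      have := abs_sub_le (g u) (g v) (g w)
      have := hg u v huv
      linarith
  have h2 : p.length + 1 ≤ (T.cellsAt z).card := by
    rw [← SimpleGraph.Walk.length_support, ← List.toFinset_card_of_nodup hp.support_nodup]
    refine Finset.card_le_card fun L hL => ?_
    have := reachable_mem hK₀ hz (p.takeUntil L (List.mem_toFinset.1 hL)).reachable
    exact mem_cellsAt.2 ⟨this.1, vertex_mem_hull this.2⟩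
  have : ((p.length + 1 : ℕ) : ℝ) * a ≤ (T.cellsAt z).card * a := by
    gcongr
  push_cast at this
  linarith

/-- Values attached to the triangles around a point `x` are controlled by the differences across
the edges containing `x` and the values at the boundary edges containing `x`. -/
lemma value_bound (hΩ : IsOpen Ω) (hΩ' : interior (closure Ω) = Ω) (hK : K ∈ T.cells)
    (hx : x ∈ hull K) (g : Finset Plane → ℝ) {a : ℝ} (ha : 0 ≤ a)
    (h1 : ∀ K ∈ T.cells, ∀ K' ∈ T.cells, ∀ F ⊆ K, F ⊆ K' → K ≠ K' → F.card = 2 → x ∈ hull F →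
      |g K - g K'| ≤ a)
    (h2 : ∀ K ∈ T.cells, ∀ F ⊆ K, F.card = 2 → x ∈ hull F → (∀ K' ∈ T.cells, F ⊆ K' → K' = K) →
      |g K| ≤ a) :
    (x ∈ Ω → ∀ K' ∈ T.cells, x ∈ hull K' → |g K - g K'| ≤ (T.cellsAt x).card * a) ∧
      (x ∉ Ω → |g K| ≤ (T.cellsAt x).card * a) := by
  classical
  have hKt := T.isTri hK
  have hN : a ≤ (T.cellsAt x).card * a := by
    have : 0 < (T.cellsAt x).card := Finset.card_pos.2 ⟨K, mem_cellsAt.2 ⟨hK, hx⟩⟩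
    have : (1 : ℝ) ≤ (T.cellsAt x).card := by exact_mod_cast this
    nlinarith
  have hself : |g K - g K| ≤ (T.cellsAt x).card * a := by
    rw [sub_self, abs_zero]; exact ha.trans hN
  -- Three positions of `x`: at a vertex, where the walk around it is needed; in the interior, where
  -- there is only one triangle; in the relative interior of an edge, where at most one edge is
  -- crossed.
  by_cases hv : ∃ z ∈ K, x = z
  · obtain ⟨z, hzK, rfl⟩ := hv
    have hadj : ∀ K K', (T.fanGraph x).Adj K K' → |g K - g K'| ≤ a := by
      rintro K K' ⟨hne, hK, hK', F, h2, hxF, hF, hF'⟩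
      exact h1 K hK K' hK' F hF hF' hne h2 (vertex_mem_hull hxF)
    constructor
    · intro hxΩ K' hK' hxK'
      have hxK'' : x ∈ K' := mem_of_bary_ne_zero hK hK' hx hxK'
        (by rw [bary_self hKt hzK]; exact one_ne_zero)
      have := sub_le_of_reachable hK hzK (reachable_of_mem hΩ hxΩ hK hzK hK' hxK'') g ha hadj
      linarith
    · intro hxΩ
      obtain ⟨L, hr, F, hF, hF2, hxF, hu⟩ := exists_reachable_boundary_edge hΩ' hxΩ hK hzK
      have := sub_le_of_reachable hK hzK hr g ha hadj
      have h3 := h2 L (reachable_mem hK hzK hr).1 F hF hF2 (vertex_mem_hull hxF) hu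
      have := abs_sub_abs_le_abs_sub (g K) (g L)
      linarith
  · by_cases hint : x ∈ interior (hull K)
    · refine ⟨fun _ K' hK' hxK' => ?_, fun h => absurd (interior_hull_subset hΩ' hK hint) h⟩
      rw [← cell_eq_of_interior hK hK' hint hxK']
      exact hself
    · obtain ⟨c, hc, hc0⟩ : ∃ c ∈ K, bary K c x = 0 := by
        rw [mem_interior_hull_iff hKt] at hint
        push Not at hint
        obtain ⟨c, hc, h⟩ := hint
        exact ⟨c, hc, le_antisymm h ((mem_hull_iff hKt).1 hx c)⟩
      have hF : K.erase c ⊆ K := Finset.erase_subset _ _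
      have hF2 : (K.erase c).card = 2 := by rw [Finset.card_erase_of_mem hc, hKt.1]
      have hxF : x ∈ hull (K.erase c) := by
        rw [mem_hull_face_iff hKt hF]
        refine ⟨hx, fun z hz => ?_⟩
        by_cases hzK : z ∈ K
        · have : z = c := by by_contra h; exact hz (Finset.mem_erase.2 ⟨h, hzK⟩)
          rw [this, hc0]
        · exact bary_notMem hzK x
      -- A second vanishing coordinate would make `x` a vertex, which is excluded here.
      have hpos : ∀ z ∈ K.erase c, bary K z x ≠ 0 := by
        intro z hz h0
        refine hv ?_
        obtain ⟨u, hu, huz⟩ : ∃ u ∈ K.erase c, u ≠ z :=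
          Finset.exists_mem_ne (by rw [hF2]; norm_num) z
        have e : K = {c, z, u} := by
          symm
          refine Finset.eq_of_subset_of_card_le ?_ ?_
          · intro v; simp only [Finset.mem_insert, Finset.mem_singleton]
            rintro (rfl | rfl | rfl)
            exacts [hc, hF hz, hF hu]
          · rw [hKt.1, Finset.card_insert_of_notMem, Finset.card_insert_of_notMem,
              Finset.card_singleton]
            · simpa using huz.symm
            · simp only [Finset.mem_insert, Finset.mem_singleton, not_or]
              exact ⟨(Finset.ne_of_mem_erase hz).symm, (Finset.ne_of_mem_erase hu).symm⟩
        have hs0 : ∀ v ∈ K, v ≠ u → bary K v x = 0 := by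
          intro v hv hvu
          rw [e] at hv
          simp only [Finset.mem_insert, Finset.mem_singleton] at hv
          rcases hv with rfl | rfl | rfl
          exacts [hc0, h0, absurd rfl hvu]
        refine ⟨u, hF hu, ?_⟩
        have h3 := sum_bary hKt x
        have h4 := sum_bary_smul hKt x
        rw [Finset.sum_eq_single_of_mem u (hF hu) hs0] at h3
        rw [Finset.sum_eq_single_of_mem u (hF hu) fun v hv hvu => by rw [hs0 v hv hvu, zero_smul],
          h3, one_smul] at h4
        exact h4.symm
      constructor
      · intro _ K' hK' hxK'
        by_cases hne : K = K'
        · rw [← hne]; exact hself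
        · refine (h1 K hK K' hK' _ hF (fun z hz => ?_) hne hF2 hxF).trans hN
          exact mem_of_bary_ne_zero hK hK' hx hxK' (hpos z hz)
      · intro hxΩ
        refine (h2 K hK _ hF hF2 hxF fun K' hK' hF' => ?_).trans hN
        by_contra hne
        exact hxΩ (mem_of_shared hΩ' hK hK' (Ne.symm hne) hF hF' hF2 hxF hpos)

end Triangulation

/-! ### Integrals over edges -/

/-- The affine parametrization of a segment. -/
def seg (a b : Plane) (t : ℝ) : Plane := (1 - t) • a + t • b

lemma continuous_seg (a b : Plane) : Continuous (seg a b) := by unfold seg; fun_prop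

lemma seg_zero (a b : Plane) : seg a b 0 = a := by simp [seg]

lemma seg_one (a b : Plane) : seg a b 1 = b := by simp [seg]

lemma hull_pair (a b : Plane) : hull ({a, b} : Finset Plane) = seg a b '' Icc 0 1 := by
  have : hull ({a, b} : Finset Plane) = segment ℝ a b := by
    rw [hull, ← convexHull_pair]; simp
  rw [this, segment_eq_image]; rfl

lemma seg_mem_hull (a b : Plane) {t : ℝ} (ht : t ∈ Icc (0 : ℝ) 1) :
    seg a b t ∈ hull ({a, b} : Finset Plane) := by
  rw [hull_pair]; exact mem_image_of_mem _ ht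

lemma diam_hull_pair (a b : Plane) : Metric.diam (hull ({a, b} : Finset Plane)) = dist a b := by
  rw [hull, convexHull_diam]; simp [Metric.diam_pair]

lemma edgeMeasure_pair (a b : Plane) : edgeMeasure {a, b} =
    nndist a b • (volume.restrict (Icc (0 : ℝ) 1)).map (seg a b) := by
  ext s hs
  have e : (seg a b : ℝ → Plane) = AffineMap.lineMap a b := by
    ext t; simp [seg, AffineMap.lineMap_apply_module]
  rw [edgeMeasure, Measure.restrict_apply hs, Measure.smul_apply,
    Measure.map_apply (continuous_seg a b).measurable hs,
    Measure.restrict_apply ((continuous_seg a b).measurable hs), hull_pair, ← hausdorffMeasure_real,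
    ← hausdorffMeasure_lineMap_image, ← e, image_preimage_inter]

lemma integral_edge_pair (a b : Plane) (g : Plane → ℝ) (hg : AEStronglyMeasurable g (edgeMeasure {a, b})) :
    ∫ x, g x ∂(edgeMeasure {a, b}) = dist a b * ∫ t in (0 : ℝ)..1, g (seg a b t) := by
  by_cases hab : a = b
  · subst hab
    rw [edgeMeasure_pair]; simp
  have h0 : nndist a b ≠ 0 := by simpa using hab
  rw [edgeMeasure_pair] at hg ⊢
  rw [integral_smul_nnreal_measure, integral_map (continuous_seg a b).aemeasurable,
    intervalIntegral.integral_of_le zero_le_one, integral_Icc_eq_integral_Ioc]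
  · rfl
  · have := hg.smul_measure (nndist a b)⁻¹
    rwa [smul_smul, inv_mul_cancel₀ h0, one_smul] at this

lemma integral_edge_pair_of_continuous (a b : Plane) {g : Plane → ℝ} (hg : Continuous g) :
    ∫ x, g x ∂(edgeMeasure {a, b}) = dist a b * ∫ t in (0 : ℝ)..1, g (seg a b t) :=
  integral_edge_pair a b g hg.aestronglyMeasurable

lemma edgeMeasure_univ_lt_top {F : Finset Plane} (h2 : F.card = 2) : IsFiniteMeasure (edgeMeasure F) := by
  classical
  obtain ⟨a, b, hab, rfl⟩ := Finset.card_eq_two.1 h2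
  rw [edgeMeasure_pair]; infer_instance

lemma ae_edge_mem (F : Finset Plane) : ∀ᵐ x ∂(edgeMeasure F), x ∈ hull F :=
  ae_restrict_mem (isClosed_hull F).measurableSet

/-! ### Integrals over triangles -/

/-- The reference triangle. -/
def refTri : Set (ℝ × ℝ) := {p | 0 ≤ p.1 ∧ 0 ≤ p.2 ∧ p.1 + p.2 ≤ 1}

lemma isClosed_refTri : IsClosed refTri := by
  have h1 : IsClosed {p : ℝ × ℝ | 0 ≤ p.1} := isClosed_le continuous_const continuous_fst
  have h2 : IsClosed {p : ℝ × ℝ | 0 ≤ p.2} := isClosed_le continuous_const continuous_snd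
  have h3 : IsClosed {p : ℝ × ℝ | p.1 + p.2 ≤ 1} :=
    isClosed_le (continuous_fst.add continuous_snd) continuous_const
  exact h1.inter (h2.inter h3)

lemma isCompact_refTri : IsCompact refTri := by
  refine (isCompact_Icc (a := ((0, 0) : ℝ × ℝ)) (b := (1, 1))).of_isClosed_subset isClosed_refTri ?_
  rintro ⟨s, t⟩ ⟨h1, h2, h3⟩
  simp only at h1 h2 h3
  exact ⟨⟨h1, h2⟩, ⟨show s ≤ 1 by linarith, show t ≤ 1 by linarith⟩⟩

/-- Fubini over the slices `[0, 1 - t]` and the fundamental theorem of calculus in each slice. -/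
lemma integral_refTri_fst {q f : ℝ × ℝ → ℝ} (hf : Continuous f)
    (hd : ∀ s t, HasDerivAt (fun s => q (s, t)) (f (s, t)) s) :
    ∫ p in refTri, f p = ∫ t in (0 : ℝ)..1, (q (1 - t, t) - q (0, t)) := by
  have hi : Integrable (refTri.indicator f) ((volume : Measure ℝ).prod (volume : Measure ℝ)) := by
    rw [integrable_indicator_iff isClosed_refTri.measurableSet]
    exact hf.continuousOn.integrableOn_compact isCompact_refTri
  rw [← integral_indicator isClosed_refTri.measurableSet, Measure.volume_eq_prod,
    integral_prod_symm _ hi, intervalIntegral.integral_of_le zero_le_one,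
    ← integral_Icc_eq_integral_Ioc, ← integral_indicator measurableSet_Icc]
  congr 1
  ext t
  by_cases ht : t ∈ Icc (0 : ℝ) 1
  · rw [indicator_of_mem ht]
    have e : (fun s => refTri.indicator f (s, t)) = (Icc 0 (1 - t)).indicator fun s => f (s, t) := by
      ext s
      by_cases hs : s ∈ Icc 0 (1 - t)
      · rw [indicator_of_mem hs, indicator_of_mem]
        exact ⟨hs.1, ht.1, by have := hs.2; simp only; linarith⟩
      · rw [indicator_of_notMem hs, indicator_of_notMem]
        rintro ⟨h1, h2, h3⟩
        exact hs ⟨h1, by simp only at h3; linarith⟩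
    rw [e, integral_indicator measurableSet_Icc, integral_Icc_eq_integral_Ioc,
      ← intervalIntegral.integral_of_le (by linarith [ht.2])]
    exact intervalIntegral.integral_eq_sub_of_hasDerivAt (f := fun s => q (s, t)) (fun s _ => hd s t)
      (Continuous.intervalIntegrable (by fun_prop) _ _)
  · rw [indicator_of_notMem ht]
    have e : (fun s => refTri.indicator f (s, t)) = 0 := by
      ext s
      refine indicator_of_notMem ?_ _
      rintro ⟨h1, h2, h3⟩
      simp only at h1 h2 h3
      exact ht ⟨h2, by linarith⟩
    rw [e]; simp

lemma integral_refTri_swap (f : ℝ × ℝ → ℝ) :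
    ∫ p in refTri, f p = ∫ p in refTri, f p.swap := by
  rw [← integral_indicator isClosed_refTri.measurableSet,
    ← integral_indicator isClosed_refTri.measurableSet, Measure.volume_eq_prod,
    ← integral_prod_swap]
  congr 1
  ext p
  have : p.swap ∈ refTri ↔ p ∈ refTri := by
    simp only [refTri, mem_ofPred_eq, Prod.fst_swap, Prod.snd_swap, add_comm p.2]
    tauto
  by_cases hp : p ∈ refTri
  · rw [indicator_of_mem hp, indicator_of_mem (this.2 hp)]
  · rw [indicator_of_notMem hp, indicator_of_notMem (fun h => hp (this.1 h))]

lemma integral_refTri_snd {q f : ℝ × ℝ → ℝ} (hf : Continuous f)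
    (hd : ∀ s t, HasDerivAt (fun t => q (s, t)) (f (s, t)) t) :
    ∫ p in refTri, f p = ∫ s in (0 : ℝ)..1, (q (s, 1 - s) - q (s, 0)) := by
  rw [integral_refTri_swap]
  exact integral_refTri_fst (q := fun p => q p.swap) (hf.comp continuous_swap) fun s t => hd t s

/-- The affine map from the reference triangle onto the triangle with vertices `c`, `a`, `b`. -/
def triMap (c a b : Plane) (p : ℝ × ℝ) : Plane := c + (p.1 • (a - c) + p.2 • (b - c))

lemma continuous_triMap (c a b : Plane) : Continuous (triMap c a b) := by unfold triMap; fun_prop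

section TriMap

variable {c a b : Plane} (hK : IsTri {c, a, b})
include hK

lemma triple_ne : c ≠ a ∧ c ≠ b ∧ a ≠ b := by
  have h := hK.1
  refine ⟨?_, ?_, ?_⟩ <;> rintro rfl
  · have := Finset.card_le_two (a := c) (b := b); simp at h this; omega
  · have := Finset.card_le_two (a := c) (b := a)
    rw [Finset.pair_comm a c, Finset.insert_idem] at h; omega
  · have := Finset.card_le_two (a := c) (b := a); simp at h this; omega

lemma bary_triMap_fst (p : ℝ × ℝ) : bary {c, a, b} a (triMap c a b p) = p.1 := by
  obtain ⟨h1, h2, h3⟩ := triple_ne hK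
  have hl (u v : Plane) : (bary {c, a, b} a).linear (u - v) = bary {c, a, b} a u - bary {c, a, b} a v := by
    simpa using (bary {c, a, b} a).linearMap_vsub u v
  rw [triMap, affine_add, map_add, map_smul, map_smul, hl, hl, bary_self hK (by simp),
    bary_of_ne hK (by simp) h1.symm, bary_of_ne hK (by simp) h3]
  simp

lemma bary_triMap_snd (p : ℝ × ℝ) : bary {c, a, b} b (triMap c a b p) = p.2 := by
  obtain ⟨h1, h2, h3⟩ := triple_ne hK
  have hl (u v : Plane) : (bary {c, a, b} b).linear (u - v) = bary {c, a, b} b u - bary {c, a, b} b v := by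
    simpa using (bary {c, a, b} b).linearMap_vsub u v
  rw [triMap, affine_add, map_add, map_smul, map_smul, hl, hl, bary_self hK (by simp),
    bary_of_ne hK (by simp) h2.symm, bary_of_ne hK (by simp) h3.symm]
  simp

lemma sum_triple {M : Type*} [AddCommMonoid M] (f : Plane → M) :
    ∑ z ∈ ({c, a, b} : Finset Plane), f z = f c + (f a + f b) := by
  obtain ⟨h1, h2, h3⟩ := triple_ne hK
  rw [Finset.sum_insert (by simp [h1, h2]), Finset.sum_pair h3]

lemma bary_triMap_zero (p : ℝ × ℝ) : bary {c, a, b} c (triMap c a b p) = 1 - p.1 - p.2 := by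
  have := sum_bary hK (triMap c a b p)
  rw [sum_triple hK, bary_triMap_fst hK, bary_triMap_snd hK] at this
  linarith

lemma triMap_bary (x : Plane) : triMap c a b (bary {c, a, b} a x, bary {c, a, b} b x) = x := by
  have h1 := sum_bary hK x
  conv_rhs => rw [← sum_bary_smul hK x, sum_triple hK]
  rw [sum_triple hK] at h1
  have : bary {c, a, b} c x = 1 - bary {c, a, b} a x - bary {c, a, b} b x := by linarith
  rw [this, triMap]
  module

lemma triMap_mem_hull_iff (p : ℝ × ℝ) : triMap c a b p ∈ hull {c, a, b} ↔ p ∈ refTri := by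
  rw [mem_hull_iff hK]
  constructor
  · intro h
    have h1 := h a; have h2 := h b; have h3 := h c
    rw [bary_triMap_fst hK] at h1
    rw [bary_triMap_snd hK] at h2
    rw [bary_triMap_zero hK] at h3
    exact ⟨h1, h2, by linarith⟩
  · rintro ⟨h1, h2, h3⟩ z
    by_cases hz : z ∈ ({c, a, b} : Finset Plane)
    · simp only [Finset.mem_insert, Finset.mem_singleton] at hz
      rcases hz with rfl | rfl | rfl
      · rw [bary_triMap_zero hK]; linarith
      · rw [bary_triMap_fst hK]; exact h1
      · rw [bary_triMap_snd hK]; exact h2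
    · rw [bary_notMem hz]

/-- The linear part is invertible, so the push-forward of Lebesgue measure is a Haar measure and
thus proportional to it. The factor (a Jacobian) is never needed explicitly. -/
lemma exists_restrict_hull_eq_map : ∃ k : NNReal, k ≠ 0 ∧
    (volume : Measure Plane).restrict (hull {c, a, b}) =
      k • (volume.restrict refTri).map (triMap c a b) := by
  let L : (ℝ × ℝ) →ₗ[ℝ] Plane :=
    (LinearMap.fst ℝ ℝ ℝ).smulRight (a - c) + (LinearMap.snd ℝ ℝ ℝ).smulRight (b - c)
  have hL : ∀ p, triMap c a b p = c + L p := fun p => by simp [triMap, L]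
  have hinj : Function.Injective L := by
    intro p q h
    have e : triMap c a b p = triMap c a b q := by rw [hL, hL, h]
    refine Prod.ext ?_ ?_
    · rw [← bary_triMap_fst hK p, e, bary_triMap_fst hK]
    · rw [← bary_triMap_snd hK p, e, bary_triMap_snd hK]
  let e : (ℝ × ℝ) ≃L[ℝ] Plane :=
    (LinearEquiv.ofInjectiveOfFinrankEq L hinj (by simp)).toContinuousLinearEquiv
  have he : ∀ p, triMap c a b p = c + e p := fun p => by rw [hL]; rfl
  have htm : (volume : Measure (ℝ × ℝ)).map (triMap c a b) = volume.map e := by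
    have : triMap c a b = (fun x => c + x) ∘ e := by ext1 p; rw [he]; rfl
    rw [this, ← Measure.map_map (by fun_prop) (by fun_prop), map_add_left_eq_self]
  have h1 := Measure.isAddLeftInvariant_eq_smul (volume : Measure Plane) (volume.map e)
  refine ⟨_, (Measure.addHaarScalarFactor_pos_of_isAddHaarMeasure (volume : Measure Plane)
    (volume.map e)).ne', ?_⟩
  have hpre : triMap c a b ⁻¹' hull {c, a, b} = refTri := by
    ext p; exact triMap_mem_hull_iff hK p
  generalize Measure.addHaarScalarFactor (volume : Measure Plane) (volume.map e) = k at h1 ⊢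
  rw [h1, ← htm, Measure.restrict_smul, Measure.restrict_map (continuous_triMap c a b).measurable
    (isClosed_hull _).measurableSet, hpre]

lemma exists_integral_hull_eq : ∃ k : ℝ, 0 < k ∧ ∀ f : Plane → ℝ, Continuous f →
    ∫ x in hull {c, a, b}, f x = k * ∫ p in refTri, f (triMap c a b p) := by
  obtain ⟨k, hk, h⟩ := exists_restrict_hull_eq_map hK
  refine ⟨k, by positivity, fun f hf => ?_⟩
  rw [h, integral_smul_nnreal_measure, integral_map (continuous_triMap c a b).aemeasurable
    hf.aestronglyMeasurable]
  rfl

end TriMap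

lemma hasDerivAt_triMap_fst {f : Plane → ℝ} (hf : ContDiff ℝ 1 f) (c a b : Plane) (s t : ℝ) :
    HasDerivAt (fun s => f (triMap c a b (s, t))) (fderiv ℝ f (triMap c a b (s, t)) (a - c)) s := by
  have h1 : HasDerivAt (fun s : ℝ => triMap c a b (s, t)) (a - c) s := by
    unfold triMap
    have := ((hasDerivAt_id s).smul_const (a - c)).add_const (t • (b - c))
    simpa using this.const_add c
  exact ((hf.differentiable one_ne_zero _).hasFDerivAt.comp_hasDerivAt s h1)

lemma hasDerivAt_triMap_snd {f : Plane → ℝ} (hf : ContDiff ℝ 1 f) (c a b : Plane) (s t : ℝ) :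
    HasDerivAt (fun t => f (triMap c a b (s, t))) (fderiv ℝ f (triMap c a b (s, t)) (b - c)) t := by
  have h1 : HasDerivAt (fun t : ℝ => triMap c a b (s, t)) (b - c) t := by
    unfold triMap
    have := ((hasDerivAt_id t).smul_const (b - c)).const_add (s • (a - c))
    simpa using this.const_add c
  exact ((hf.differentiable one_ne_zero _).hasFDerivAt.comp_hasDerivAt t h1)

lemma continuous_fderiv_apply' {f : Plane → ℝ} (hf : ContDiff ℝ 1 f) (v : Plane) :
    Continuous fun x => fderiv ℝ f x v :=
  (hf.continuous_fderiv one_ne_zero).clm_apply continuous_const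

lemma continuous_pderiv {f : Plane → ℝ} (hf : ContDiff ℝ 1 f) (i : Fin 2) :
    Continuous (pderiv i f) := continuous_fderiv_apply' hf _

lemma fderiv_apply_eq (f : Plane → ℝ) (x v : Plane) :
    fderiv ℝ f x v = v 0 * pderiv 0 f x + v 1 * pderiv 1 f x := by
  have : v = v 0 • EuclideanSpace.single (0 : Fin 2) (1 : ℝ) +
      v 1 • EuclideanSpace.single (1 : Fin 2) (1 : ℝ) := by
    ext i; fin_cases i <;> simp
  conv_lhs => rw [this, map_add, map_smul, map_smul]
  rfl

/-- A function with vanishing means on the edges of a triangle has a gradient with vanishing mean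
on this triangle. -/
lemma integral_pderiv_eq_zero {K : Finset Plane} (hK : IsTri K) {f : Plane → ℝ}
    (hf : ContDiff ℝ 1 f)
    (h : ∀ F ⊆ K, F.card = 2 → ∫ x, f x ∂(edgeMeasure F) = 0) (i : Fin 2) :
    ∫ x in hull K, pderiv i f x = 0 := by
  classical
  obtain ⟨c, a, b, hca, hcb, hab, rfl⟩ := Finset.card_eq_three.1 hK.1
  have key : ∀ u v : Plane, u ≠ v → u ∈ ({c, a, b} : Finset Plane) → v ∈ ({c, a, b} : Finset Plane) →
      ∫ t in (0 : ℝ)..1, f (seg u v t) = 0 := by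
    intro u v huv hu hv
    have := h {u, v} (by
      intro w hw; rw [Finset.mem_insert, Finset.mem_singleton] at hw
      rcases hw with rfl | rfl <;> assumption) (Finset.card_pair huv)
    rw [integral_edge_pair_of_continuous u v hf.continuous] at this
    exact (mul_eq_zero.1 this).resolve_left (dist_ne_zero.2 huv)
  have hint : ∀ g : ℝ → Plane, Continuous g → IntervalIntegrable (fun t => f (g t)) volume 0 1 :=
    fun g hg => (hf.continuous.comp hg).intervalIntegrable _ _
  obtain ⟨k, hk, hkk⟩ := exists_integral_hull_eq hK
  -- Integrating along lines parallel to `a - c` leaves the difference of the integrals over the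
  -- edges `ab` and `cb`, both zero.
  have h1 : ∫ x in hull {c, a, b}, fderiv ℝ f x (a - c) = 0 := by
    rw [hkk _ (continuous_fderiv_apply' hf _), integral_refTri_fst
      (q := fun p => f (triMap c a b p))
      (f := fun p => fderiv ℝ f (triMap c a b p) _)
      ((continuous_fderiv_apply' hf _).comp (continuous_triMap c a b))
      (hasDerivAt_triMap_fst hf c a b)]
    have e1 : ∀ t, triMap c a b (1 - t, t) = seg a b t := fun t => by
      simp only [triMap, seg]; module
    have e2 : ∀ t, triMap c a b (0, t) = seg c b t := fun t => by
      simp only [triMap, seg]; module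
    simp only [e1, e2]
    rw [intervalIntegral.integral_sub (hint _ (continuous_seg a b)) (hint _ (continuous_seg c b)),
      key a b hab (by simp) (by simp), key c b hcb (by simp) (by simp)]
    simp
  have h2 : ∫ x in hull {c, a, b}, fderiv ℝ f x (b - c) = 0 := by
    rw [hkk _ (continuous_fderiv_apply' hf _), integral_refTri_snd
      (q := fun p => f (triMap c a b p))
      (f := fun p => fderiv ℝ f (triMap c a b p) _)
      ((continuous_fderiv_apply' hf _).comp (continuous_triMap c a b))
      (hasDerivAt_triMap_snd hf c a b)]
    have e1 : ∀ t, triMap c a b (t, 1 - t) = seg b a t := fun t => by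
      simp only [triMap, seg]; module
    have e2 : ∀ t, triMap c a b (t, 0) = seg c a t := fun t => by
      simp only [triMap, seg]; module
    simp only [e1, e2]
    rw [intervalIntegral.integral_sub (hint _ (continuous_seg b a)) (hint _ (continuous_seg c a)),
      key b a hab.symm (by simp) (by simp), key c a hca (by simp) (by simp)]
    simp
  set e : Plane := EuclideanSpace.single i 1
  -- The two edge directions span the plane; the coefficients of the unit vector are barycentric
  -- coordinates of `c + e`.
  have he : e = bary {c, a, b} a (c + e) • (a - c) + bary {c, a, b} b (c + e) • (b - c) := by
    have := triMap_bary hK (c + e)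
    rw [triMap] at this
    exact (add_left_cancel this).symm
  have hi : ∀ v, IntegrableOn (fun x => fderiv ℝ f x v) (hull {c, a, b}) := fun v =>
    (continuous_fderiv_apply' hf v).continuousOn.integrableOn_compact (isCompact_hull _)
  have : ∀ x, pderiv i f x = bary {c, a, b} a (c + e) * fderiv ℝ f x (a - c) +
      bary {c, a, b} b (c + e) * fderiv ℝ f x (b - c) := fun x => by
    change fderiv ℝ f x e = _
    conv_lhs => rw [he, map_add, map_smul, map_smul]
    rfl
  simp only [this]
  rw [integral_add ((hi _).const_mul _) ((hi _).const_mul _), integral_const_mul,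
    integral_const_mul, h1, h2]
  simp

/-- The trace inequality for smooth functions. -/
lemma exists_trace_inequality {K F : Finset Plane} (hK : IsTri K) (hF : F ⊆ K) (h2 : F.card = 2) :
    ∃ C : ℝ, 0 ≤ C ∧ ∀ φ : Plane → ℝ, ContDiff ℝ 1 φ →
      ∫ x, φ x ^ 2 ∂(edgeMeasure F) ≤
        C * ((∫ x in hull K, φ x ^ 2) + ∑ i, ∫ x in hull K, pderiv i φ x ^ 2) := by
  obtain ⟨a, b, c, hab, hca, hcb, rfl, rfl⟩ := exists_triple_of_edge hK hF h2
  -- With `a` as base vertex, the edge `ab` becomes the side `s = 0` of the reference triangle.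
  rw [Finset.insert_comm c a] at hK ⊢
  obtain ⟨k, hk, hkk⟩ := exists_integral_hull_eq hK
  set u := c - a
  set v := b - a
  -- The 4 collects two copies of `φ²` from the divergence of the field used below and two from
  -- Young's inequality; the rest bounds the squared derivatives along `u` and `v` by the full
  -- gradient.
  set M : ℝ := 4 + 2 * (u 0 ^ 2 + u 1 ^ 2 + v 0 ^ 2 + v 1 ^ 2) with hM
  have hM4 : 4 ≤ M := by rw [hM]; linarith [sq_nonneg (u 0), sq_nonneg (u 1), sq_nonneg (v 0), sq_nonneg (v 1)]
  refine ⟨dist a b * (k⁻¹ * M), by positivity, fun φ hφ => ?_⟩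
  have hc0 := hφ.continuous
  have hcp : ∀ i, Continuous (pderiv i φ) := continuous_pderiv hφ
  rw [integral_edge_pair_of_continuous a b (g := fun x => φ x ^ 2) (hc0.pow 2), mul_assoc]
  refine mul_le_mul_of_nonneg_left ?_ dist_nonneg
  set A := triMap a c b
  have hA : Continuous A := continuous_triMap a c b
  set g : ℝ × ℝ → ℝ := fun p => φ (A p) ^ 2
  set gs : ℝ × ℝ → ℝ := fun p => 2 * φ (A p) * fderiv ℝ φ (A p) u
  set gt : ℝ × ℝ → ℝ := fun p => 2 * φ (A p) * fderiv ℝ φ (A p) v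
  have hfu := continuous_fderiv_apply' hφ u
  have hfv := continuous_fderiv_apply' hφ v
  have hg : Continuous g := by fun_prop
  have hgs : Continuous gs := by fun_prop
  have hgt : Continuous gt := by fun_prop
  have hds : ∀ s t, HasDerivAt (fun s => g (s, t)) (gs (s, t)) s := fun s t => by
    exact ((hasDerivAt_triMap_fst hφ a c b s t).fun_pow 2).congr_deriv (by simp [gs, A, u])
  have hdt : ∀ s t, HasDerivAt (fun t => g (s, t)) (gt (s, t)) t := fun s t => by
    exact ((hasDerivAt_triMap_snd hφ a c b s t).fun_pow 2).congr_deriv (by simp [gt, A, v])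
  -- Divergence theorem for `φ²` times the field `(s - 1, t)`, which is tangential on the sides `t =
  -- 0` and `s + t = 1`. Only the integral over the side `s = 0` survives after the two
  -- contributions are added.
  have i1 := integral_refTri_fst (q := fun p => (p.1 - 1) * g p)
    (f := fun p => g p + (p.1 - 1) * gs p) (by fun_prop) fun s t => by
      exact (((hasDerivAt_id' s).sub_const 1).fun_mul (hds s t)).congr_deriv (by ring)
  have i2 := integral_refTri_snd (q := fun p => p.2 * g p)
    (f := fun p => g p + p.2 * gt p) (by fun_prop) fun s t => by
      exact ((hasDerivAt_id' t).fun_mul (hdt s t)).congr_deriv (by ring)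
  have hio : ∀ f : ℝ × ℝ → ℝ, Continuous f → IntegrableOn f refTri := fun f hf =>
    hf.continuousOn.integrableOn_compact isCompact_refTri
  have i3 : ∫ s in (0 : ℝ)..1, ((1 - s) * g (s, 1 - s) - 0 * g (s, 0)) =
      ∫ t in (0 : ℝ)..1, t * g (1 - t, t) := by
    have := intervalIntegral.integral_comp_sub_left (fun t => t * g (1 - t, t)) (1 : ℝ)
      (a := 0) (b := 1)
    simpa using this
  have i4 : ∫ t in (0 : ℝ)..1, φ (seg a b t) ^ 2 =
      ∫ p in refTri, ((g p + (p.1 - 1) * gs p) + (g p + p.2 * gt p)) := by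
    rw [integral_add (hio _ (by fun_prop)) (hio _ (by fun_prop)), i1, i2, i3,
      ← intervalIntegral.integral_add (Continuous.intervalIntegrable (by fun_prop) _ _)
        (Continuous.intervalIntegrable (by fun_prop) _ _)]
    refine intervalIntegral.integral_congr fun t _ => ?_
    have : seg a b t = A (0, t) := by simp only [A, triMap, seg]; module
    simp only [this, g]
    ring
  have i5 : (∫ x in hull {a, c, b}, φ x ^ 2) + ∑ i, ∫ x in hull {a, c, b}, pderiv i φ x ^ 2 =
      k * ∫ p in refTri, (φ (A p) ^ 2 + (pderiv 0 φ (A p) ^ 2 + pderiv 1 φ (A p) ^ 2)) := by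
    rw [Fin.sum_univ_two, hkk (fun x => φ x ^ 2) (hc0.pow 2),
      hkk (fun x => pderiv 0 φ x ^ 2) ((hcp 0).pow 2), hkk (fun x => pderiv 1 φ x ^ 2) ((hcp 1).pow 2),
      integral_add (hio _ (by fun_prop)) (hio _ (by fun_prop)),
      integral_add (hio _ (by fun_prop)) (hio _ (by fun_prop))]
    ring
  rw [i4, i5]
  have : k⁻¹ * M * (k * ∫ p in refTri, (φ (A p) ^ 2 + (pderiv 0 φ (A p) ^ 2 + pderiv 1 φ (A p) ^ 2)))
      = ∫ p in refTri, M * (φ (A p) ^ 2 + (pderiv 0 φ (A p) ^ 2 + pderiv 1 φ (A p) ^ 2)) := by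
    rw [integral_const_mul]; field_simp
  rw [this]
  refine setIntegral_mono_on (hio _ (by fun_prop)) (hio _ (by fun_prop))
    isClosed_refTri.measurableSet fun p hp => ?_
  obtain ⟨hp1, hp2, hp3⟩ := hp
  simp only [g, gs, gt, fderiv_apply_eq]
  set w := φ (A p)
  set x := pderiv 0 φ (A p)
  set y := pderiv 1 φ (A p)
  have hp1' : (p.1 - 1) ^ 2 ≤ 1 := by nlinarith
  have hp2' : p.2 ^ 2 ≤ 1 := by nlinarith
  have b1 (α β : ℝ) : (α * x + β * y) ^ 2 ≤ 2 * (α ^ 2 + β ^ 2) * (x ^ 2 + y ^ 2) := by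
    nlinarith [sq_nonneg (α * y - β * x), sq_nonneg (α * x + β * y)]
  have b2 (r z : ℝ) (hr : r ^ 2 ≤ 1) : r * (2 * w * z) ≤ w ^ 2 + z ^ 2 := by
    nlinarith [sq_nonneg (r * w - z), mul_nonneg (sub_nonneg.2 hr) (sq_nonneg w)]
  have c1 := b2 (p.1 - 1) (u 0 * x + u 1 * y) hp1'
  have c2 := b2 p.2 (v 0 * x + v 1 * y) hp2'
  have c3 := b1 (u 0) (u 1)
  have c4 := b1 (v 0) (v 1)
  have c5 : (4 + 2 * (u 0 ^ 2 + u 1 ^ 2 + v 0 ^ 2 + v 1 ^ 2)) * (w ^ 2 + (x ^ 2 + y ^ 2)) =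
    4 * w ^ 2 + 4 * (x ^ 2 + y ^ 2) + 2 * (u 0 ^ 2 + u 1 ^ 2) * (x ^ 2 + y ^ 2) +
      2 * (v 0 ^ 2 + v 1 ^ 2) * (x ^ 2 + y ^ 2) +
      2 * (u 0 ^ 2 + u 1 ^ 2 + v 0 ^ 2 + v 1 ^ 2) * w ^ 2 := by ring
  have c6 : 0 ≤ 2 * (u 0 ^ 2 + u 1 ^ 2 + v 0 ^ 2 + v 1 ^ 2) * w ^ 2 := by positivity
  have c7 := sq_nonneg x
  have c8 := sq_nonneg y
  have c9 := sq_nonneg w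
  rw [hM, c5]
  linarith

/-! ### Weak derivatives -/

lemma tendsto_integral_mul_of_L2 {α : Type*} [MeasurableSpace α] {μ : Measure α} {f : ℕ → α → ℝ}
    {g ψ : α → ℝ} (hf : ∀ n, MemLp (f n) 2 μ) (hg : MemLp g 2 μ) (hψ : MemLp ψ 2 μ)
    (h : Tendsto (fun n => eLpNorm (f n - g) 2 μ) atTop (𝓝 0)) :
    Tendsto (fun n => ∫ x, f n x * ψ x ∂μ) atTop (𝓝 (∫ x, g x * ψ x ∂μ)) := by
  refine tendsto_integral_of_L1' (fun x => g x * ψ x) (hg.aestronglyMeasurable.mul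
    hψ.aestronglyMeasurable) (Eventually.of_forall fun n => (hf n).integrable_mul hψ) ?_
  have hb : ∀ n, eLpNorm ((fun x => f n x * ψ x) - fun x => g x * ψ x) 1 μ ≤
      eLpNorm (f n - g) 2 μ * eLpNorm ψ 2 μ := fun n => by
    have e : ((fun x => f n x * ψ x) - fun x => g x * ψ x) = (f n - g) • ψ := by
      ext x; simp [sub_mul]
    rw [e]
    exact eLpNorm_smul_le_mul_eLpNorm hψ.aestronglyMeasurable
      ((hf n).aestronglyMeasurable.sub hg.aestronglyMeasurable)
  refine tendsto_of_tendsto_of_tendsto_of_le_of_le tendsto_const_nhds ?_ (fun _ => zero_le) hb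
  have := ENNReal.Tendsto.mul_const (b := eLpNorm ψ 2 μ) h (Or.inr hψ.eLpNorm_ne_top)
  simpa using this

section Weak

variable {U S : Set Plane} {i : Fin 2} {w w' g g' : Plane → ℝ} {φ : Plane → ℝ}

lemma IsTestFunction.pderiv_eq_zero (_hφ : IsTestFunction U φ) {x : Plane} (hx : x ∉ tsupport φ) :
    pderiv i φ x = 0 := by
  have : fderiv ℝ φ x = 0 := by
    by_contra h
    exact hx (support_fderiv_subset ℝ h)
  simp [pderiv, this]

lemma IsTestFunction.continuous_pderiv (hφ : IsTestFunction U φ) (i : Fin 2) :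
    Continuous (pderiv i φ) := CrouzeixRaviart.continuous_pderiv (hφ.1.of_le (by simp)) i

lemma IsTestFunction.hasCompactSupport_pderiv (hφ : IsTestFunction U φ) (i : Fin 2) :
    HasCompactSupport (pderiv i φ) :=
  HasCompactSupport.intro hφ.2.1 fun _ hx => hφ.pderiv_eq_zero hx

lemma IsTestFunction.memLp (hφ : IsTestFunction U φ) (μ : Measure Plane)
    [IsFiniteMeasureOnCompacts μ] : MemLp φ 2 μ :=
  hφ.1.continuous.memLp_of_hasCompactSupport hφ.2.1

lemma IsTestFunction.memLp_pderiv (hφ : IsTestFunction U φ) (i : Fin 2) (μ : Measure Plane)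
    [IsFiniteMeasureOnCompacts μ] : MemLp (pderiv i φ) 2 μ :=
  (hφ.continuous_pderiv i).memLp_of_hasCompactSupport (hφ.hasCompactSupport_pderiv i)

lemma IsTestFunction.mono {V : Set Plane} (hφ : IsTestFunction U φ) (h : U ⊆ V) :
    IsTestFunction V φ := ⟨hφ.1, hφ.2.1, hφ.2.2.trans h⟩

lemma integral_mul_pderiv (hf : ContDiff ℝ 1 w) (hφ : IsTestFunction U φ) :
    ∫ x, w x * pderiv i φ x = - ∫ x, pderiv i w x * φ x := by
  refine integral_mul_fderiv_eq_neg_fderiv_mul_of_integrable ?_ ?_ ?_ ?_ ?_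
  · exact ((continuous_pderiv hf i).mul hφ.1.continuous).integrable_of_hasCompactSupport
      hφ.2.1.mul_left
  · exact (hf.continuous.mul (hφ.continuous_pderiv i)).integrable_of_hasCompactSupport
      (hφ.hasCompactSupport_pderiv i).mul_left
  · exact (hf.continuous.mul hφ.1.continuous).integrable_of_hasCompactSupport hφ.2.1.mul_left
  · exact fun x _ => hf.differentiable one_ne_zero x
  · exact fun x _ => hφ.1.differentiable (by simp) x

lemma IsTestFunction.setIntegral_mul (hφ : IsTestFunction U φ) (w : Plane → ℝ) :
    ∫ x in U, w x * φ x = ∫ x, w x * φ x :=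
  setIntegral_eq_integral_of_forall_compl_eq_zero fun x hx => by
    rw [image_eq_zero_of_notMem_tsupport fun h => hx (hφ.2.2 h), mul_zero]

lemma IsTestFunction.setIntegral_mul_pderiv (hφ : IsTestFunction U φ) (w : Plane → ℝ) (i : Fin 2) :
    ∫ x in U, w x * pderiv i φ x = ∫ x, w x * pderiv i φ x :=
  setIntegral_eq_integral_of_forall_compl_eq_zero fun x hx => by
    rw [hφ.pderiv_eq_zero fun h => hx (hφ.2.2 h), mul_zero]

lemma isWeakPartial_of_contDiff (hw : ContDiff ℝ 1 w)
    (hm : MemLp (pderiv i w) 2 (volume.restrict U)) : IsWeakPartial U i w (pderiv i w) :=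
  ⟨hm, fun φ hφ => by
    rw [hφ.setIntegral_mul, hφ.setIntegral_mul_pderiv, integral_mul_pderiv hw hφ]⟩

lemma IsWeakPartial.mono {V : Set Plane} (h : IsWeakPartial U i w g) (hVU : V ⊆ U) :
    IsWeakPartial V i w g :=
  ⟨h.1.mono_measure (Measure.restrict_mono_set _ hVU), fun φ hφ => by
    have := h.2 φ (hφ.mono hVU)
    rw [(hφ.mono hVU).setIntegral_mul, (hφ.mono hVU).setIntegral_mul_pderiv] at this
    rw [hφ.setIntegral_mul, hφ.setIntegral_mul_pderiv, this]⟩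

lemma IsWeakPartial.congr (h : IsWeakPartial U i w g) (hw : w =ᵐ[volume.restrict U] w') :
    IsWeakPartial U i w' g :=
  ⟨h.1, fun φ hφ => by
    rw [← h.2 φ hφ]
    exact integral_congr_ae (hw.mono fun x hx => by simp only [hx])⟩

lemma IsWeakPartial.unique (hU : IsOpen U) (h : IsWeakPartial U i w g)
    (h' : IsWeakPartial U i w g') : g =ᵐ[volume.restrict U] g' := by
  have hloc : ∀ {g : Plane → ℝ}, MemLp g 2 (volume.restrict U) → LocallyIntegrableOn g U volume :=
    fun hg => (locallyIntegrableOn_of_locallyIntegrable_restrict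
      (hg.locallyIntegrable (by norm_num)))
  have := hU.ae_eq_zero_of_integral_contDiff_smul_eq_zero (f := g - g') (μ := volume)
    (hloc (h.1.sub h'.1)) fun φ h1 h2 h3 => by
      have hφ : IsTestFunction U φ := ⟨h1, h2, h3⟩
      have e : ∫ x in U, (g - g') x * φ x = 0 := by
        have e1 := h.2 φ hφ
        rw [h'.2 φ hφ, neg_inj] at e1
        simp only [Pi.sub_apply, sub_mul]
        have e2 := integral_sub (h.1.integrable_mul (hφ.memLp _)) (h'.1.integrable_mul (hφ.memLp _))
        simp only [Pi.mul_apply] at e2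
        rw [e2, e1, sub_self]
      rw [hφ.setIntegral_mul] at e
      rw [← e]
      exact integral_congr_ae (Eventually.of_forall fun x => by simp [mul_comm])
  refine (ae_restrict_iff' hU.measurableSet).2 (this.mono fun x hx hxU => ?_)
  have := hx hxU
  rwa [Pi.sub_apply, sub_eq_zero] at this

/-- The choice in `weakPartial` is harmless on open sets by uniqueness of weak derivatives. -/
lemma weakPartial_ae_eq (hU : IsOpen U) (h : IsWeakPartial U i w g) :
    weakPartial U i w =ᵐ[volume.restrict U] g := by
  have hex : ∃ g, IsWeakPartial U i w g := ⟨g, h⟩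
  rw [weakPartial, dif_pos hex]
  exact hex.choose_spec.unique hU h

/-- The gradient of an `H¹`-limit is the weak gradient of the limit. -/
lemma TendstoH1.isWeakPartial {φ : ℕ → Plane → ℝ} {G : Fin 2 → Plane → ℝ}
    (h : TendstoH1 S φ w G) (hφ : ∀ n, ContDiff ℝ 1 (φ n))
    (hm : ∀ n, MemLp (φ n) 2 (volume.restrict S))
    (hmp : ∀ n i, MemLp (pderiv i (φ n)) 2 (volume.restrict S))
    (hw : MemLp w 2 (volume.restrict S)) (hU : U ⊆ S) (i : Fin 2) :
    IsWeakPartial U i w (G i) := by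
  refine IsWeakPartial.mono (U := S) ⟨(h.2 i).1, fun ψ hψ => ?_⟩ hU
  have t1 := tendsto_integral_mul_of_L2 hm hw (hψ.memLp_pderiv i _) h.1
  have t2 := tendsto_integral_mul_of_L2 (fun n => hmp n i) (h.2 i).1 (hψ.memLp _) (h.2 i).2
  refine tendsto_nhds_unique t1 (t2.neg.congr fun n => ?_)
  rw [hψ.setIntegral_mul, hψ.setIntegral_mul_pderiv, integral_mul_pderiv (hφ n) hψ]

end Weak

/-! ### Traces -/

section Trace

variable {K F : Finset Plane} {w w' g g' : Plane → ℝ}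

lemma memLp_hull_of_continuous (K : Finset Plane) {f : Plane → ℝ} (hf : Continuous f) :
    MemLp f 2 (volume.restrict (hull K)) := by
  have : IsFiniteMeasure ((volume : Measure Plane).restrict (hull K)) :=
    isFiniteMeasure_restrict.2 (volume_hull_lt_top K).ne
  obtain ⟨C, hC⟩ := (isCompact_hull K).exists_bound_of_continuousOn hf.continuousOn
  exact MemLp.of_bound hf.aestronglyMeasurable C
    ((ae_restrict_mem (isClosed_hull K).measurableSet).mono fun x hx => hC x hx)

lemma eLpNorm_sq_toReal {α : Type*} [MeasurableSpace α] {μ : Measure α} {f : α → ℝ}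
    (hf : MemLp f 2 μ) : eLpNorm f 2 μ = ENNReal.ofReal (Real.sqrt (∫ x, f x ^ 2 ∂μ)) := by
  rw [hf.eLpNorm_eq_integral_rpow_norm two_ne_zero ENNReal.ofNat_ne_top, Real.sqrt_eq_rpow]
  norm_num

lemma memLp_edge_of_continuous (h2 : F.card = 2) {f : Plane → ℝ} (hf : Continuous f) :
    MemLp f 2 (edgeMeasure F) := by
  have := edgeMeasure_univ_lt_top h2
  obtain ⟨C, hC⟩ := (isCompact_hull F).exists_bound_of_continuousOn hf.continuousOn
  exact MemLp.of_bound hf.aestronglyMeasurable C ((ae_edge_mem F).mono fun x hx => hC x hx)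

lemma sqrt_add_le (x y : ℝ) : Real.sqrt (x + y) ≤ Real.sqrt x + Real.sqrt y := by
  by_cases hx : 0 ≤ x
  · by_cases hy : 0 ≤ y
    · rw [Real.sqrt_le_left (by positivity)]
      nlinarith [Real.sq_sqrt hx, Real.sq_sqrt hy, Real.sqrt_nonneg x, Real.sqrt_nonneg y,
        mul_nonneg (Real.sqrt_nonneg x) (Real.sqrt_nonneg y)]
    · have := Real.sqrt_le_sqrt (show x + y ≤ x by linarith)
      linarith [Real.sqrt_nonneg y]
  · have := Real.sqrt_le_sqrt (show x + y ≤ y by linarith)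
    linarith [Real.sqrt_nonneg x]

lemma exists_trace_inequality_eLpNorm (hK : IsTri K) (hF : F ⊆ K) (h2 : F.card = 2) :
    ∃ C : ENNReal, C ≠ ⊤ ∧ ∀ φ : Plane → ℝ, ContDiff ℝ 1 φ →
      eLpNorm φ 2 (edgeMeasure F) ≤ C * (eLpNorm φ 2 (volume.restrict (hull K)) +
        ∑ i, eLpNorm (pderiv i φ) 2 (volume.restrict (hull K))) := by
  obtain ⟨C, hC0, hC⟩ := exists_trace_inequality hK hF h2
  refine ⟨ENNReal.ofReal (Real.sqrt C), ENNReal.ofReal_ne_top, fun φ hφ => ?_⟩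
  rw [eLpNorm_sq_toReal (memLp_edge_of_continuous h2 hφ.continuous),
    eLpNorm_sq_toReal (memLp_hull_of_continuous K hφ.continuous), Fin.sum_univ_two,
    eLpNorm_sq_toReal (memLp_hull_of_continuous K (continuous_pderiv hφ 0)),
    eLpNorm_sq_toReal (memLp_hull_of_continuous K (continuous_pderiv hφ 1)),
    ← ENNReal.ofReal_add (Real.sqrt_nonneg _) (Real.sqrt_nonneg _),
    ← ENNReal.ofReal_add (Real.sqrt_nonneg _) (by positivity),
    ← ENNReal.ofReal_mul (Real.sqrt_nonneg _)]
  refine ENNReal.ofReal_le_ofReal ?_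
  have h := hC φ hφ
  rw [Fin.sum_univ_two] at h
  have n0 : 0 ≤ ∫ x in hull K, φ x ^ 2 := integral_nonneg fun x => sq_nonneg _
  have n1 : 0 ≤ ∫ x in hull K, pderiv 0 φ x ^ 2 := integral_nonneg fun x => sq_nonneg _
  have n2 : 0 ≤ ∫ x in hull K, pderiv 1 φ x ^ 2 := integral_nonneg fun x => sq_nonneg _
  refine (Real.sqrt_le_sqrt h).trans ?_
  rw [Real.sqrt_mul hC0]
  refine mul_le_mul_of_nonneg_left ?_ (Real.sqrt_nonneg _)
  refine (sqrt_add_le _ _).trans ?_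
  gcongr
  exact sqrt_add_le _ _

lemma TendstoH1.isWeakPartial_hull {φ : ℕ → Plane → ℝ} {G : Fin 2 → Plane → ℝ}
    (h : TendstoH1 (hull K) φ w G) (hφ : ∀ n, ContDiff ℝ ∞ (φ n))
    (hw : MemLp w 2 (volume.restrict (hull K))) (i : Fin 2) :
    IsWeakPartial (interior (hull K)) i w (G i) :=
  h.isWeakPartial (fun n => (hφ n).of_le (by simp))
    (fun n => memLp_hull_of_continuous K (hφ n).continuous)
    (fun n i => memLp_hull_of_continuous K (continuous_pderiv ((hφ n).of_le (by simp)) i)) hw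
    interior_subset i

lemma pderiv_sub {f g : Plane → ℝ} (hf : ContDiff ℝ 1 f) (hg : ContDiff ℝ 1 g) (i : Fin 2) :
    pderiv i (f - g) = pderiv i f - pderiv i g := by
  ext x
  simp only [pderiv, Pi.sub_apply]
  rw [fderiv_sub (hf.differentiable one_ne_zero x) (hg.differentiable one_ne_zero x)]
  rfl

lemma eLpNorm_sub_le_add {α : Type*} [MeasurableSpace α] {μ : Measure α} {f g h : α → ℝ}
    (hf : AEStronglyMeasurable f μ) (hg : AEStronglyMeasurable g μ)
    (hh : AEStronglyMeasurable h μ) :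
    eLpNorm (f - g) 2 μ ≤ eLpNorm (f - h) 2 μ + eLpNorm (g - h) 2 μ := by
  have : f - g = (f - h) - (g - h) := by abel
  rw [this]
  exact eLpNorm_sub_le (hf.sub hh) (hg.sub hh) (by norm_num)

/-- Smooth functions with the same limit in `H¹(K)` have asymptotically the same restriction to the
edges. -/
lemma exists_trace_bound (hK : IsTri K) (hF : F ⊆ K) (h2 : F.card = 2)
    (hw : MemLp w 2 (volume.restrict (hull K))) :
    ∃ C : ENNReal, C ≠ ⊤ ∧ ∀ (φ ψ : Plane → ℝ) (G : Fin 2 → Plane → ℝ), ContDiff ℝ ∞ φ →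
      ContDiff ℝ ∞ ψ → (∀ i, MemLp (G i) 2 (volume.restrict (hull K))) →
      eLpNorm (φ - ψ) 2 (edgeMeasure F) ≤
        C * (eLpNorm (φ - w) 2 (volume.restrict (hull K)) +
          ∑ i, eLpNorm (pderiv i φ - G i) 2 (volume.restrict (hull K))) +
        C * (eLpNorm (ψ - w) 2 (volume.restrict (hull K)) +
          ∑ i, eLpNorm (pderiv i ψ - G i) 2 (volume.restrict (hull K))) := by
  obtain ⟨C, hC, h⟩ := exists_trace_inequality_eLpNorm hK hF h2
  refine ⟨C, hC, fun φ ψ G hφ hψ hG => ?_⟩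
  have hφ1 : ContDiff ℝ 1 φ := hφ.of_le (by simp)
  have hψ1 : ContDiff ℝ 1 ψ := hψ.of_le (by simp)
  refine (h (φ - ψ) (hφ1.sub hψ1)).trans ?_
  rw [← mul_add]
  refine mul_le_mul' le_rfl ?_
  have e : ∀ i, eLpNorm (pderiv i (φ - ψ)) 2 (volume.restrict (hull K)) ≤
      eLpNorm (pderiv i φ - G i) 2 (volume.restrict (hull K)) +
      eLpNorm (pderiv i ψ - G i) 2 (volume.restrict (hull K)) := fun i => by
    rw [pderiv_sub hφ1 hψ1]
    exact eLpNorm_sub_le_add (continuous_pderiv hφ1 i).aestronglyMeasurable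
      (continuous_pderiv hψ1 i).aestronglyMeasurable (hG i).aestronglyMeasurable
  calc _ ≤ (eLpNorm (φ - w) 2 (volume.restrict (hull K)) +
        eLpNorm (ψ - w) 2 (volume.restrict (hull K))) +
        ∑ i, (eLpNorm (pderiv i φ - G i) 2 (volume.restrict (hull K)) +
          eLpNorm (pderiv i ψ - G i) 2 (volume.restrict (hull K))) := by
        exact add_le_add (eLpNorm_sub_le_add hφ.continuous.aestronglyMeasurable
            hψ.continuous.aestronglyMeasurable hw.aestronglyMeasurable)
          (Finset.sum_le_sum fun i _ => e i)
    _ = _ := by rw [Finset.sum_add_distrib]; abel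

lemma tendsto_H1_error {S : Set Plane} {φ : ℕ → Plane → ℝ} {G : Fin 2 → Plane → ℝ}
    (h : TendstoH1 S φ w G) {C : ENNReal} (hC : C ≠ ⊤) :
    Tendsto (fun n => C * (eLpNorm (φ n - w) 2 (volume.restrict S) +
      ∑ i, eLpNorm (pderiv i (φ n) - G i) 2 (volume.restrict S))) atTop (𝓝 0) := by
  have := ENNReal.Tendsto.const_mul (a := C) (h.1.add (tendsto_finsetSum Finset.univ fun i _ => (h.2 i).2))
    (Or.inr hC)
  simpa using this

/-- Two approximating sequences differ by a null sequence in H¹(K), and the trace inequality carries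
this over to the edge. -/
lemma IsTrace.unique (hK : IsTri K) (hF : F ⊆ K) (h2 : F.card = 2)
    (hw : MemLp w 2 (volume.restrict (hull K))) (h : IsTrace K F w g) (h' : IsTrace K F w g') :
    g =ᵐ[edgeMeasure F] g' := by
  obtain ⟨hg, φ, G, hφ, hφw, hφg⟩ := h
  obtain ⟨hg', ψ, G', hψ, hψw, hψg⟩ := h'
  -- Each trace comes with its own gradient limit; both are weak gradients of `w`, hence equal a.e.
  have hGG : ∀ i, G' i =ᵐ[volume.restrict (hull K)] G i := fun i => by
    rw [restrict_hull_eq_interior]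
    exact (hψw.isWeakPartial_hull hψ hw i).unique isOpen_interior (hφw.isWeakPartial_hull hφ hw i)
  have hψw' : TendstoH1 (hull K) ψ w G := by
    refine ⟨hψw.1, fun i => ⟨(hφw.2 i).1, (hψw.2 i).2.congr fun n => ?_⟩⟩
    exact eLpNorm_congr_ae ((hGG i).mono fun x hx => by simp [hx])
  obtain ⟨C, hC, hb⟩ := exists_trace_bound hK hF h2 hw
  have hlim := (hφg.add ((tendsto_H1_error hφw hC).add (tendsto_H1_error hψw' hC))).add hψg
  simp only [add_zero] at hlim
  have h0 : eLpNorm (g - g') 2 (edgeMeasure F) = 0 := by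
    refine le_antisymm (ge_of_tendsto' hlim fun n => ?_) zero_le
    have a1 := eLpNorm_sub_le_add hg.aestronglyMeasurable hg'.aestronglyMeasurable
      (hφ n).continuous.aestronglyMeasurable
    have a2 := eLpNorm_sub_le_add hg'.aestronglyMeasurable
      ((hφ n).continuous.aestronglyMeasurable (μ := edgeMeasure F))
      (hψ n).continuous.aestronglyMeasurable
    have a3 := hb (φ n) (ψ n) G (hφ n) (hψ n) fun i => (hφw.2 i).1
    rw [eLpNorm_sub_comm g (φ n), eLpNorm_sub_comm g' (φ n)] at a1
    rw [eLpNorm_sub_comm g' (φ n), eLpNorm_sub_comm g' (ψ n)] at a2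
    refine a1.trans ((add_le_add le_rfl (a2.trans (add_le_add le_rfl a3))).trans (le_of_eq ?_))
    abel
  rw [eLpNorm_eq_zero_iff (hg.aestronglyMeasurable.sub hg'.aestronglyMeasurable) two_ne_zero] at h0
  exact h0.mono fun x hx => sub_eq_zero.1 hx

lemma IsTrace.trace_ae_eq (hK : IsTri K) (hF : F ⊆ K) (h2 : F.card = 2)
    (hw : MemLp w 2 (volume.restrict (hull K))) (h : IsTrace K F w g) :
    trace K F w =ᵐ[edgeMeasure F] g := by
  have hex : ∃ g, IsTrace K F w g := ⟨g, h⟩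
  rw [trace, dif_pos hex]
  exact hex.choose_spec.unique hK hF h2 hw h

lemma IsTrace.congr (h : IsTrace K F w g) (hw : w =ᵐ[volume.restrict (hull K)] w') :
    IsTrace K F w' g := by
  obtain ⟨hg, φ, G, hφ, hφw, hφg⟩ := h
  refine ⟨hg, φ, G, hφ, ⟨hφw.1.congr fun n => ?_, hφw.2⟩, hφg⟩
  exact eLpNorm_congr_ae (hw.mono fun x hx => by simp [hx])

lemma isTrace_of_contDiff (h2 : F.card = 2) (hw : ContDiff ℝ ∞ w) : IsTrace K F w w :=
  ⟨memLp_edge_of_continuous h2 hw.continuous, fun _ => w, fun i => pderiv i w, fun _ => hw,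
    ⟨by simp, fun i => ⟨memLp_hull_of_continuous K (continuous_pderiv (hw.of_le (by simp)) i),
      by simp⟩⟩, by simp⟩

lemma tendsto_eLpNorm_sub_sub {α : Type*} [MeasurableSpace α] {μ : Measure α}
    {f f' : ℕ → α → ℝ} {u u' : α → ℝ} (hf : ∀ n, AEStronglyMeasurable (f n) μ)
    (hf' : ∀ n, AEStronglyMeasurable (f' n) μ) (hu : AEStronglyMeasurable u μ)
    (hu' : AEStronglyMeasurable u' μ) (h : Tendsto (fun n => eLpNorm (f n - u) 2 μ) atTop (𝓝 0))
    (h' : Tendsto (fun n => eLpNorm (f' n - u') 2 μ) atTop (𝓝 0)) :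
    Tendsto (fun n => eLpNorm (f n - f' n - (u - u')) 2 μ) atTop (𝓝 0) := by
  refine tendsto_of_tendsto_of_tendsto_of_le_of_le tendsto_const_nhds
    (by simpa using h.add h') (fun _ => zero_le) fun n => ?_
  have : f n - f' n - (u - u') = (f n - u) - (f' n - u') := by abel
  simp only [this]
  exact eLpNorm_sub_le ((hf n).sub hu) ((hf' n).sub hu') (by norm_num)

lemma IsTrace.sub (h : IsTrace K F w g) (h' : IsTrace K F w' g')
    (hw : AEStronglyMeasurable w (volume.restrict (hull K)))
    (hw' : AEStronglyMeasurable w' (volume.restrict (hull K))) :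
    IsTrace K F (w - w') (g - g') := by
  obtain ⟨hg, φ, G, hφ, hφw, hφg⟩ := h
  obtain ⟨hg', ψ, G', hψ, hψw, hψg⟩ := h'
  refine ⟨hg.sub hg', fun n => φ n - ψ n, fun i => G i - G' i, fun n => (hφ n).sub (hψ n),
    ⟨?_, fun i => ⟨(hφw.2 i).1.sub (hψw.2 i).1, ?_⟩⟩, ?_⟩
  · exact tendsto_eLpNorm_sub_sub (fun n => (hφ n).continuous.aestronglyMeasurable)
      (fun n => (hψ n).continuous.aestronglyMeasurable) hw hw' hφw.1 hψw.1
  · refine (tendsto_eLpNorm_sub_sub (fun n => (continuous_pderiv ((hφ n).of_le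
      (by simp)) i).aestronglyMeasurable) (fun n => (continuous_pderiv ((hψ n).of_le
      (by simp)) i).aestronglyMeasurable) (hφw.2 i).1.aestronglyMeasurable
      (hψw.2 i).1.aestronglyMeasurable (hφw.2 i).2 (hψw.2 i).2).congr fun n => ?_
    rw [pderiv_sub ((hφ n).of_le (by simp)) ((hψ n).of_le (by simp))]
  · exact tendsto_eLpNorm_sub_sub (fun n => (hφ n).continuous.aestronglyMeasurable)
      (fun n => (hψ n).continuous.aestronglyMeasurable) hg.aestronglyMeasurable
      hg'.aestronglyMeasurable hφg hψg

end Trace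

namespace Triangulation

variable {Ω : Set Plane} {T : Triangulation Ω} {K K' F : Finset Plane}

lemma restrict_hull_le (hΩ' : interior (closure Ω) = Ω) (hK : K ∈ T.cells) :
    (volume : Measure Plane).restrict (hull K) ≤ volume.restrict Ω := by
  rw [restrict_hull_eq_interior]
  exact Measure.restrict_mono_set _ (interior_hull_subset hΩ' hK)

lemma ae_restrict_hull (hΩ' : interior (closure Ω) = Ω) (hK : K ∈ T.cells) {p : Plane → Prop}
    (h : ∀ᵐ x ∂(volume.restrict Ω), p x) : ∀ᵐ x ∂(volume.restrict (hull K)), p x :=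
  (Measure.absolutelyContinuous_of_le (restrict_hull_le hΩ' hK)).ae_le h

lemma memLp_restrict_hull (hΩ' : interior (closure Ω) = Ω) (hK : K ∈ T.cells) {w : Plane → ℝ}
    (h : MemLp w 2 (volume.restrict Ω)) : MemLp w 2 (volume.restrict (hull K)) :=
  h.mono_measure (restrict_hull_le hΩ' hK)

lemma TendstoH1_restrict (hΩ' : interior (closure Ω) = Ω) (hK : K ∈ T.cells)
    {φ : ℕ → Plane → ℝ} {w : Plane → ℝ} {G : Fin 2 → Plane → ℝ} (h : TendstoH1 Ω φ w G) :
    TendstoH1 (hull K) φ w G := by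
  have hle := restrict_hull_le hΩ' hK
  refine ⟨?_, fun i => ⟨(h.2 i).1.mono_measure hle, ?_⟩⟩
  · exact tendsto_of_tendsto_of_tendsto_of_le_of_le tendsto_const_nhds h.1 (fun _ => zero_le)
      fun n => eLpNorm_mono_measure _ hle
  · exact tendsto_of_tendsto_of_tendsto_of_le_of_le tendsto_const_nhds (h.2 i).2
      (fun _ => zero_le) fun n => eLpNorm_mono_measure _ hle

/-- Functions in `H¹₀(Ω)` have weak derivatives. -/
lemma H10_exists_weakPartial {v : L2 Ω} (hv : v ∈ H10 Ω) (i : Fin 2) :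
    ∃ g, IsWeakPartial Ω i v g := by
  obtain ⟨φ, G, hφ, h⟩ := hv
  exact ⟨G i, h.isWeakPartial (fun n => (hφ n).1.of_le (by simp)) (fun n => (hφ n).memLp _)
    (fun n i => (hφ n).memLp_pderiv i _) (Lp.memLp v) subset_rfl i⟩

/-- Functions in `H¹₀(Ω)` have the same trace on an edge from all triangles, and it vanishes if the
edge is on the boundary. -/
lemma H10_exists_trace (hΩ' : interior (closure Ω) = Ω) {v : L2 Ω} (hv : v ∈ H10 Ω)
    (hF : F ∈ T.edges) : ∃ g : Plane → ℝ, (∀ K ∈ T.cells, F ⊆ K → IsTrace K F v g) ∧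
      (hull F ∩ Ω = ∅ → g =ᵐ[edgeMeasure F] 0) := by
  obtain ⟨K, hK, hFK, h2⟩ := mem_edges.1 hF
  obtain ⟨φ, G, hφ, h⟩ := hv
  have hm : ∀ n, MemLp (φ n) 2 (edgeMeasure F) := fun n =>
    memLp_edge_of_continuous h2 (hφ n).1.continuous
  obtain ⟨C, hC, hb⟩ := exists_trace_bound (T.isTri hK) hFK h2
    (memLp_restrict_hull hΩ' hK (Lp.memLp v))
  have hlim := tendsto_H1_error (TendstoH1_restrict hΩ' hK h) hC
  -- The trace inequality on one triangle makes the restrictions of the test functions Cauchy in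
  -- L²(F). Their limit is the trace from every triangle, because the test functions are the same
  -- for all of them.
  have hcauchy : CauchySeq fun n => (hm n).toLp (φ n) := by
    rw [EMetric.cauchySeq_iff]
    intro ε hε
    obtain ⟨N, hN⟩ := eventually_atTop.1 (hlim.eventually (gt_mem_nhds (ENNReal.half_pos hε.ne')))
    refine ⟨N, fun m hm' n hn' => ?_⟩
    rw [Lp.edist_toLp_toLp]
    refine (hb (φ m) (φ n) G (hφ m).1 (hφ n).1
      fun i => ((TendstoH1_restrict hΩ' hK h).2 i).1).trans_lt ?_
    rw [← ENNReal.add_halves ε]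
    exact ENNReal.add_lt_add (hN m hm') (hN n hn')
  obtain ⟨g, hg⟩ := cauchySeq_tendsto_of_complete hcauchy
  have hg' : Tendsto (fun n => eLpNorm (φ n - ⇑g) 2 (edgeMeasure F)) atTop (𝓝 0) := by
    have := tendsto_iff_edist_tendsto_0.1 hg
    refine this.congr fun n => ?_
    rw [Lp.edist_def]
    exact eLpNorm_congr_ae ((hm n).coeFn_toLp.mono fun x hx => by simp [hx])
  refine ⟨g, fun L hL _ => ⟨Lp.memLp g, φ, G, fun n => (hφ n).1, TendstoH1_restrict hΩ' hL h, hg'⟩,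
    fun hem => ?_⟩
  -- On an edge missing `Ω` all test functions vanish, so the distance to the limit is constant and
  -- must be zero.
  have h0 : ∀ n, eLpNorm (φ n - ⇑g) 2 (edgeMeasure F) = eLpNorm g 2 (edgeMeasure F) := fun n => by
    rw [← eLpNorm_neg (f := (g : Plane → ℝ))]
    refine eLpNorm_congr_ae ((ae_edge_mem F).mono fun x hx => ?_)
    have : φ n x = 0 := image_eq_zero_of_notMem_tsupport fun hx' => by
      have : x ∈ hull F ∩ Ω := ⟨hx, (hφ n).2.2 hx'⟩
      rw [hem] at this; exact this
    simp [this]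
  simp only [h0] at hg'
  have := tendsto_nhds_unique hg' tendsto_const_nhds
  exact (eLpNorm_eq_zero_iff (Lp.memLp g).aestronglyMeasurable two_ne_zero).1 this.symm

/-! ### Jumps -/

open Classical in
variable (T) in
/-- The triangles other than `plus F` that contain the edge `F`. -/
def others (F : Finset Plane) : Finset (Finset Plane) :=
  T.cells.filter fun K => F ⊆ K ∧ K ≠ T.plus F

lemma mem_others : K ∈ T.others F ↔ K ∈ T.cells ∧ F ⊆ K ∧ K ≠ T.plus F := by
  simp [others]

lemma plus_mem (hF : F ∈ T.edges) : T.plus F ∈ T.cells ∧ F ⊆ T.plus F := by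
  obtain ⟨K, hK, hFK, h2⟩ := mem_edges.1 hF
  exact T.plus_spec K hK F hFK h2

lemma card_of_mem_edges (hF : F ∈ T.edges) : F.card = 2 := (mem_edges.1 hF).choose_spec.2.2

lemma others_eq_singleton (hF : F ∈ T.edges) (hK : K ∈ T.cells) (hFK : F ⊆ K)
    (hne : K ≠ T.plus F) : T.others F = {K} := by
  ext L
  rw [mem_others, Finset.mem_singleton]
  obtain ⟨hp, hFp⟩ := plus_mem hF
  constructor
  · rintro ⟨hL, hFL, hLne⟩
    exact two_cells_per_edge hp hL hK hFp hFL hFK (card_of_mem_edges hF) hLne.symm hne.symm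
  · rintro rfl; exact ⟨hK, hFK, hne⟩

lemma others_cases (hΩ : IsOpen Ω) (hF : F ∈ T.edges) :
    (∃ K, T.others F = {K}) ∨ (T.others F = ∅ ∧ hull F ∩ Ω = ∅) := by
  obtain ⟨hp, hFp⟩ := plus_mem hF
  by_cases h : ∃ K ∈ T.cells, K ≠ T.plus F ∧ F ⊆ K
  · obtain ⟨K, hK, hne, hFK⟩ := h
    exact Or.inl ⟨K, others_eq_singleton hF hK hFK hne⟩
  · right
    push Not at h
    constructor
    · ext K
      simp only [mem_others, Finset.notMem_empty, iff_false]
      exact fun ⟨h1, h2, h3⟩ => h K h1 h3 h2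
    · by_contra hne
      obtain ⟨x, hx, hxΩ⟩ := nonempty_iff_ne_empty.2 hne
      obtain ⟨K', hK', h1, h2⟩ := exists_other_cell hΩ hp hFp (card_of_mem_edges hF) hx hxΩ
      exact h K' hK' h1 h2

lemma jump_ae_eq (hF : F ∈ T.edges) {w : Plane → ℝ} {g : Finset Plane → Plane → ℝ}
    (hw : ∀ K ∈ T.cells, MemLp w 2 (volume.restrict (hull K)))
    (hg : ∀ K ∈ T.cells, F ⊆ K → IsTrace K F w (g K)) :
    T.jump F w =ᵐ[edgeMeasure F] fun x => g (T.plus F) x - ∑ K ∈ T.others F, g K x := by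
  obtain ⟨hp, hFp⟩ := plus_mem hF
  have h2 := card_of_mem_edges hF
  have h1 : ∀ K ∈ T.others F, trace K F w =ᵐ[edgeMeasure F] g K := fun K hK => by
    obtain ⟨a, b, _⟩ := mem_others.1 hK
    exact (hg K a b).trace_ae_eq (T.isTri a) b h2 (hw K a)
  have h1' : ∀ᵐ x ∂(edgeMeasure F), ∀ K ∈ T.others F, trace K F w x = g K x :=
    (Finset.eventually_all _).2 h1
  filter_upwards [(hg _ hp hFp).trace_ae_eq (T.isTri hp) hFp h2 (hw _ hp), h1'] with x e1 e2
  rw [jump, e1]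
  congr 1
  exact Finset.sum_congr rfl e2

/-- The jump of an `H¹₀` function minus an element-wise smooth function. -/
lemma jump_H10_sub (hΩ : IsOpen Ω) (hΩ' : interior (closure Ω) = Ω) {u : L2 Ω} (hu : u ∈ H10 Ω)
    (hF : F ∈ T.edges) {w : Plane → ℝ} {p : Finset Plane → Plane → ℝ}
    (hp : ∀ K ∈ T.cells, ContDiff ℝ ∞ (p K))
    (hw : ∀ K ∈ T.cells, w =ᵐ[volume.restrict (hull K)] u - p K) :
    T.jump F w =ᵐ[edgeMeasure F] fun x => -(p (T.plus F) x - ∑ K ∈ T.others F, p K x) := by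
  obtain ⟨g, hg, hg0⟩ := H10_exists_trace hΩ' hu hF
  have h2 := card_of_mem_edges hF
  have hum : ∀ K ∈ T.cells, MemLp u 2 (volume.restrict (hull K)) := fun K hK =>
    memLp_restrict_hull hΩ' hK (Lp.memLp u)
  have hpm : ∀ K ∈ T.cells, MemLp (p K) 2 (volume.restrict (hull K)) := fun K hK =>
    memLp_hull_of_continuous K (hp K hK).continuous
  have hj := jump_ae_eq (T := T) hF (w := w) (g := fun K => g - p K)
    (fun K hK => (memLp_congr_ae (hw K hK)).2 ((hum K hK).sub (hpm K hK)))
    fun K hK hFK => ((hg K hK hFK).sub (isTrace_of_contDiff h2 (hp K hK))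
      (hum K hK).aestronglyMeasurable (hpm K hK).aestronglyMeasurable).congr (hw K hK).symm
  -- Across a shared edge the two equal traces of `u` cancel; otherwise the trace of `u` is zero.
  rcases others_cases (T := T) hΩ hF with ⟨K, hK⟩ | ⟨he, hem⟩
  · filter_upwards [hj] with x hx
    rw [hx, hK, Finset.sum_singleton, Finset.sum_singleton]
    simp only [Pi.sub_apply]; ring
  · filter_upwards [hj, hg0 hem] with x hx h0
    rw [hx, he, Finset.sum_empty, Finset.sum_empty, Pi.sub_apply, h0, Pi.zero_apply]; ring

end Triangulation

/-! ### Polynomials -/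

/-- The function on the plane given by a polynomial in the coordinates. -/
def ev (p : MvPolynomial (Fin 2) ℝ) (x : Plane) : ℝ := MvPolynomial.eval (fun i => x i) p

lemma ev_add (p q : MvPolynomial (Fin 2) ℝ) : ev (p + q) = ev p + ev q := by
  ext x; simp [ev]

lemma ev_sub (p q : MvPolynomial (Fin 2) ℝ) : ev (p - q) = ev p - ev q := by
  ext x; simp [ev]

lemma ev_C_mul (a : ℝ) (q : MvPolynomial (Fin 2) ℝ) : ev (MvPolynomial.C a * q) = a • ev q := by
  ext x; simp [ev]

lemma ev_zero : ev 0 = 0 := by ext x; simp [ev]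

lemma ev_sum {ι : Type*} (s : Finset ι) (p : ι → MvPolynomial (Fin 2) ℝ) (x : Plane) :
    ev (∑ i ∈ s, p i) x = ∑ i ∈ s, ev (p i) x := by
  simp [ev]

lemma ev_prod {ι : Type*} (s : Finset ι) (p : ι → MvPolynomial (Fin 2) ℝ) (x : Plane) :
    ev (∏ i ∈ s, p i) x = ∏ i ∈ s, ev (p i) x := by
  simp [ev]

lemma contDiff_eval_comp {E : Type*} [NormedAddCommGroup E] [NormedSpace ℝ E] {n : WithTop ℕ∞}
    {g : Fin 2 → E → ℝ} (hg : ∀ i, ContDiff ℝ n (g i)) (p : MvPolynomial (Fin 2) ℝ) :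
    ContDiff ℝ n fun x => MvPolynomial.eval (fun i => g i x) p := by
  induction p using MvPolynomial.induction_on with
  | C a => simpa using contDiff_const
  | add p q hp hq => simpa using hp.add hq
  | mul_X p i hp => simpa using hp.mul (hg i)

lemma contDiff_coord (i : Fin 2) {n : WithTop ℕ∞} : ContDiff ℝ n fun x : Plane => x i :=
  (EuclideanSpace.proj (𝕜 := ℝ) i).contDiff

lemma contDiff_ev (p : MvPolynomial (Fin 2) ℝ) {n : WithTop ℕ∞} : ContDiff ℝ n (ev p) :=
  contDiff_eval_comp (fun i => contDiff_coord i) p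

lemma continuous_ev (p : MvPolynomial (Fin 2) ℝ) : Continuous (ev p) :=
  (contDiff_ev p (n := 0)).continuous

lemma hasFDerivAt_eval_comp {E : Type*} [NormedAddCommGroup E] [NormedSpace ℝ E]
    {g : Fin 2 → E → ℝ} {g' : Fin 2 → E →L[ℝ] ℝ} {x : E}
    (hg : ∀ i, HasFDerivAt (g i) (g' i) x) (p : MvPolynomial (Fin 2) ℝ) :
    HasFDerivAt (fun x => MvPolynomial.eval (fun i => g i x) p)
      (∑ j, MvPolynomial.eval (fun i => g i x) (MvPolynomial.pderiv j p) • g' j) x := by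
  induction p using MvPolynomial.induction_on with
  | C a => simpa using hasFDerivAt_const a x
  | add p q hp hq => simpa [add_smul, Finset.sum_add_distrib] using hp.fun_add hq
  | mul_X p i hp =>
    have := hp.fun_mul (hg i)
    simp only [map_mul, MvPolynomial.eval_X]
    refine this.congr_fderiv ?_
    ext v
    simp only [add_apply, smul_apply, Fin.sum_univ_two,
      Derivation.leibniz, map_add, smul_eq_mul, map_mul, MvPolynomial.eval_X,
      MvPolynomial.pderiv_X]
    fin_cases i <;> simp <;> ring

lemma totalDegree_bind₁_le {f : Fin 2 → MvPolynomial (Fin 2) ℝ} (hf : ∀ i, (f i).totalDegree ≤ 1)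
    (p : MvPolynomial (Fin 2) ℝ) : (MvPolynomial.bind₁ f p).totalDegree ≤ p.totalDegree := by
  conv_lhs => rw [p.as_sum, map_sum]
  refine MvPolynomial.totalDegree_finsetSum_le fun m hm => ?_
  rw [MvPolynomial.bind₁_monomial]
  refine (MvPolynomial.totalDegree_mul _ _).trans ?_
  rw [MvPolynomial.totalDegree_C, zero_add]
  refine (MvPolynomial.totalDegree_finsetProd _ _).trans ?_
  refine le_trans (Finset.sum_le_sum fun i _ => ?_) (MvPolynomial.le_totalDegree hm)
  refine (MvPolynomial.totalDegree_pow _ _).trans ?_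
  simpa using Nat.mul_le_mul_left (m i) (hf i)

lemma eval_bind₁ (f : Fin 2 → MvPolynomial (Fin 2) ℝ) (p : MvPolynomial (Fin 2) ℝ)
    (x : Fin 2 → ℝ) : MvPolynomial.eval x (MvPolynomial.bind₁ f p) =
      MvPolynomial.eval (fun i => MvPolynomial.eval x (f i)) p := by
  exact MvPolynomial.eval₂Hom_bind₁ (RingHom.id ℝ) x f p

lemma totalDegree_affine_le (α β γ : ℝ) :
    (MvPolynomial.C α + MvPolynomial.C β * MvPolynomial.X 0 +
      MvPolynomial.C γ * MvPolynomial.X 1 : MvPolynomial (Fin 2) ℝ).totalDegree ≤ 1 := by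
  have h (β : ℝ) (i : Fin 2) :
      (MvPolynomial.C β * MvPolynomial.X i : MvPolynomial (Fin 2) ℝ).totalDegree ≤ 1 := by
    refine (MvPolynomial.totalDegree_mul _ _).trans ?_
    simp
  refine (MvPolynomial.totalDegree_add _ _).trans (max_le ?_ (h γ 1))
  exact (MvPolynomial.totalDegree_add _ _).trans (max_le (by simp) (h β 0))

/-! ### Unisolvence of the principal lattice -/

/-- Translation of a polynomial by a unit vector. -/
def shift (i : Fin 2) : MvPolynomial (Fin 2) ℝ →ₐ[ℝ] MvPolynomial (Fin 2) ℝ :=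
  MvPolynomial.bind₁ fun j => MvPolynomial.X j + MvPolynomial.C (if j = i then 1 else 0)

lemma eval_shift (i : Fin 2) (p : MvPolynomial (Fin 2) ℝ) (x : Fin 2 → ℝ) :
    MvPolynomial.eval x (shift i p) =
      MvPolynomial.eval (fun j => x j + if j = i then 1 else 0) p := by
  rw [shift, eval_bind₁]; simp

/-- The polynomial has degree at most `k` and the difference operator lowers this bound. -/
def DiffDegree (i : Fin 2) (k : ℕ) (p : MvPolynomial (Fin 2) ℝ) : Prop :=
  p.totalDegree ≤ k ∧ (shift i p).totalDegree ≤ k ∧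
    (k = 0 → shift i p - p = 0) ∧ ∀ n, k = n + 1 → (shift i p - p).totalDegree ≤ n

/-- Discrete Leibniz rule. The case `k = 0` is kept apart because a degree drop below 0 means that
the difference is the zero polynomial. -/
lemma DiffDegree.mul {i : Fin 2} {k k' : ℕ} {p q : MvPolynomial (Fin 2) ℝ}
    (hp : DiffDegree i k p) (hq : DiffDegree i k' q) : DiffDegree i (k + k') (p * q) := by
  obtain ⟨p1, p2, p3, p4⟩ := hp
  obtain ⟨q1, q2, q3, q4⟩ := hq
  have e : shift i (p * q) - p * q = (shift i p - p) * shift i q + p * (shift i q - q) := by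
    rw [map_mul]; ring
  refine ⟨(MvPolynomial.totalDegree_mul _ _).trans (add_le_add p1 q1), ?_, fun h => ?_,
    fun n hn => ?_⟩
  · rw [map_mul]
    exact (MvPolynomial.totalDegree_mul _ _).trans (add_le_add p2 q2)
  · rw [e, p3 (by omega), q3 (by omega)]; ring
  · rw [e]
    refine (MvPolynomial.totalDegree_add _ _).trans (max_le ?_ ?_)
    · rcases k with _ | k
      · rw [p3 rfl]; simp
      · refine (MvPolynomial.totalDegree_mul _ _).trans ?_
        have := p4 k rfl
        omega
    · rcases k' with _ | k'
      · rw [q3 rfl]; simp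
      · refine (MvPolynomial.totalDegree_mul _ _).trans ?_
        have := q4 k' rfl
        omega

lemma diffDegree_C (i : Fin 2) (a : ℝ) : DiffDegree i 0 (MvPolynomial.C a) := by
  refine ⟨by simp, by simp [shift], by simp [shift], by simp⟩

lemma diffDegree_X_pow (i j : Fin 2) (n : ℕ) : DiffDegree i n (MvPolynomial.X j ^ n) := by
  have hX : DiffDegree i 1 (MvPolynomial.X j) := by
    refine ⟨by simp, ?_, by simp, ?_⟩
    · rw [shift, MvPolynomial.bind₁_X_right]
      exact (MvPolynomial.totalDegree_add _ _).trans (max_le (by simp)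
        (by rw [MvPolynomial.totalDegree_C]; exact Nat.zero_le _))
    · intro n hn
      rw [shift, MvPolynomial.bind₁_X_right, add_sub_cancel_left, MvPolynomial.totalDegree_C]
      exact Nat.zero_le _
  induction n with
  | zero => simpa using diffDegree_C i 1
  | succ n ih => rw [pow_succ]; exact ih.mul hX

lemma totalDegree_shift_sub_le (i : Fin 2) {n : ℕ} {p : MvPolynomial (Fin 2) ℝ}
    (hp : p.totalDegree ≤ n + 1) : (shift i p - p).totalDegree ≤ n := by
  have e : shift i p - p = ∑ m ∈ p.support,
      (shift i (MvPolynomial.monomial m (p.coeff m)) - MvPolynomial.monomial m (p.coeff m)) := by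
    conv_lhs => rw [p.as_sum, map_sum, ← Finset.sum_sub_distrib]
  rw [e]
  refine MvPolynomial.totalDegree_finsetSum_le fun m hm => ?_
  have hm' : MvPolynomial.monomial m (p.coeff m) =
      MvPolynomial.C (p.coeff m) * (MvPolynomial.X 0 ^ m 0 * MvPolynomial.X 1 ^ m 1) := by
    rw [MvPolynomial.monomial_eq, Finsupp.prod_fintype _ _ (by simp), Fin.prod_univ_two]
  have hdeg : m 0 + m 1 ≤ n + 1 := by
    have := (MvPolynomial.le_totalDegree hm).trans hp
    rwa [Finsupp.sum_fintype _ _ (by simp), Fin.sum_univ_two] at this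
  have := (diffDegree_C i (p.coeff m)).mul ((diffDegree_X_pow i 0 (m 0)).mul
    (diffDegree_X_pow i 1 (m 1)))
  rw [← hm'] at this
  rcases h : m 0 + m 1 with _ | k
  · rw [this.2.2.1 (by omega)]; simp
  · exact (this.2.2.2 k (by omega)).trans (by omega)

/-- Induction on the degree: both unit differences have lower degree and vanish on the smaller
lattice, so they are zero. Then `p` is invariant under unit shifts and vanishes on all of ℕ², which
forces it to be zero. -/
lemma eq_zero_of_vanishing_on_naturals (n : ℕ) : ∀ p : MvPolynomial (Fin 2) ℝ, p.totalDegree ≤ n →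
    (∀ i j : ℕ, i + j ≤ n → MvPolynomial.eval ![(i : ℝ), j] p = 0) → p = 0 := by
  induction n with
  | zero =>
    intro p hp h
    rw [Nat.le_zero, MvPolynomial.totalDegree_eq_zero_iff_eq_C] at hp
    have := h 0 0 le_rfl
    rw [hp, MvPolynomial.eval_C] at this
    rw [hp, this, map_zero]
  | succ n ih =>
    intro p hp h
    have e0 (i j : ℕ) : (fun k => ![(i : ℝ), j] k + if k = 0 then (1 : ℝ) else 0) =
        ![((i + 1 : ℕ) : ℝ), j] := by
      ext k; fin_cases k <;> simp
    have e1 (i j : ℕ) : (fun k => ![(i : ℝ), j] k + if k = 1 then (1 : ℝ) else 0) =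
        ![(i : ℝ), (j + 1 : ℕ)] := by
      ext k; fin_cases k <;> simp
    have h0 : shift 0 p - p = 0 := ih _ (totalDegree_shift_sub_le 0 hp) fun i j hij => by
      rw [map_sub, eval_shift, e0, h _ _ (by omega), h _ _ (by omega), sub_zero]
    have h1 : shift 1 p - p = 0 := ih _ (totalDegree_shift_sub_le 1 hp) fun i j hij => by
      rw [map_sub, eval_shift, e1, h _ _ (by omega), h _ _ (by omega), sub_zero]
    have k0 (i j : ℕ) : MvPolynomial.eval ![((i + 1 : ℕ) : ℝ), j] p =
        MvPolynomial.eval ![(i : ℝ), j] p := by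
      rw [← e0, ← eval_shift, sub_eq_zero.1 h0]
    have k1 (i j : ℕ) : MvPolynomial.eval ![(i : ℝ), (j + 1 : ℕ)] p =
        MvPolynomial.eval ![(i : ℝ), j] p := by
      rw [← e1, ← eval_shift, sub_eq_zero.1 h1]
    have hall : ∀ i j : ℕ, MvPolynomial.eval ![(i : ℝ), j] p = 0 := by
      intro i j
      induction j with
      | zero =>
        induction i with
        | zero => exact h 0 0 (by omega)
        | succ i ihi => rw [k0, ihi]
      | succ j ihj => rw [k1, ihj]
    refine MvPolynomial.funext_set (fun _ => range ((↑) : ℕ → ℝ))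
      (fun _ => infinite_range_of_injective Nat.cast_injective) fun x hx => ?_
    obtain ⟨i, hi⟩ := hx 0 (mem_univ _)
    obtain ⟨j, hj⟩ := hx 1 (mem_univ _)
    have : x = ![(i : ℝ), j] := by ext k; fin_cases k <;> simp [hi, hj]
    rw [this, hall, map_zero]

lemma eq_zero_of_vanishing_on_lattice {l : ℕ} (hl : 0 < l) {p : MvPolynomial (Fin 2) ℝ}
    (hp : p.totalDegree ≤ l)
    (h : ∀ i j : ℕ, i + j ≤ l → MvPolynomial.eval ![(i : ℝ) / l, (j : ℝ) / l] p = 0) : p = 0 := by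
  have hl' : (l : ℝ) ≠ 0 := by positivity
  set q : MvPolynomial (Fin 2) ℝ := MvPolynomial.bind₁ (fun i : Fin 2 => MvPolynomial.C 0 +
    MvPolynomial.C (if i = 0 then (1 / l : ℝ) else 0) * MvPolynomial.X 0 +
    MvPolynomial.C (if i = 1 then (1 / l : ℝ) else 0) * MvPolynomial.X 1) p
  have hq (x : Fin 2 → ℝ) : MvPolynomial.eval x q = MvPolynomial.eval (fun i => x i / l) p := by
    rw [eval_bind₁]
    congr 2
    ext i; fin_cases i <;> simp <;> ring
  have : q = 0 := by
    refine eq_zero_of_vanishing_on_naturals l q ((totalDegree_bind₁_le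
      (fun i => totalDegree_affine_le _ _ _) p).trans hp) fun i j hij => ?_
    rw [hq, ← h i j hij]
    congr 2
    ext k; fin_cases k <;> simp
  refine MvPolynomial.funext fun x => ?_
  have e := hq (fun i => x i * l)
  rw [this] at e
  simp only [mul_div_cancel_right₀ _ hl'] at e
  rw [← e, map_zero, map_zero]

/-- Polynomials on the reference triangle are controlled by their values at the lattice points. -/
lemma exists_reference_bound {l : ℕ} (hl : 0 < l) : ∃ C : ℝ, 0 ≤ C ∧
    ∀ p : MvPolynomial (Fin 2) ℝ, p.totalDegree ≤ l → ∀ M : ℝ,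
      (∀ i j : ℕ, i + j ≤ l → |MvPolynomial.eval ![(i : ℝ) / l, (j : ℝ) / l] p| ≤ M) →
      ∀ x ∈ refTri, |MvPolynomial.eval ![x.1, x.2] p| ≤ C * M ∧
        ∀ k, |MvPolynomial.eval ![x.1, x.2] (MvPolynomial.pderiv k p)| ≤ C * M := by
  classical
  let V := MvPolynomial.restrictTotalDegree (Fin 2) ℝ l
  let I := {a : Fin (l + 1) × Fin (l + 1) // (a.1 : ℕ) + a.2 ≤ l}
  let L : V →ₗ[ℝ] I → ℝ := LinearMap.pi fun a =>
    (MvPolynomial.aeval ![((a.1.1 : ℕ) : ℝ) / l, ((a.1.2 : ℕ) : ℝ) / l]).toLinearMap ∘ₗ V.subtype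
  have hL (p : V) (a : I) : L p a =
      MvPolynomial.eval ![((a.1.1 : ℕ) : ℝ) / l, ((a.1.2 : ℕ) : ℝ) / l] (p : MvPolynomial (Fin 2) ℝ) := by
    simp [L, MvPolynomial.aeval_eq_eval]
  have hinj : LinearMap.ker L = ⊥ := by
    rw [LinearMap.ker_eq_bot']
    intro p hp
    have := eq_zero_of_vanishing_on_lattice hl ((MvPolynomial.mem_restrictTotalDegree _ _ _).1 p.2)
      fun i j hij => by
        have := congrFun hp ⟨(⟨i, by omega⟩, ⟨j, by omega⟩), hij⟩
        rw [hL] at this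
        simpa using this
    exact Subtype.ext this
  -- A left inverse of the nodal evaluation provides polynomials playing the role of a nodal basis.
  -- There are finitely many, so `C` can be the sum of their bounds on the compact reference
  -- triangle.
  obtain ⟨R, hR⟩ := L.exists_leftInverse_of_injective hinj
  have hrep (p : V) : p = ∑ a : I, L p a • R (Pi.single a 1) := by
    have h1 : R (L p) = p := LinearMap.congr_fun hR p
    conv_lhs => rw [← h1, pi_eq_sum_univ' (L p), map_sum]
    refine Finset.sum_congr rfl fun a _ => ?_
    rw [map_smul]
  have hbd (q : MvPolynomial (Fin 2) ℝ) : ∃ B : ℝ, ∀ x ∈ refTri,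
      |MvPolynomial.eval ![x.1, x.2] q| ≤ B := by
    have hc : Continuous fun x : ℝ × ℝ => MvPolynomial.eval ![x.1, x.2] q := by
      have := (contDiff_eval_comp (E := ℝ × ℝ) (n := 0) (g := ![Prod.fst, Prod.snd])
        (fun i => by fin_cases i <;> [exact contDiff_fst; exact contDiff_snd]) q).continuous
      convert! this using 4 with x
      ext i; fin_cases i <;> rfl
    obtain ⟨B, hB⟩ := isCompact_refTri.exists_bound_of_continuousOn hc.continuousOn
    exact ⟨B, fun x hx => by simpa using hB x hx⟩
  have hbd' (a : I) : ∃ B : ℝ, 0 ≤ B ∧ ∀ x ∈ refTri,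
      |MvPolynomial.eval ![x.1, x.2] (R (Pi.single a 1) : MvPolynomial (Fin 2) ℝ)| ≤ B ∧
      ∀ k, |MvPolynomial.eval ![x.1, x.2]
        (MvPolynomial.pderiv k (R (Pi.single a 1) : MvPolynomial (Fin 2) ℝ))| ≤ B := by
    obtain ⟨B, hB⟩ := hbd (R (Pi.single a 1))
    obtain ⟨B0, hB0⟩ := hbd (MvPolynomial.pderiv 0 (R (Pi.single a 1) : MvPolynomial (Fin 2) ℝ))
    obtain ⟨B1, hB1⟩ := hbd (MvPolynomial.pderiv 1 (R (Pi.single a 1) : MvPolynomial (Fin 2) ℝ))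
    refine ⟨|B| + |B0| + |B1|, by positivity, fun x hx => ⟨?_, fun k => ?_⟩⟩
    · linarith [hB x hx, le_abs_self B, abs_nonneg B0, abs_nonneg B1]
    · fin_cases k
      · exact (hB0 x hx).trans (by linarith [le_abs_self B0, abs_nonneg B, abs_nonneg B1])
      · exact (hB1 x hx).trans (by linarith [le_abs_self B1, abs_nonneg B, abs_nonneg B0])
  choose B hB0 hB using hbd'
  refine ⟨∑ a, B a, Finset.sum_nonneg fun a _ => hB0 a, fun p hp M hM x hx => ?_⟩
  have hp' := congrArg (Subtype.val) (hrep ⟨p, (MvPolynomial.mem_restrictTotalDegree _ _ _).2 hp⟩)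
  simp only [AddSubmonoidClass.coe_finsetSum, Submodule.coe_smul] at hp'
  have hM' (a : I) : |L ⟨p, (MvPolynomial.mem_restrictTotalDegree _ _ _).2 hp⟩ a| ≤ M := by
    rw [hL]; exact hM _ _ a.2
  have key (f : MvPolynomial (Fin 2) ℝ →ₗ[ℝ] ℝ)
      (hf : ∀ a, |f (R (Pi.single a 1) : MvPolynomial (Fin 2) ℝ)| ≤ B a) :
      |f p| ≤ (∑ a, B a) * M := by
    rw [hp', map_sum, Finset.sum_mul]
    refine (Finset.abs_sum_le_sum_abs _ _).trans (Finset.sum_le_sum fun a _ => ?_)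
    rw [map_smul, smul_eq_mul, abs_mul, mul_comm]
    exact mul_le_mul (hf a) (hM' a) (abs_nonneg _) (hB0 a)
  constructor
  · have := key (MvPolynomial.aeval ![x.1, x.2]).toLinearMap fun a => by
      simpa [MvPolynomial.aeval_eq_eval] using (hB a x hx).1
    simpa [MvPolynomial.aeval_eq_eval] using this
  · intro k
    have := key ((MvPolynomial.aeval ![x.1, x.2]).toLinearMap ∘ₗ
      (MvPolynomial.pderiv k).toLinearMap) fun a => by
      simpa [MvPolynomial.aeval_eq_eval] using (hB a x hx).2 k
    simpa [MvPolynomial.aeval_eq_eval] using this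

/-! ### Polynomials on segments -/

/-- The restriction of a polynomial to a segment. -/
lemma exists_seg_coeffs (l : ℕ) (p : MvPolynomial (Fin 2) ℝ) (hp : p.totalDegree ≤ l)
    (a b : Plane) : ∃ q : Polynomial ℝ, q.natDegree ≤ l ∧ ∀ t, ev p (seg a b t) = q.eval t := by
  let f : Fin 2 → Polynomial ℝ := fun i =>
    Polynomial.C (a i) + Polynomial.C (b i - a i) * Polynomial.X
  have hf : ∀ i, (f i).natDegree ≤ 1 := fun i => by
    refine Polynomial.natDegree_add_le_of_degree_le (by simp) ?_
    refine Polynomial.natDegree_mul_le.trans ?_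
    simp
  refine ⟨MvPolynomial.aeval f p, ?_, fun t => ?_⟩
  · conv_lhs => rw [p.as_sum, map_sum]
    refine Polynomial.natDegree_sum_le_of_forall_le _ _ fun m hm => ?_
    rw [MvPolynomial.aeval_monomial]
    refine Polynomial.natDegree_mul_le.trans ?_
    rw [Polynomial.algebraMap_eq, Polynomial.natDegree_C, zero_add]
    refine (Polynomial.natDegree_prod_le _ _).trans (le_trans ?_ hp)
    refine le_trans (Finset.sum_le_sum fun i _ => ?_) (MvPolynomial.le_totalDegree hm)
    refine Polynomial.natDegree_pow_le.trans ?_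
    simpa using Nat.mul_le_mul_left (m i) (hf i)
  · rw [ev, ← Polynomial.coe_evalRingHom, ← RingHom.coe_coe (MvPolynomial.aeval f),
      ← RingHom.comp_apply]
    congr 1
    refine MvPolynomial.ringHom_ext (fun r => by simp) fun i => ?_
    simp [f, seg]; ring

/-- Inverse inequality on the unit interval. -/
lemma exists_inverse_bound (l : ℕ) : ∃ C : ℝ, 0 < C ∧ ∀ q : Polynomial ℝ, q.natDegree ≤ l →
    ∀ t ∈ Icc (0 : ℝ) 1, q.eval t ^ 2 ≤ C * ∫ s in (0 : ℝ)..1, q.eval s ^ 2 := by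
  let P : (Fin (l + 1) → ℝ) → ℝ → ℝ := fun c t => ∑ i, c i * t ^ (i : ℕ)
  have hPc : Continuous fun x : (Fin (l + 1) → ℝ) × ℝ => P x.1 x.2 := by
    simp only [P]; fun_prop
  let f : (Fin (l + 1) → ℝ) → ℝ := fun c => ∫ s in (0 : ℝ)..1, P c s ^ 2
  have hf : Continuous f :=
    intervalIntegral.continuous_parametric_intervalIntegral_of_continuous' (by
      exact hPc.pow 2) 0 1
  have hP1 (c : Fin (l + 1) → ℝ) : Continuous (P c) := hPc.comp (by fun_prop : Continuous fun t : ℝ => (c, t))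
  have hfpos : ∀ c, c ≠ 0 → 0 < f c := by
    intro c hc
    by_contra! hle
    have h0 : ∀ t ∈ Ioo (0 : ℝ) 1, P c t = 0 := by
      intro t ht
      by_contra hne
      have : 0 < f c := by
        refine intervalIntegral.integral_pos one_pos ((hP1 c).pow 2).continuousOn
          (fun _ _ => sq_nonneg _) ⟨t, Ioo_subset_Icc_self ht, by positivity⟩
      linarith
    let q : Polynomial ℝ := ∑ i : Fin (l + 1), Polynomial.C (c i) * Polynomial.X ^ (i : ℕ)
    have hq : ∀ t, q.eval t = P c t := fun t => by simp [q, P, Polynomial.eval_finsetSum]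
    have hq0 : q = 0 := by
      refine Polynomial.eq_zero_of_infinite_isRoot q ((Ioo_infinite (zero_lt_one' ℝ)).mono ?_)
      intro t ht
      change q.eval t = 0
      rw [hq, h0 t ht]
    refine hc (funext fun i => ?_)
    have := congrArg (fun r => Polynomial.coeff r i) hq0
    simp only [q, Polynomial.finsetSum_coeff, Polynomial.coeff_C_mul, Polynomial.coeff_X_pow,
      Polynomial.coeff_zero] at this
    rw [Finset.sum_eq_single i (fun j _ hj => by
      rw [if_neg (fun h => hj (Fin.ext h.symm)), mul_zero]) (by simp)] at this
    simpa using this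
  -- Equivalence of norms on coefficient vectors: the squared L² norm is positive and continuous, so
  -- it has a positive minimum on the unit sphere, and it is 2-homogeneous.
  obtain ⟨c₀, hc₀, hmin⟩ := (isCompact_sphere (0 : Fin (l + 1) → ℝ) 1).exists_isMinOn
    (NormedSpace.sphere_nonempty.2 zero_le_one) hf.continuousOn
  have hc₀' : c₀ ≠ 0 := by
    rintro rfl; simp at hc₀
  have hm := hfpos c₀ hc₀'
  -- On the unit interval a polynomial is at most `l + 1` times its largest coefficient.
  refine ⟨(l + 1) ^ 2 / f c₀, by positivity, fun q hq t ht => ?_⟩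
  let c : Fin (l + 1) → ℝ := fun i => q.coeff i
  have hqc : ∀ s, q.eval s = P c s := fun s => by
    rw [Polynomial.eval_eq_sum_range' (Nat.lt_succ_of_le hq), Finset.sum_range]
  have hfc : f c₀ * ‖c‖ ^ 2 ≤ f c := by
    by_cases h0 : c = 0
    · rw [h0]
      simp only [norm_zero, f, P]
      simp
    · have hn : ‖c‖ ≠ 0 := norm_ne_zero_iff.2 h0
      have h1 : f c₀ ≤ f (‖c‖⁻¹ • c) := hmin (by simp [norm_smul, hn])
      have h2 : f (‖c‖⁻¹ • c) = (‖c‖⁻¹) ^ 2 * f c := by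
        simp only [f]
        rw [← intervalIntegral.integral_const_mul]
        refine intervalIntegral.integral_congr fun s _ => ?_
        have : P (‖c‖⁻¹ • c) s = ‖c‖⁻¹ * P c s := by
          simp only [P, Finset.mul_sum, Pi.smul_apply, smul_eq_mul, mul_assoc]
        simp only [this]; ring
      rw [h2] at h1
      calc f c₀ * ‖c‖ ^ 2 ≤ ((‖c‖⁻¹) ^ 2 * f c) * ‖c‖ ^ 2 := by gcongr
        _ = f c := by field_simp
  have hb : |P c t| ≤ (l + 1) * ‖c‖ := by
    refine (Finset.abs_sum_le_sum_abs _ _).trans ?_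
    have : ∀ i ∈ (Finset.univ : Finset (Fin (l + 1))), |c i * t ^ (i : ℕ)| ≤ ‖c‖ := fun i _ => by
      rw [abs_mul, abs_pow, abs_of_nonneg ht.1]
      have h1 : |c i| ≤ ‖c‖ := norm_le_pi_norm c i
      have h2 : t ^ (i : ℕ) ≤ 1 := pow_le_one₀ ht.1 ht.2
      calc |c i| * t ^ (i : ℕ) ≤ ‖c‖ * 1 :=
            mul_le_mul h1 h2 (pow_nonneg ht.1 _) (norm_nonneg _)
        _ = ‖c‖ := mul_one _
    refine (Finset.sum_le_card_nsmul _ _ _ this).trans ?_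
    simp
  have hint : ∫ s in (0 : ℝ)..1, q.eval s ^ 2 = f c := by simp only [hqc, f]
  rw [hint, hqc, ← sq_abs]
  calc |P c t| ^ 2 ≤ ((l + 1) * ‖c‖) ^ 2 := by gcongr
    _ = (l + 1) ^ 2 / f c₀ * (f c₀ * ‖c‖ ^ 2) := by field_simp
    _ ≤ (l + 1) ^ 2 / f c₀ * f c := by gcongr

/-- Simpson's rule. -/
lemma simpson {q : Polynomial ℝ} (hq : q.natDegree ≤ 2) :
    ∫ t in (0 : ℝ)..1, q.eval t = (q.eval 0 + 4 * q.eval (1 / 2) + q.eval 1) / 6 := by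
  have h : ∀ t, q.eval t = q.coeff 0 + q.coeff 1 * t + q.coeff 2 * t ^ 2 := fun t => by
    rw [Polynomial.eval_eq_sum_range' (Nat.lt_succ_of_le hq)]
    simp [Finset.sum_range_succ]
  simp only [h]
  rw [intervalIntegral.integral_add (Continuous.intervalIntegrable (by fun_prop) _ _)
      (Continuous.intervalIntegrable (by fun_prop) _ _),
    intervalIntegral.integral_add (Continuous.intervalIntegrable (by fun_prop) _ _)
      (Continuous.intervalIntegrable (by fun_prop) _ _),
    intervalIntegral.integral_const_mul, intervalIntegral.integral_const_mul, integral_id,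
    integral_pow, intervalIntegral.integral_const]
  norm_num; ring

/-! ### Approximation by test functions: Lipschitz functions in H¹₀. -/

/-- Dominated convergence in `L²` on a finite measure space. -/
theorem tendsto_eLpNorm_sub_of_bounded {α : Type*} [MeasurableSpace α] {μ : Measure α}
    [IsFiniteMeasure μ] {f : ℕ → α → ℝ} {g : α → ℝ} (C : ℝ)
    (hf : ∀ n, AEStronglyMeasurable (f n) μ) (hg : AEStronglyMeasurable g μ)
    (hb : ∀ n, ∀ᵐ x ∂μ, |f n x - g x| ≤ C)
    (h : ∀ᵐ x ∂μ, Tendsto (fun n => f n x) atTop (𝓝 (g x))) :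
    Tendsto (fun n => eLpNorm (f n - g) 2 μ) atTop (𝓝 0) := by
  have key : Tendsto (fun n => ∫⁻ x, ‖(f n - g) x‖ₑ ^ (2 : ℝ) ∂μ) atTop (𝓝 (∫⁻ _, 0 ∂μ)) := by
    refine tendsto_lintegral_of_dominated_convergence' (fun _ => ENNReal.ofReal C ^ (2 : ℝ))
      (fun n => (((hf n).sub hg).enorm.pow_const _)) (fun n => ?_) ?_ ?_
    · filter_upwards [hb n] with x hx
      gcongr
      rw [Pi.sub_apply, Real.enorm_eq_ofReal_abs]
      exact ENNReal.ofReal_le_ofReal hx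
    · rw [lintegral_const]
      exact ENNReal.mul_ne_top (ENNReal.rpow_ne_top_of_nonneg (by norm_num) ENNReal.ofReal_ne_top)
        (measure_ne_top _ _)
    · filter_upwards [h] with x hx
      have h1 : Tendsto (fun n => ‖f n x - g x‖ₑ) atTop (𝓝 ‖g x - g x‖ₑ) :=
        (hx.sub_const _).enorm
      have h2 := h1.ennrpow_const (2 : ℝ)
      simpa using h2
  have h0 := key.ennrpow_const (1 / 2 : ℝ)
  simp only [lintegral_zero] at h0
  rw [ENNReal.zero_rpow_of_pos (by norm_num)] at h0
  refine h0.congr fun n => ?_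
  rw [eLpNorm_eq_lintegral_rpow_enorm_toReal (by norm_num) (by norm_num)]
  simp

open scoped Convolution

/-- The partial derivative in the sense of directional derivatives. -/
def dirDeriv (f : Plane → ℝ) (i : Fin 2) (x : Plane) : ℝ :=
  lineDeriv ℝ f x (EuclideanSpace.single i 1)

theorem abs_dirDeriv_le {f : Plane → ℝ} {C : NNReal} (hf : LipschitzWith C f) (i : Fin 2)
    (x : Plane) : |dirDeriv f i x| ≤ C := by
  have := norm_lineDeriv_le_of_lipschitz ℝ (v := EuclideanSpace.single i (1 : ℝ)) (x₀ := x) hf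
  simpa [dirDeriv] using this

theorem measurable_dirDeriv {f : Plane → ℝ} (hf : Continuous f) (i : Fin 2) :
    Measurable (dirDeriv f i) := measurable_lineDeriv hf

theorem locallyIntegrable_of_bounded {g : Plane → ℝ} (hg : Measurable g) {M : ℝ}
    (hM : ∀ x, |g x| ≤ M) : LocallyIntegrable g volume := by
  intro x
  refine ⟨Metric.ball x 1, Metric.ball_mem_nhds x one_pos, ?_⟩
  exact Measure.integrableOn_of_bounded (M := M) measure_ball_lt_top.ne hg.aestronglyMeasurable
    (Eventually.of_forall hM)

section Mollify

variable (φ : ContDiffBump (0 : Plane))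

/-- Mollification of a function with a smooth bump function. -/
def mollify (f : Plane → ℝ) : Plane → ℝ :=
  (φ.normed volume) ⋆[ContinuousLinearMap.lsmul ℝ ℝ, volume] f

theorem mollify_apply (f : Plane → ℝ) (x : Plane) :
    mollify φ f x = ∫ t, φ.normed volume t * f (x - t) := by
  rw [mollify, convolution_lsmul]; rfl

theorem abs_mollify_le {g : Plane → ℝ} {M : ℝ} (hM : ∀ x, |g x| ≤ M) (x : Plane) :
    |mollify φ g x| ≤ M := by
  rw [mollify_apply]
  have h : ‖∫ t, φ.normed volume t * g (x - t)‖ ≤ ∫ t, φ.normed volume t * M := by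
    refine norm_integral_le_of_norm_le (φ.integrable_normed.mul_const M)
      (Eventually.of_forall fun t => ?_)
    rw [norm_mul, Real.norm_of_nonneg (φ.nonneg_normed t)]
    exact mul_le_mul_of_nonneg_left (hM _) (φ.nonneg_normed t)
  rwa [integral_mul_const, φ.integral_normed, one_mul] at h

theorem contDiff_mollify {f : Plane → ℝ} (hf : Continuous f) : ContDiff ℝ ∞ (mollify φ f) :=
  HasCompactSupport.contDiff_convolution_left _ φ.hasCompactSupport_normed
    φ.contDiff_normed hf.locallyIntegrable

/-- Difference quotients of a Lipschitz function are bounded and converge almost everywhere, so the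
derivative may be moved under the integral and onto `f`. -/
theorem pderiv_mollify {f : Plane → ℝ} {C : NNReal} (hf : LipschitzWith C f) (i : Fin 2)
    (x : Plane) : pderiv i (mollify φ f) x = mollify φ (dirDeriv f i) x := by
  set e : Plane := EuclideanSpace.single i 1 with he
  have hne : ‖e‖ = 1 := by simp [he]
  have hd : DifferentiableAt ℝ (mollify φ f) x :=
    (contDiff_mollify φ hf.continuous).differentiable (by simp) x
  have hm : Measurable (dirDeriv f i) := measurable_dirDeriv hf.continuous i
  have h := hasDerivAt_integral_of_dominated_loc_of_lip (μ := (volume : Measure Plane))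
    (F := fun (s : ℝ) t => φ.normed volume t * f (x + s • e - t)) (x₀ := 0) (s := univ)
    (F' := fun t => φ.normed volume t * dirDeriv f i (x - t))
    (bound := fun t => φ.normed volume t * C) univ_mem
    (Eventually.of_forall fun s => (φ.continuous_normed.mul
      (hf.continuous.comp (by fun_prop))).aestronglyMeasurable)
    ((φ.continuous_normed.mul
      (hf.continuous.comp (by fun_prop))).integrable_of_hasCompactSupport
        φ.hasCompactSupport_normed.mul_right)
    (φ.continuous_normed.measurable.mul (hm.comp (by fun_prop))).aestronglyMeasurable
    (Eventually.of_forall fun t => ?_) (φ.integrable_normed.mul_const _) ?_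
  · have h1 : HasDerivAt (fun s : ℝ => mollify φ f (x + s • e))
        (mollify φ (dirDeriv f i) x) 0 := by
      simp only [mollify_apply]
      exact h.2
    have h2 : lineDeriv ℝ (mollify φ f) x e = mollify φ (dirDeriv f i) x := h1.deriv
    rw [← h2, hd.lineDeriv_eq_fderiv]; rfl
  · refine LipschitzOnWith.of_dist_le_mul fun s _ s' _ => ?_
    rw [Real.dist_eq, ← mul_sub, abs_mul, abs_of_nonneg (φ.nonneg_normed t)]
    have h1 := hf.dist_le_mul (x + s • e - t) (x + s' • e - t)
    rw [Real.dist_eq, dist_eq_norm,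
      show x + s • e - t - (x + s' • e - t) = (s - s') • e by module, norm_smul, hne,
      mul_one, Real.norm_eq_abs] at h1
    rw [Real.dist_eq, Real.coe_nnabs, abs_of_nonneg (mul_nonneg (φ.nonneg_normed (μ := volume) t) C.coe_nonneg),
      mul_assoc]
    exact mul_le_mul_of_nonneg_left h1 (φ.nonneg_normed t)
  -- Almost everywhere differentiability of Lipschitz functions along lines, transported by the
  -- measure-preserving map `t ↦ x - t`.
  · have h1 := (Measure.measurePreserving_sub_left (volume : Measure Plane) x).quasiMeasurePreserving.ae
      (hf.ae_lineDifferentiableAt (μ := volume) e)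
    filter_upwards [h1] with t ht
    have h2 : HasDerivAt (fun s : ℝ => f (x - t + s • e)) (dirDeriv f i (x - t)) 0 :=
      ht.hasLineDerivAt
    have h3 := h2.const_mul (φ.normed volume t)
    refine h3.congr_of_eventuallyEq (Eventually.of_forall fun s => ?_)
    simp only [add_sub_right_comm]

theorem tsupport_mollify_subset (f : Plane → ℝ) :
    tsupport (mollify φ f) ⊆ Metric.cthickening φ.rOut (tsupport f) := by
  refine closure_minimal (fun x hx => ?_) Metric.isClosed_cthickening
  have h := support_convolution_subset (ContinuousLinearMap.lsmul ℝ ℝ) hx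
  rw [ContDiffBump.support_normed_eq] at h
  obtain ⟨a, ha, b, hb, rfl⟩ := h
  refine Metric.mem_cthickening_of_dist_le (a + b) b _ _ (subset_tsupport _ hb) ?_
  simpa [dist_eq_norm] using (mem_ball_zero_iff.1 ha).le

end Mollify

/-- Lipschitz functions with compact support in `Ω` are limits of test functions. -/
theorem exists_testFunctions_of_lipschitz {Ω : Set Plane} (hΩ : IsOpen Ω)
    (hb : Bornology.IsBounded Ω) {f : Plane → ℝ} {C : NNReal} (hf : LipschitzWith C f)
    (hc : HasCompactSupport f) (hs : tsupport f ⊆ Ω) :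
    ∃ φ : ℕ → Plane → ℝ, (∀ n, IsTestFunction Ω (φ n)) ∧ TendstoH1 Ω φ f (dirDeriv f) := by
  have : IsFiniteMeasure ((volume : Measure Plane).restrict Ω) :=
    ⟨by simpa using hb.measure_lt_top⟩
  obtain ⟨δ, hδ, hsub⟩ := IsCompact.exists_cthickening_subset_open hc hΩ hs
  obtain ⟨M, hM⟩ := hf.continuous.bounded_above_of_compact_support hc
  have hM' : ∀ x, |f x| ≤ M := hM
  have hpos : ∀ n : ℕ, 0 < δ / (n + 2) := fun n => by positivity
  -- Outer radii at most `δ` keep the supports inside `Ω`; the fixed ratio 2 of the radii is what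
  -- a.e. convergence of mollifications requires.
  let ψ : ℕ → ContDiffBump (0 : Plane) := fun n =>
    ⟨δ / (n + 2) / 2, δ / (n + 2), half_pos (hpos n), half_lt_self (hpos n)⟩
  have hle : ∀ n, (ψ n).rOut ≤ δ := fun n => div_le_self hδ.le (by
    have : (0 : ℝ) ≤ n := Nat.cast_nonneg n
    linarith)
  have hr : Tendsto (fun n => (ψ n).rOut) atTop (𝓝 0) := by
    have h1 := (tendsto_const_div_atTop_nhds_zero_nat δ).comp (tendsto_add_atTop_nat 2)
    refine h1.congr fun n => ?_
    simp [ψ]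
  have hK : ∀ᶠ n in atTop, (ψ n).rOut ≤ 2 * (ψ n).rIn := Eventually.of_forall fun n => by
    simp only [ψ]; linarith
  have hconv : ∀ g : Plane → ℝ, Measurable g → ∀ B : ℝ, (∀ x, |g x| ≤ B) →
      (∀ n, AEStronglyMeasurable (mollify (ψ n) g) (volume.restrict Ω)) →
      Tendsto (fun n => eLpNorm (mollify (ψ n) g - g) 2 (volume.restrict Ω)) atTop (𝓝 0) := by
    intro g hg B hB hmm
    refine tendsto_eLpNorm_sub_of_bounded (B + B) hmm hg.aestronglyMeasurable
      (fun n => Eventually.of_forall fun x => ?_) ?_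
    · exact (abs_sub _ _).trans (add_le_add (abs_mollify_le _ hB x) (hB x))
    · exact ae_restrict_of_ae (ContDiffBump.ae_convolution_tendsto_right_of_locallyIntegrable hr hK
        (locallyIntegrable_of_bounded hg hB))
  refine ⟨fun n => mollify (ψ n) f, fun n => ⟨contDiff_mollify _ hf.continuous, ?_, ?_⟩, ?_, ?_⟩
  · exact HasCompactSupport.intro' (K := Metric.cthickening (ψ n).rOut (tsupport f))
      (IsCompact.cthickening hc) Metric.isClosed_cthickening fun x hx => by
        by_contra h
        exact hx (tsupport_mollify_subset _ _ (subset_tsupport _ h))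
  · exact (tsupport_mollify_subset _ _).trans ((Metric.cthickening_mono (hle n) _).trans hsub)
  · exact hconv f hf.continuous.measurable M hM' fun n =>
      (contDiff_mollify _ hf.continuous).continuous.aestronglyMeasurable
  · intro i
    have hm := measurable_dirDeriv hf.continuous i
    have he : ∀ n, pderiv i (mollify (ψ n) f) = mollify (ψ n) (dirDeriv f i) := fun n =>
      funext fun x => pderiv_mollify _ hf i x
    refine ⟨MemLp.of_bound hm.aestronglyMeasurable C
      (Eventually.of_forall (abs_dirDeriv_le hf i)), ?_⟩
    simp only [he]
    refine hconv _ hm C (abs_dirDeriv_le hf i) fun n => ?_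
    rw [← he]
    exact (continuous_pderiv ((contDiff_mollify _ hf.continuous).of_le (by norm_cast)) i).aestronglyMeasurable

/-- A membership criterion for `H¹₀(Ω)`. -/
theorem mem_H10_of_approx {Ω : Set Plane} {f : Plane → ℝ} {G : Fin 2 → Plane → ℝ}
    (hG : ∀ i, MemLp (G i) 2 (volume.restrict Ω))
    (h : ∀ ε : ENNReal, 0 < ε → ∃ φ, IsTestFunction Ω φ ∧
      eLpNorm (φ - f) 2 (volume.restrict Ω) ≤ ε ∧
      ∀ i, eLpNorm (pderiv i φ - G i) 2 (volume.restrict Ω) ≤ ε)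
    {v : L2 Ω} (hv : v =ᵐ[volume.restrict Ω] f) : v ∈ H10 Ω := by
  have hpos : ∀ n : ℕ, (0 : ENNReal) < ((n : ENNReal))⁻¹ := fun n => by simp
  choose φ h1 h2 h3 using fun n : ℕ => h _ (hpos n)
  have h0 : Tendsto (fun n : ℕ => ((n : ENNReal))⁻¹) atTop (𝓝 0) :=
    ENNReal.tendsto_inv_nat_nhds_zero
  refine ⟨φ, G, h1, ?_, fun i => ⟨hG i, ?_⟩⟩
  · refine tendsto_of_tendsto_of_tendsto_of_le_of_le tendsto_const_nhds h0
      (fun n => zero_le) fun n => (le_of_eq (eLpNorm_congr_ae ?_)).trans (h2 n)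
    filter_upwards [hv] with x hx
    simp [hx]
  · exact tendsto_of_tendsto_of_tendsto_of_le_of_le tendsto_const_nhds h0
      (fun n => zero_le) fun n => h3 n i

/-- Lipschitz functions vanishing outside the bounded open set `Ω` belong to `H¹₀(Ω)`. -/
theorem mem_H10_of_lipschitz {Ω : Set Plane} (hΩ : IsOpen Ω)
    (hb : Bornology.IsBounded Ω) {f : Plane → ℝ} {C : NNReal} (hf : LipschitzWith C f)
    (h0 : ∀ x, x ∉ Ω → f x = 0) {v : L2 Ω} (hv : v =ᵐ[volume.restrict Ω] f) : v ∈ H10 Ω := by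
  have : IsFiniteMeasure ((volume : Measure Plane).restrict Ω) :=
    ⟨by simpa using hb.measure_lt_top⟩
  have hfc := hf.continuous
  let ε : ℕ → ℝ := fun n => 1 / ((n : ℝ) + 1)
  have hε : ∀ n, 0 < ε n := fun n => by positivity
  have hε0 : Tendsto ε atTop (𝓝 0) := tendsto_one_div_add_atTop_nhds_zero_nat
  -- Soft thresholding: `g n` is within `ε n` of `f`, stays Lipschitz uniformly in `n`, and vanishes
  -- where `|f| ≤ ε n`, so its support is a compact subset of `Ω`.
  let g : ℕ → Plane → ℝ := fun n x => f x - max (-ε n) (min (f x) (ε n))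
  have hg : ∀ n, LipschitzWith (C + C) (g n) := fun n =>
    hf.sub ((hf.min_const (ε n)).const_max (-ε n))
  have hgz : ∀ n x, |f x| ≤ ε n → g n x = 0 := fun n x hx => by
    obtain ⟨h1, h2⟩ := abs_le.1 hx
    simp only [g]
    rw [min_eq_left h2, max_eq_right h1, sub_self]
  have hgf : ∀ n x, |g n x - f x| ≤ ε n := fun n x => by
    have h1 := hε n
    simp only [g, sub_sub_cancel_left, abs_neg]
    exact abs_le.2 ⟨le_max_left _ _, max_le (by linarith) (min_le_right _ _)⟩
  have hsub : ∀ n, tsupport (g n) ⊆ {x | ε n ≤ |f x|} := fun n =>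
    closure_minimal (fun x hx => by
      by_contra h
      exact hx (hgz n x (not_le.1 h).le)) (isClosed_le continuous_const hfc.abs)
  have hsub' : ∀ n, tsupport (g n) ⊆ Ω := fun n x hx => by
    by_contra h
    have h1 : ε n ≤ |f x| := hsub n hx
    rw [h0 x h, abs_zero] at h1
    exact absurd (hε n) (not_lt.2 h1)
  have hcomp : ∀ n, HasCompactSupport (g n) := fun n =>
    Metric.isCompact_of_isClosed_isBounded (isClosed_tsupport _) (hb.subset (hsub' n))
  -- With the gradient cut off on the zero set of `f`, the derivatives of `g n` converge at every
  -- point, and it need not be shown that the gradient of `f` vanishes a.e. on that set.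
  let G : Fin 2 → Plane → ℝ := fun i => indicator {x | f x ≠ 0} (dirDeriv f i)
  have hGm : ∀ i, AEStronglyMeasurable (G i) (volume.restrict Ω) := fun i =>
    ((measurable_dirDeriv hfc i).indicator
      (isOpen_ne_fun hfc continuous_const).measurableSet).aestronglyMeasurable
  have hGb : ∀ i x, |G i x| ≤ C := fun i x => by
    simp only [G, indicator]
    split_ifs
    · exact abs_dirDeriv_le hf i x
    · simp
  have hlim : ∀ i x, Tendsto (fun n => dirDeriv (g n) i x) atTop (𝓝 (G i x)) := by
    intro i x
    refine tendsto_const_nhds.congr' ?_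
    by_cases hx : f x = 0
    · refine Eventually.of_forall fun n => ?_
      have hev : g n =ᶠ[𝓝 x] fun _ => 0 := by
        have h1 : ∀ᶠ y in 𝓝 x, |f y| < ε n := hfc.abs.continuousAt.eventually_lt_const
          (by simpa [hx] using hε n)
        filter_upwards [h1] with y hy using hgz n y hy.le
      have h2 : dirDeriv (g n) i x = 0 := by
        rw [dirDeriv, hev.lineDeriv_eq]
        simp [lineDeriv]
      simp [G, hx, h2]
    · have h1 : ∀ᶠ n in atTop, ε n < |f x| :=
        hε0.eventually_lt_const (abs_pos.2 hx)
      filter_upwards [h1] with n hn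
      have hG : G i x = dirDeriv f i x := by simp [G, hx]
      have hn0 := hε n
      rw [hG]
      -- Where `|f| > ε n`, thresholding is locally the addition of a constant.
      have hkey : ∃ c, g n =ᶠ[𝓝 x] fun y => f y + c := by
        rcases lt_or_gt_of_ne hx with h | h
        · rw [abs_of_neg h] at hn
          refine ⟨ε n, ?_⟩
          filter_upwards [hfc.continuousAt.eventually_lt_const
            (show f x < -ε n by linarith)] with y hy
          simp only [g]
          rw [min_eq_left (by linarith), max_eq_left hy.le, sub_neg_eq_add]
        · rw [abs_of_pos h] at hn
          refine ⟨-ε n, ?_⟩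
          filter_upwards [hfc.continuousAt.eventually_const_lt hn] with y hy
          simp only [g]
          rw [min_eq_right hy.le, max_eq_right (by linarith), sub_eq_add_neg]
      obtain ⟨c, hc⟩ := hkey
      rw [dirDeriv, dirDeriv, hc.lineDeriv_eq]
      simp [lineDeriv, deriv_add_const]
  have hA : Tendsto (fun n => eLpNorm (g n - f) 2 (volume.restrict Ω)) atTop (𝓝 0) := by
    refine tendsto_eLpNorm_sub_of_bounded 1 (fun n => (hg n).continuous.aestronglyMeasurable)
      hfc.aestronglyMeasurable (fun n => Eventually.of_forall fun x => (hgf n x).trans ?_)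
      (Eventually.of_forall fun x => ?_)
    · have : (0 : ℝ) ≤ n := Nat.cast_nonneg n
      exact (div_le_one (by linarith)).2 (by linarith)
    · rw [tendsto_iff_dist_tendsto_zero]
      exact squeeze_zero (fun n => dist_nonneg) (fun n => hgf n x) hε0
  have hB : ∀ i, Tendsto (fun n => eLpNorm (dirDeriv (g n) i - G i) 2 (volume.restrict Ω)) atTop
      (𝓝 0) := fun i =>
    tendsto_eLpNorm_sub_of_bounded ((C + C : NNReal) + C)
      (fun n => (measurable_dirDeriv (hg n).continuous i).aestronglyMeasurable) (hGm i)
      (fun n => Eventually.of_forall fun x => (abs_sub _ _).trans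
        (add_le_add (abs_dirDeriv_le (hg n) i x) (hGb i x)))
      (Eventually.of_forall (hlim i))
  refine mem_H10_of_approx (G := G)
    (fun i => MemLp.of_bound (hGm i) C (Eventually.of_forall (hGb i))) (fun δ hδ => ?_) hv
  have hδ2 : 0 < δ / 2 := ENNReal.half_pos hδ.ne'
  have hev : ∀ᶠ n in atTop, eLpNorm (g n - f) 2 (volume.restrict Ω) < δ / 2 ∧
      ∀ i, eLpNorm (dirDeriv (g n) i - G i) 2 (volume.restrict Ω) < δ / 2 :=
    (hA.eventually_lt_const hδ2).and
      (eventually_all.2 fun i => (hB i).eventually_lt_const hδ2)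
  obtain ⟨n, hn1, hn2⟩ := hev.exists
  obtain ⟨φ, hφ, hφ1, hφ2⟩ :=
    exists_testFunctions_of_lipschitz hΩ hb (hg n) (hcomp n) (hsub' n)
  have hev' : ∀ᶠ m in atTop, eLpNorm (φ m - g n) 2 (volume.restrict Ω) < δ / 2 ∧
      ∀ i, eLpNorm (pderiv i (φ m) - dirDeriv (g n) i) 2 (volume.restrict Ω) < δ / 2 :=
    (hφ1.eventually_lt_const hδ2).and
      (eventually_all.2 fun i => (hφ2 i).2.eventually_lt_const hδ2)
  obtain ⟨m, hm1, hm2⟩ := hev'.exists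
  have hφs : ContDiff ℝ 1 (φ m) := (hφ m).1.of_le (by norm_cast)
  refine ⟨φ m, hφ m, ?_, fun i => ?_⟩
  · rw [← sub_add_sub_cancel (φ m) (g n) f, ← ENNReal.add_halves δ]
    exact (eLpNorm_add_le (hφs.continuous.sub (hg n).continuous).aestronglyMeasurable
      ((hg n).continuous.sub hfc).aestronglyMeasurable (by norm_num)).trans
      (add_le_add hm1.le hn1.le)
  · have hd := (measurable_dirDeriv (hg n).continuous i).aestronglyMeasurable
      (μ := volume.restrict Ω)
    rw [← sub_add_sub_cancel (pderiv i (φ m)) (dirDeriv (g n) i) (G i), ← ENNReal.add_halves δ]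
    exact (eLpNorm_add_le ((continuous_pderiv hφs i).aestronglyMeasurable.sub hd)
      (hd.sub (hGm i)) (by norm_num)).trans
      (add_le_add (hm2 i).le (hn2 i).le)

/-- A function that is Lipschitz on each member of a finite closed cover is Lipschitz. -/
theorem lipschitzWith_of_finite_closed_cover {ι : Type*} [Finite ι] {S : ι → Set Plane}
    (hS : ∀ i, IsClosed (S i)) (hcov : ∀ x, ∃ i, x ∈ S i) {f : Plane → ℝ} {C : NNReal}
    (hf : ∀ i, LipschitzOnWith C f (S i)) : LipschitzWith C f := by
  have hfc : Continuous f := (locallyFinite_of_finite S).continuous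
    (iUnion_eq_univ_iff.2 hcov) hS fun i => (hf i).continuousOn
  refine LipschitzWith.of_dist_le_mul fun x y => ?_
  have hdist : ∀ t t', dist (seg x y t) (seg x y t') = |t - t'| * dist x y := fun t t' => by
    rw [dist_eq_norm, dist_eq_norm, ← Real.norm_eq_abs, ← norm_sub_rev y x, ← norm_smul]
    congr 1
    simp only [seg]
    module
  -- Real induction along the segment: `s` is closed, and from each `t < 1` in it one can advance.
  let s : Set ℝ := {t | dist (f x) (f (seg x y t)) ≤ C * (t * dist x y)}
  have h1 : (1 : ℝ) ∈ s := by
    refine IsClosed.mem_of_ge_of_forall_exists_gt (a := 0) (b := 1) ?_ ?_ zero_le_one ?_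
    · exact (isClosed_le (continuous_const.dist (hfc.comp (continuous_seg x y)))
        (by fun_prop)).inter isClosed_Icc
    · simp [s, seg_zero]
    · rintro t ⟨hts, ht0, ht1⟩
      -- Since the cover is finite, one member is met arbitrarily close to the right of `t`; being
      -- closed, it also contains the point at `t`, so its Lipschitz bound applies.
      have hfr : ∃ i, ∃ᶠ t' in 𝓝[>] t, seg x y t' ∈ S i := by
        by_contra hcon
        push Not at hcon
        have h2 : ∀ᶠ t' in 𝓝[>] t, ∀ i, seg x y t' ∉ S i :=
          eventually_all.2 fun i => by simpa using hcon i
        obtain ⟨t', ht'⟩ := h2.exists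
        obtain ⟨i, hi⟩ := hcov (seg x y t')
        exact ht' i hi
      obtain ⟨i, hi⟩ := hfr
      have hti : seg x y t ∈ S i := by
        have h3 : ∃ᶠ t' in 𝓝 t, t' ∈ seg x y ⁻¹' S i := hi.filter_mono nhdsWithin_le_nhds
        exact ((hS i).preimage (continuous_seg x y)).mem_of_frequently_of_tendsto h3 tendsto_id
      obtain ⟨t', ht'S, ht'⟩ := (hi.and_eventually (Ioc_mem_nhdsGT ht1)).exists
      refine ⟨t', ?_, ht'⟩
      have h4 := (hf i).dist_le_mul _ hti _ ht'S
      rw [hdist, abs_sub_comm, abs_of_pos (sub_pos.2 ht'.1)] at h4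
      have h5 := dist_triangle (f x) (f (seg x y t)) (f (seg x y t'))
      change dist (f x) (f (seg x y t')) ≤ C * (t' * dist x y)
      change dist (f x) (f (seg x y t)) ≤ C * (t * dist x y) at hts
      calc _ ≤ _ := h5
        _ ≤ C * (t * dist x y) + C * ((t' - t) * dist x y) := add_le_add hts h4
        _ = _ := by ring
  have h2 : dist (f x) (f (seg x y 1)) ≤ C * (1 * dist x y) := h1
  rwa [seg_one, one_mul] at h2

/-! ### Gluing element-wise smooth functions. -/

namespace Triangulation

variable {Ω : Set Plane} (T : Triangulation Ω)

theorem isBounded (T : Triangulation Ω) : Bornology.IsBounded Ω := by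
  refine Bornology.IsBounded.subset ?_ subset_closure
  rw [← T.cover]
  exact (Bornology.isBounded_biUnion_finset T.cells).2 fun K _ => (isCompact_hull K).isBounded

/-- Compatible element-wise smooth functions vanishing on the boundary form a function in
`H¹₀(Ω)`. -/
theorem exists_H10_of_compatible (hΩ : IsOpen Ω) (hΩ' : interior (closure Ω) = Ω)
    {P : Finset Plane → Plane → ℝ} (hP : ∀ K ∈ T.cells, ContDiff ℝ ∞ (P K))
    (hcomp : ∀ K ∈ T.cells, ∀ K' ∈ T.cells, ∀ x ∈ hull K, x ∈ hull K' → P K x = P K' x)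
    (h0 : ∀ K ∈ T.cells, ∀ x ∈ hull K, x ∉ Ω → P K x = 0) :
    ∃ v : L2 Ω, v ∈ H10 Ω ∧ ∀ K ∈ T.cells, v =ᵐ[volume.restrict (hull K)] P K := by
  classical
  let f : Plane → ℝ := fun x => if h : ∃ K ∈ T.cells, x ∈ hull K then P h.choose x else 0
  have hfK : ∀ K ∈ T.cells, ∀ x ∈ hull K, f x = P K x := fun K hK x hx => by
    have h : ∃ K ∈ T.cells, x ∈ hull K := ⟨K, hK, hx⟩
    simp only [f, dif_pos h]
    exact hcomp _ h.choose_spec.1 _ hK x h.choose_spec.2 hx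
  have hf0 : ∀ x, x ∉ Ω → f x = 0 := fun x hx => by
    by_cases h : ∃ K ∈ T.cells, x ∈ hull K
    · obtain ⟨K, hK, hxK⟩ := h
      rw [hfK K hK x hxK, h0 K hK x hxK hx]
    · simp only [f, dif_neg h]
  have hL : ∀ K ∈ T.cells, ∃ C, LipschitzOnWith C f (hull K) := fun K hK => by
    obtain ⟨C, hC⟩ := (hP K hK).contDiffOn.exists_lipschitzOnWith (by simp) (convex_hull K)
      (isCompact_hull K)
    refine ⟨C, fun x hx y hy => ?_⟩
    rw [hfK K hK x hx, hfK K hK y hy]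
    exact hC hx hy
  choose! C hC using hL
  -- The complement of `Ω`, on which `f` is zero, completes the triangles to a finite closed cover
  -- of the plane.
  let S : Option T.cells → Set Plane := fun o => o.elim Ωᶜ fun K => hull K.1
  have hLip : LipschitzWith (∑ K ∈ T.cells, C K) f := by
    refine lipschitzWith_of_finite_closed_cover (S := S) ?_ ?_ ?_
    · rintro (_ | K)
      · exact hΩ.isClosed_compl
      · exact isClosed_hull _
    · intro x
      by_cases hx : x ∈ Ω
      · obtain ⟨K, hK, hxK⟩ := exists_cell_of_mem (T := T) hx
        exact ⟨some ⟨K, hK⟩, hxK⟩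
      · exact ⟨none, hx⟩
    · rintro (_ | K)
      · intro x hx y hy
        rw [hf0 x hx, hf0 y hy, edist_self]
        exact zero_le
      · exact (hC K.1 K.2).weaken (Finset.single_le_sum (f := C) (fun _ _ => zero_le) K.2)
  have : IsFiniteMeasure ((volume : Measure Plane).restrict Ω) :=
    ⟨by simpa using T.isBounded.measure_lt_top⟩
  obtain ⟨B, hB⟩ := hLip.continuous.bounded_above_of_compact_support
    (HasCompactSupport.intro T.isBounded.isCompact_closure
      fun x hx => hf0 x fun h => hx (subset_closure h))
  have hmem : MemLp f 2 (volume.restrict Ω) :=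
    MemLp.of_bound hLip.continuous.aestronglyMeasurable B (Eventually.of_forall hB)
  refine ⟨hmem.toLp f, mem_H10_of_lipschitz hΩ T.isBounded hLip hf0 hmem.coeFn_toLp,
    fun K hK => ?_⟩
  have h1 := T.ae_restrict_hull hΩ' hK hmem.coeFn_toLp
  filter_upwards [h1, ae_restrict_mem (isClosed_hull K).measurableSet] with x hx hxK
  rw [hx, hfK K hK x hxK]

end Triangulation

/-! ### Affine functions as polynomials. -/

variable {K : Finset Plane}

/-- The polynomial given by an affine function on the plane. -/
def affinePoly (f : Plane →ᵃ[ℝ] ℝ) : MvPolynomial (Fin 2) ℝ :=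
  MvPolynomial.C (f 0) + MvPolynomial.C (f.linear (EuclideanSpace.single 0 1)) * MvPolynomial.X 0 +
    MvPolynomial.C (f.linear (EuclideanSpace.single 1 1)) * MvPolynomial.X 1

lemma totalDegree_affinePoly_le (f : Plane →ᵃ[ℝ] ℝ) : (affinePoly f).totalDegree ≤ 1 :=
  totalDegree_affine_le _ _ _

lemma ev_affinePoly (f : Plane →ᵃ[ℝ] ℝ) (x : Plane) : ev (affinePoly f) x = f x := by
  have hx : x = (0 : Plane) + (x 0 • EuclideanSpace.single (0 : Fin 2) (1 : ℝ) +
      x 1 • EuclideanSpace.single 1 1) := by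
    ext i; fin_cases i <;> simp
  conv_rhs => rw [hx, affine_add, map_add, map_smul, map_smul]
  simp [ev, affinePoly]
  ring

/-! ### The inscribed discs -/

lemma bary_le_one (hK : IsTri K) {x : Plane} (hx : x ∈ hull K) (z : Plane) : bary K z x ≤ 1 := by
  by_cases hz : z ∈ K
  · rw [← sum_bary hK x]
    exact Finset.single_le_sum (f := fun z => bary K z x)
      (fun w _ => (mem_hull_iff hK).1 hx w) hz
  · rw [bary_notMem hz]; exact zero_le_one

/-- A barycentric coordinate stays in `[0, 1]` on the triangle, so it varies by at most 1 along the
diameter of the disc in direction `v`. -/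
lemma abs_bary_linear_mul_le (hK : IsTri K) {y : Plane} {r : ℝ} (hr : 0 ≤ r)
    (h : Metric.closedBall y r ⊆ hull K) (z v : Plane) :
    |(bary K z).linear v| * (2 * r) ≤ ‖v‖ := by
  rcases eq_or_ne v 0 with rfl | hv
  · simp
  have hv' : 0 < ‖v‖ := norm_pos_iff.2 hv
  have hn : ‖(r / ‖v‖) • v‖ = r := by
    rw [norm_smul, norm_div, norm_norm, div_mul_cancel₀ _ hv'.ne', Real.norm_of_nonneg hr]
  have h1 : y + (r / ‖v‖) • v ∈ hull K := h (by simp [hn])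
  have h2 : y + -((r / ‖v‖) • v) ∈ hull K := h (by simp [hn])
  have a1 := (mem_hull_iff hK).1 h1 z
  have a2 := (mem_hull_iff hK).1 h2 z
  have b1 := bary_le_one hK h1 z
  have b2 := bary_le_one hK h2 z
  rw [affine_add, map_smul, smul_eq_mul] at a1 b1
  rw [affine_add, map_neg, map_smul, smul_eq_mul] at a2 b2
  set L := (bary K z).linear v
  have h3 : |r / ‖v‖ * L| * 2 ≤ 1 := by
    have : |r / ‖v‖ * L| ≤ 1 / 2 := abs_le.2 ⟨by linarith, by linarith⟩
    linarith
  rw [abs_mul, abs_of_nonneg (by positivity), div_mul_eq_mul_div, div_mul_eq_mul_div,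
    div_le_one hv'] at h3
  linarith

/-- The diameters of the discs contained in a triangle. -/
def discDiams (K : Finset Plane) : Set ℝ :=
  {d : ℝ | ∃ (z : Plane) (r : ℝ), 0 ≤ r ∧ d = 2 * r ∧ Metric.closedBall z r ⊆ hull K}

/-- Needed for `sSup` in `inDiam` to be a genuine supremum and not the default 0. -/
lemma bddAbove_discDiams (hK : IsTri K) : BddAbove (discDiams K) := by
  obtain ⟨z, w, u, hzw, -, -, rfl⟩ := Finset.card_eq_three.1 hK.1
  set K : Finset Plane := {z, w, u}
  have h1 : (bary K z).linear (z - w) = 1 := by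
    have := affine_add (bary K z) w (z - w)
    rw [add_sub_cancel, bary_self hK (by simp [K]), bary_of_ne hK (by simp [K]) hzw] at this
    linarith
  refine ⟨‖z - w‖, ?_⟩
  rintro d ⟨y, r, hr, rfl, h⟩
  simpa [h1] using abs_bary_linear_mul_le hK hr h z (z - w)

lemma exists_closedBall_subset_hull (hK : IsTri K) :
    ∃ y, ∃ r, 0 < r ∧ Metric.closedBall y r ⊆ hull K := by
  obtain ⟨y, hy⟩ := interior_hull_nonempty hK
  obtain ⟨r, hr, h⟩ := Metric.nhds_basis_closedBall.mem_iff.1 (mem_interior_iff_mem_nhds.1 hy)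
  exact ⟨y, r, hr, h⟩

lemma inDiam_pos (hK : IsTri K) : 0 < Triangulation.inDiam K := by
  obtain ⟨y, r, hr, h⟩ := exists_closedBall_subset_hull hK
  exact (by positivity : 0 < 2 * r).trans_le
    (le_csSup (bddAbove_discDiams hK) ⟨y, r, hr.le, rfl, h⟩)

/-- A disc with more than half the supremal diameter is enough, so attainment of the supremum is not
needed. -/
lemma exists_closedBall_inDiam_lt (hK : IsTri K) : ∃ y, ∃ r, 0 < r ∧
    Triangulation.inDiam K < 4 * r ∧ Metric.closedBall y r ⊆ hull K := by
  obtain ⟨y, r, hr, h⟩ := exists_closedBall_subset_hull hK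
  obtain ⟨d, ⟨y, r, hr, rfl, h'⟩, hd⟩ := exists_lt_of_lt_csSup (s := discDiams K)
    ⟨_, y, r, hr.le, rfl, h⟩ (half_lt_self (inDiam_pos hK))
  have := inDiam_pos hK
  change Triangulation.inDiam K / 2 < 2 * r at hd
  exact ⟨y, r, by linarith, by linarith, h'⟩

lemma abs_bary_linear_mul_inDiam_le (hK : IsTri K) (z v : Plane) :
    |(bary K z).linear v| * Triangulation.inDiam K ≤ ‖v‖ := by
  rcases (abs_nonneg ((bary K z).linear v)).eq_or_lt with h0 | h0
  · rw [← h0, zero_mul]; exact norm_nonneg v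
  rw [mul_comm, ← le_div_iff₀ h0]
  obtain ⟨y, r, hr, h⟩ := exists_closedBall_subset_hull hK
  refine csSup_le ⟨_, y, r, hr.le, rfl, h⟩ ?_
  rintro d ⟨y, r, hr, rfl, h⟩
  rw [le_div_iff₀ h0, mul_comm]
  exact abs_bary_linear_mul_le hK hr h z v

lemma isBounded_hull (K : Finset Plane) : Bornology.IsBounded (hull K) :=
  (isCompact_hull K).isBounded

lemma diam_hull_pos (hK : IsTri K) : 0 < Metric.diam (hull K) := by
  obtain ⟨z, w, u, hzw, -, -, rfl⟩ := Finset.card_eq_three.1 hK.1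
  exact (dist_pos.2 hzw).trans_le (Metric.dist_le_diam_of_mem (isBounded_hull _)
    (vertex_mem_hull (by simp)) (vertex_mem_hull (by simp)))

/-! ### Lagrange nodes and local bounds -/

/-- The Lagrange node with barycentric coordinates `α z / l`. -/
def node (l : ℕ) (K : Finset Plane) (α : Plane → ℕ) : Plane := ∑ z ∈ K, ((α z : ℝ) / l) • z

lemma sum_div_eq_one {l : ℕ} (hl : 0 < l) {α : Plane → ℕ} (hα : ∑ z ∈ K, α z = l) :
    ∑ z ∈ K, (α z : ℝ) / l = 1 := by
  have hl' : (l : ℝ) ≠ 0 := by positivity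
  rw [← Finset.sum_div, ← Nat.cast_sum, hα, div_self hl']

lemma bary_node (hK : IsTri K) {l : ℕ} (hl : 0 < l) {α : Plane → ℕ} (hα : ∑ z ∈ K, α z = l)
    {z : Plane} (hz : z ∈ K) : bary K z (node l K α) = (α z : ℝ) / l :=
  bary_sum_smul hK (sum_div_eq_one hl hα) hz

lemma node_mem_hull (hK : IsTri K) {l : ℕ} (hl : 0 < l) {α : Plane → ℕ}
    (hα : ∑ z ∈ K, α z = l) : node l K α ∈ hull K := by
  rw [mem_hull_iff hK]
  intro z
  by_cases hz : z ∈ K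
  · rw [bary_node hK hl hα hz]; positivity
  · rw [bary_notMem hz]

/-- Polynomials on a triangle are bounded by their nodal values, and their gradients scale like
the inverse of the diameter of an inscribed disc. -/
theorem exists_local_bound {l : ℕ} (hl : 0 < l) : ∃ C : ℝ, 0 ≤ C ∧
    ∀ K : Finset Plane, IsTri K → ∀ p : MvPolynomial (Fin 2) ℝ, p.totalDegree ≤ l → ∀ M : ℝ,
      (∀ α : Plane → ℕ, ∑ z ∈ K, α z = l → |ev p (node l K α)| ≤ M) →
      ∀ x ∈ hull K, |ev p x| ≤ C * M ∧
        ∀ j, |pderiv j (ev p) x| ≤ C * M / Triangulation.inDiam K := by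
  obtain ⟨C, hC0, hC⟩ := exists_reference_bound hl
  -- The factor 2 comes from the chain rule: two reference coordinates, each with gradient at most
  -- the inverse of the inscribed diameter.
  refine ⟨2 * C, by positivity, fun K hK p hp M hM x hx => ?_⟩
  classical
  have hM0 : 0 ≤ M := by
    obtain ⟨z, hz⟩ := Finset.card_pos.1 (by rw [hK.1]; norm_num : 0 < K.card)
    exact (abs_nonneg _).trans (hM (fun w => if w = z then l else 0) (by simp [hz]))
  obtain ⟨c, a, b, hca, hcb, hab, rfl⟩ := Finset.card_eq_three.1 hK.1
  set q : MvPolynomial (Fin 2) ℝ := MvPolynomial.bind₁ (fun i : Fin 2 =>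
    MvPolynomial.C (c i) + MvPolynomial.C (a i - c i) * MvPolynomial.X 0 +
      MvPolynomial.C (b i - c i) * MvPolynomial.X 1) p with hq
  have hqd : q.totalDegree ≤ l := (totalDegree_bind₁_le (fun i => totalDegree_affine_le _ _ _) p).trans hp
  have hqe : ∀ s t : ℝ, MvPolynomial.eval ![s, t] q = ev p (triMap c a b (s, t)) := fun s t => by
    rw [hq, eval_bind₁, ev]
    congr 2
    ext i
    simp [triMap]
    ring
  have hlat : ∀ i j : ℕ, i + j ≤ l → |MvPolynomial.eval ![(i : ℝ) / l, (j : ℝ) / l] q| ≤ M := by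
    intro i j hij
    rw [hqe]
    -- The reference lattice point `(i/l, j/l)` has weights `i` at `a` and `j` at `b`; the remaining
    -- weight goes to `c`.
    set α : Plane → ℕ := fun z => if z = a then i else if z = b then j else l - i - j with hα
    have h1 : ∑ z ∈ ({c, a, b} : Finset Plane), α z = l := by
      rw [Finset.sum_insert (by simp [hca, hcb]), Finset.sum_pair hab]
      simp only [hα, hca, hcb, hab.symm, if_true, if_false]
      omega
    have h2 := hM α h1
    have h3 : node l {c, a, b} α = triMap c a b ((i : ℝ) / l, (j : ℝ) / l) := by
      rw [← triMap_bary hK (node l {c, a, b} α), bary_node hK hl h1 (by simp),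
        bary_node hK hl h1 (by simp)]
      simp [hα, hab.symm]
    rwa [h3] at h2
  set g : Fin 2 → Plane → ℝ := ![bary {c, a, b} a, bary {c, a, b} b] with hg
  have hev : ev p = fun x => MvPolynomial.eval (fun i => g i x) q := by
    ext y
    have : (fun i => g i y) = ![bary {c, a, b} a y, bary {c, a, b} b y] := by
      ext i; fin_cases i <;> rfl
    rw [this, hqe, triMap_bary hK]
  have hmem : (bary {c, a, b} a x, bary {c, a, b} b x) ∈ refTri := by
    rw [← triMap_mem_hull_iff hK, triMap_bary hK]; exact hx
  obtain ⟨hv, hd⟩ := hC q hqd M hlat _ hmem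
  rw [hqe, triMap_bary hK] at hv
  refine ⟨hv.trans (by nlinarith [mul_nonneg hC0 hM0]), fun j => ?_⟩
  have hgd : ∀ i, HasFDerivAt (g i)
      (LinearMap.toContinuousLinearMap (bary {c, a, b} (![a, b] i)).linear) x := fun i => by
    have h1 : ∀ z, HasFDerivAt (bary {c, a, b} z)
        (LinearMap.toContinuousLinearMap (bary {c, a, b} z).linear) x := fun z => by
      have h2 : (bary {c, a, b} z : Plane → ℝ) = fun y => bary {c, a, b} z 0 +
          LinearMap.toContinuousLinearMap (bary {c, a, b} z).linear y := by
        ext y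
        simpa using affine_add (bary {c, a, b} z) 0 y
      rw [h2]
      exact (ContinuousLinearMap.hasFDerivAt _).const_add _
    fin_cases i <;> exact h1 _
  have hp := (hasFDerivAt_eval_comp hgd q).fderiv
  rw [← hev] at hp
  have hgx : (fun i => g i x) = ![bary {c, a, b} a x, bary {c, a, b} b x] := by
    ext i; fin_cases i <;> rfl
  have hin := inDiam_pos hK
  have hL : ∀ z, |(bary {c, a, b} z).linear (EuclideanSpace.single j 1)| ≤
      1 / Triangulation.inDiam {c, a, b} := fun z => by
    rw [le_div_iff₀ hin]
    simpa using abs_bary_linear_mul_inDiam_le hK z (EuclideanSpace.single j 1)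
  rw [pderiv, hp, hgx, Fin.sum_univ_two]
  simp only [add_apply, smul_apply, smul_eq_mul,
    LinearMap.coe_toContinuousLinearMap']
  refine (abs_add_le _ _).trans ?_
  rw [abs_mul, abs_mul]
  calc _ ≤ C * M * (1 / Triangulation.inDiam {c, a, b}) +
        C * M * (1 / Triangulation.inDiam {c, a, b}) :=
      add_le_add (mul_le_mul (hd 0) (hL _) (abs_nonneg _) (by positivity))
        (mul_le_mul (hd 1) (hL _) (abs_nonneg _) (by positivity))
    _ = _ := by ring

/-- The area of a triangle is bounded by the square of its diameter. -/
lemma volume_hull_toReal_le (hK : IsTri K) :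
    (volume (hull K)).toReal ≤ Real.pi * Metric.diam (hull K) ^ 2 := by
  obtain ⟨z, hz⟩ := Finset.card_pos.1 (by rw [hK.1]; norm_num : 0 < K.card)
  have h1 : hull K ⊆ Metric.closedBall z (Metric.diam (hull K)) := fun x hx =>
    Metric.dist_le_diam_of_mem (isBounded_hull K) hx (vertex_mem_hull hz)
  have h2 := ENNReal.toReal_mono (measure_closedBall_lt_top.ne) (measure_mono (μ := volume) h1)
  refine h2.trans (le_of_eq ?_)
  rw [EuclideanSpace.volume_closedBall_fin_two]
  simp [ENNReal.toReal_ofReal Metric.diam_nonneg, Real.pi_pos.le, mul_comm]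

namespace Triangulation

variable {Ω : Set Plane} (T : Triangulation Ω)

lemma diam_div_inDiam_le (hK : K ∈ T.cells) :
    Metric.diam (hull K) / inDiam K ≤ T.shapeParameter :=
  le_ciSup (f := fun K : T.cells => Metric.diam (hull K.1) / inDiam K.1)
    (finite_range _).bddAbove ⟨K, hK⟩

lemma shapeParameter_pos (hK : K ∈ T.cells) : 0 < T.shapeParameter :=
  (div_pos (diam_hull_pos (T.isTri hK)) (inDiam_pos (T.isTri hK))).trans_le
    (T.diam_div_inDiam_le hK)

/-- The number of triangles at a point is bounded in terms of the shape parameter. -/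
theorem card_cellsAt_le (x : Plane) : ((T.cellsAt x).card : ℝ) ≤ 16 * T.shapeParameter ^ 2 := by
  classical
  rcases (T.cellsAt x).eq_empty_or_nonempty with h0 | hne
  · rw [h0]; simp; positivity
  -- Scaling every triangle at `x` down to the smallest diameter makes the areas comparable.
  obtain ⟨K₀, hK₀, hmin⟩ := Finset.exists_min_image (T.cellsAt x)
    (fun K => Metric.diam (hull K)) hne
  set R := Metric.diam (hull K₀)
  have hK₀' := (mem_cellsAt.1 hK₀).1
  have hR : 0 < R := diam_hull_pos (T.isTri hK₀')
  set σ := T.shapeParameter with hσ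
  have hσ0 : 0 < σ := T.shapeParameter_pos hK₀'
  -- The homothety with centre `x` and ratio `R / d ≤ 1` maps `K` into itself by convexity. It sends
  -- a disc of radius at least `d / (4σ)` to one of radius at least `R / (4σ)`, all within distance
  -- `R` of `x`. These discs are disjoint, so comparing areas gives at most `(4σ)²` of them.
  have hball : ∀ K ∈ T.cellsAt x, ∃ y, Metric.ball y (R / (4 * σ)) ⊆ interior (hull K) ∧
      Metric.ball y (R / (4 * σ)) ⊆ Metric.closedBall x R := by
    intro K hK
    obtain ⟨hKc, hxK⟩ := mem_cellsAt.1 hK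
    have hKt := T.isTri hKc
    obtain ⟨y, r, hr, hlt, hsub⟩ := exists_closedBall_inDiam_lt hKt
    have hd := diam_hull_pos hKt
    set d := Metric.diam (hull K) with hdd
    have hin := inDiam_pos hKt
    have hlam : R / d ≤ 1 := (div_le_one hd).2 (hmin K hK)
    have hlam0 : 0 < R / d := div_pos hR hd
    have hrad : R / (4 * σ) ≤ R / d * r := by
      have h1 : d ≤ σ * inDiam K := (div_le_iff₀ hin).1 (T.diam_div_inDiam_le hKc)
      have h2 : d ≤ σ * (4 * r) := h1.trans (mul_le_mul_of_nonneg_left hlt.le hσ0.le)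
      rw [div_mul_eq_mul_div, div_le_div_iff₀ (by positivity) hd]
      nlinarith
    have hin2 : ∀ w ∈ Metric.ball (x + (R / d) • (y - x)) (R / (4 * σ)),
        ∃ u ∈ hull K, w = x + (R / d) • (u - x) := by
      intro w hw
      refine ⟨x + (R / d)⁻¹ • (w - x), hsub ?_, ?_⟩
      · rw [mem_closedBall_iff_norm, show x + (R / d)⁻¹ • (w - x) - y =
          (R / d)⁻¹ • (w - (x + (R / d) • (y - x))) from ?_, norm_smul, Real.norm_of_nonneg
          (inv_nonneg.2 hlam0.le), inv_mul_le_iff₀ hlam0]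
        · exact (mem_ball_iff_norm.1 hw).le.trans hrad
        · rw [← sub_sub, smul_sub _ (w - x), smul_smul, inv_mul_cancel₀ hlam0.ne', one_smul]
          abel
      · rw [add_sub_cancel_left, smul_smul, mul_inv_cancel₀ hlam0.ne', one_smul, add_sub_cancel]
    refine ⟨x + (R / d) • (y - x), ?_, ?_⟩
    · refine interior_maximal (fun w hw => ?_) Metric.isOpen_ball
      obtain ⟨u, hu, rfl⟩ := hin2 w hw
      exact (convex_hull K).add_smul_sub_mem hxK hu ⟨hlam0.le, hlam⟩
    · intro w hw
      obtain ⟨u, hu, rfl⟩ := hin2 w hw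
      rw [mem_closedBall_iff_norm, add_sub_cancel_left, norm_smul, Real.norm_of_nonneg hlam0.le,
        div_mul_eq_mul_div, div_le_iff₀ hd]
      refine mul_le_mul_of_nonneg_left ?_ hR.le
      rw [← dist_eq_norm]
      exact Metric.dist_le_diam_of_mem (isBounded_hull K) hu hxK
  choose! y hy1 hy2 using hball
  have hdisj : (T.cellsAt x : Set (Finset Plane)).PairwiseDisjoint
      fun K => Metric.ball (y K) (R / (4 * σ)) := by
    intro K hK K' hK' hne
    refine Set.disjoint_left.2 fun w hw hw' => hne ?_
    exact cell_eq_of_interior (T := T) (mem_cellsAt.1 hK).1 (mem_cellsAt.1 hK').1 (hy1 K hK hw)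
      (interior_subset (hy1 K' hK' hw'))
  have hm : ∑ K ∈ T.cellsAt x, volume (Metric.ball (y K) (R / (4 * σ))) ≤
      volume (Metric.closedBall x R) := by
    rw [← measure_biUnion_finset hdisj fun K _ => Metric.isOpen_ball.measurableSet]
    exact measure_mono (iUnion₂_subset hy2)
  simp only [EuclideanSpace.volume_ball_fin_two, EuclideanSpace.volume_closedBall_fin_two] at hm
  rw [Finset.sum_const, nsmul_eq_mul, ← mul_assoc] at hm
  have hm2 := (ENNReal.mul_le_mul_iff_left (by simp [Real.pi_pos]) (by simp)).1 hm
  have hm3 := ENNReal.toReal_mono (by simp) hm2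
  rw [ENNReal.toReal_mul, ENNReal.toReal_pow, ENNReal.toReal_pow, ENNReal.toReal_natCast,
    ENNReal.toReal_ofReal hR.le, ENNReal.toReal_ofReal (by positivity), div_pow,
    mul_div_assoc', div_le_iff₀ (by positivity), mul_comm _ (R ^ 2),
    mul_le_mul_iff_right₀ (by positivity)] at hm3
  linarith [mul_pow 4 σ 2]

end Triangulation

/-- Inverse estimate on edges. -/
theorem exists_edge_bound (l : ℕ) : ∃ C : ℝ, 0 < C ∧
    ∀ p : MvPolynomial (Fin 2) ℝ, p.totalDegree ≤ l → ∀ F : Finset Plane, F.card = 2 →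
      ∀ x ∈ hull F, ev p x ^ 2 ≤
        C * ((Metric.diam (hull F))⁻¹ * ∫ y, ev p y ^ 2 ∂edgeMeasure F) := by
  obtain ⟨C, hC0, hC⟩ := exists_inverse_bound l
  refine ⟨C, hC0, fun p hp F hF x hx => ?_⟩
  classical
  obtain ⟨a, b, hab, rfl⟩ := Finset.card_eq_two.1 hF
  obtain ⟨q, hq, hqe⟩ := exists_seg_coeffs l p hp a b
  rw [hull_pair] at hx
  obtain ⟨t, ht, rfl⟩ := hx
  rw [integral_edge_pair_of_continuous a b (g := fun y => ev p y ^ 2) ((continuous_ev p).pow 2), diam_hull_pair,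
    inv_mul_cancel_left₀ (dist_pos.2 hab).ne']
  simp only [hqe]
  exact hC q hq t ht

lemma diam_edge_pos {F : Finset Plane} (h2 : F.card = 2) : 0 < Metric.diam (hull F) := by
  classical
  obtain ⟨a, b, hab, rfl⟩ := Finset.card_eq_two.1 h2
  rw [diam_hull_pair]; exact dist_pos.2 hab

lemma abs_integral_edge_le {F : Finset Plane} (h2 : F.card = 2) {g : Plane → ℝ}
    (hg : Continuous g) {M : ℝ} (hM : ∀ x ∈ hull F, |g x| ≤ M) :
    |∫ x, g x ∂edgeMeasure F| ≤ Metric.diam (hull F) * M := by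
  classical
  obtain ⟨a, b, hab, rfl⟩ := Finset.card_eq_two.1 h2
  rw [integral_edge_pair_of_continuous a b hg, diam_hull_pair, abs_mul, abs_of_nonneg dist_nonneg]
  refine mul_le_mul_of_nonneg_left ?_ dist_nonneg
  have := intervalIntegral.norm_integral_le_of_norm_le_const (a := (0 : ℝ)) (b := 1) (C := M)
    (f := fun t => g (seg a b t)) fun t ht => by
      rw [uIoc_of_le zero_le_one] at ht
      exact hM _ (seg_mem_hull a b ⟨ht.1.le, ht.2⟩)
  simpa using this

/-! ### Element-wise polynomials and their jumps. -/

namespace Triangulation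

variable {Ω : Set Plane} {T : Triangulation Ω} {F : Finset Plane} {l : ℕ}

variable (T) in
/-- The function `v` coincides on each triangle `K` with the polynomial `p K` of degree at most
`l`. -/
def Represents (l : ℕ) (v : Plane → ℝ) (p : Finset Plane → MvPolynomial (Fin 2) ℝ) : Prop :=
  ∀ K ∈ T.cells, (p K).totalDegree ≤ l ∧ v =ᵐ[volume.restrict (hull K)] ev (p K)

variable (T) in
/-- The polynomial that describes the jump on `F`. -/
def jumpPoly (p : Finset Plane → MvPolynomial (Fin 2) ℝ) (F : Finset Plane) :
    MvPolynomial (Fin 2) ℝ := p (T.plus F) - ∑ K ∈ T.others F, p K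

lemma ev_jumpPoly (p : Finset Plane → MvPolynomial (Fin 2) ℝ) (F : Finset Plane) (x : Plane) :
    ev (T.jumpPoly p F) x = ev (p (T.plus F)) x - ∑ K ∈ T.others F, ev (p K) x := by
  rw [jumpPoly, ev_sub, Pi.sub_apply, ev_sum]

variable (T) in
/-- The contribution of the edge `F` to the squared jump seminorm. -/
def edgeEnergy (F : Finset Plane) (v : Plane → ℝ) : ℝ :=
  (Metric.diam (hull F))⁻¹ * ∫ x, T.jump F v x ^ 2 ∂edgeMeasure F

lemma edgeEnergy_nonneg (F : Finset Plane) (v : Plane → ℝ) : 0 ≤ T.edgeEnergy F v :=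
  mul_nonneg (inv_nonneg.2 Metric.diam_nonneg) (integral_nonneg fun _ => sq_nonneg _)

variable {v : Plane → ℝ} {p : Finset Plane → MvPolynomial (Fin 2) ℝ}

lemma Represents.memLp (h : T.Represents l v p) {K : Finset Plane} (hK : K ∈ T.cells) :
    MemLp v 2 (volume.restrict (hull K)) :=
  (memLp_congr_ae (h K hK).2).2 (memLp_hull_of_continuous K (continuous_ev _))

lemma Represents.isTrace (h : T.Represents l v p) {K : Finset Plane} (hK : K ∈ T.cells)
    (h2 : F.card = 2) : IsTrace K F v (ev (p K)) :=
  (isTrace_of_contDiff h2 (contDiff_ev _)).congr (h K hK).2.symm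

lemma Represents.trace_ae_eq (h : T.Represents l v p) {K : Finset Plane} (hK : K ∈ T.cells)
    (hFK : F ⊆ K) (h2 : F.card = 2) : trace K F v =ᵐ[edgeMeasure F] ev (p K) :=
  (h.isTrace hK h2).trace_ae_eq (T.isTri hK) hFK h2 (h.memLp hK)

lemma Represents.jump_ae_eq (h : T.Represents l v p) (hF : F ∈ T.edges) :
    T.jump F v =ᵐ[edgeMeasure F] ev (T.jumpPoly p F) := by
  have h2 := card_of_mem_edges hF
  refine (Triangulation.jump_ae_eq hF (fun K hK => h.memLp hK)
    fun K hK _ => h.isTrace hK h2).trans (Eventually.of_forall fun x => ?_)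
  rw [ev_jumpPoly]

lemma Represents.totalDegree_jumpPoly_le (h : T.Represents l v p) (hF : F ∈ T.edges) :
    (T.jumpPoly p F).totalDegree ≤ l :=
  (MvPolynomial.totalDegree_sub _ _).trans (max_le (h _ (plus_mem hF).1).1
    (MvPolynomial.totalDegree_finsetSum_le fun K hK => (h K (mem_others.1 hK).1).1))

lemma Represents.edgeEnergy_eq (h : T.Represents l v p) (hF : F ∈ T.edges) :
    T.edgeEnergy F v =
      (Metric.diam (hull F))⁻¹ * ∫ x, ev (T.jumpPoly p F) x ^ 2 ∂edgeMeasure F := by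
  rw [edgeEnergy]
  congr 1
  refine integral_congr_ae ?_
  filter_upwards [h.jump_ae_eq hF] with x hx
  rw [hx]

/-- Subtracting an element-wise polynomial from an `H¹₀` function, the jumps are those of the
element-wise polynomial. -/
lemma Represents.edgeEnergy_H10_sub (h : T.Represents l v p) (hΩ : IsOpen Ω)
    (hΩ' : interior (closure Ω) = Ω) {u : L2 Ω} (hu : u ∈ H10 Ω) {w : Plane → ℝ}
    (hw : ∀ K ∈ T.cells, w =ᵐ[volume.restrict (hull K)] u - v) (hF : F ∈ T.edges) :
    T.edgeEnergy F w = T.edgeEnergy F v := by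
  rw [h.edgeEnergy_eq hF, edgeEnergy]
  congr 1
  refine integral_congr_ae ?_
  filter_upwards [jump_H10_sub hΩ hΩ' hu hF (w := w) (p := fun K => ev (p K))
    (fun K _ => contDiff_ev _) fun K hK => (hw K hK).trans
      (EventuallyEq.rfl.sub (h K hK).2)] with x hx
  rw [hx, ev_jumpPoly, neg_sq]

lemma edgeEnergy_H10 (hΩ : IsOpen Ω) (hΩ' : interior (closure Ω) = Ω) {v : L2 Ω}
    (hv : v ∈ H10 Ω) (hF : F ∈ T.edges) : T.edgeEnergy F v = 0 := by
  have h0 : T.Represents 0 (0 : Plane → ℝ) fun _ => 0 := fun K _ =>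
    ⟨by simp, by rw [ev_zero]⟩
  rw [h0.edgeEnergy_H10_sub hΩ hΩ' hv (fun K _ => by rw [sub_zero]) hF, h0.edgeEnergy_eq hF]
  simp [jumpPoly, ev_zero]

lemma abs_ev_jumpPoly_of_ne {K K' : Finset Plane} (hK : K ∈ T.cells) (hK' : K' ∈ T.cells)
    (hFK : F ⊆ K) (hFK' : F ⊆ K') (hne : K ≠ K') (h2 : F.card = 2) (x : Plane) :
    |ev (p K) x - ev (p K') x| = |ev (T.jumpPoly p F) x| := by
  have hF : F ∈ T.edges := mem_edges.2 ⟨K, hK, hFK, h2⟩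
  rw [ev_jumpPoly]
  by_cases h : K = T.plus F
  · rw [others_eq_singleton hF hK' hFK' (fun e => hne (h.trans e.symm)), Finset.sum_singleton, ← h]
  · have h1 := others_eq_singleton hF hK hFK h
    have h2 : K' = T.plus F := by
      by_contra h'
      have h3 := others_eq_singleton hF hK' hFK' h'
      rw [h1] at h3
      exact hne (Finset.singleton_injective h3)
    rw [h1, Finset.sum_singleton, ← h2, abs_sub_comm]

/-- Differences of element-wise polynomials are controlled by the jumps. -/
theorem exists_value_bound (l : ℕ) : ∃ C : ℝ, 0 < C ∧ ∀ {Ω : Set Plane} {T : Triangulation Ω},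
    IsOpen Ω → interior (closure Ω) = Ω → ∀ {v : Plane → ℝ}
    {p : Finset Plane → MvPolynomial (Fin 2) ℝ}, T.Represents l v p →
    ∀ {K : Finset Plane}, K ∈ T.cells → ∀ {x : Plane}, x ∈ hull K → ∀ {E : ℝ},
    (∀ F ∈ T.edges, x ∈ hull F → T.edgeEnergy F v ≤ E) →
    (x ∈ Ω → ∀ K' ∈ T.cells, x ∈ hull K' →
      |ev (p K) x - ev (p K') x| ≤ (T.cellsAt x).card * √(C * E)) ∧
    (x ∉ Ω → |ev (p K) x| ≤ (T.cellsAt x).card * √(C * E)) := by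
  obtain ⟨C, hC0, hC⟩ := exists_edge_bound l
  refine ⟨C, hC0, fun {Ω T} hΩ hΩ' {v p} h {K} hK {x} hx {E} hE => ?_⟩
  have hj : ∀ F ∈ T.edges, x ∈ hull F → |ev (T.jumpPoly p F) x| ≤ √(C * E) := fun F hF hxF => by
    refine Real.abs_le_sqrt ((hC _ (h.totalDegree_jumpPoly_le hF) F (card_of_mem_edges hF) x
      hxF).trans (mul_le_mul_of_nonneg_left ?_ hC0.le))
    rw [← h.edgeEnergy_eq hF]
    exact hE F hF hxF
  refine value_bound hΩ hΩ' hK hx (fun K => ev (p K) x) (Real.sqrt_nonneg _) ?_ ?_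
  · intro K hK K' hK' F hF hF' hne h2 hxF
    rw [abs_ev_jumpPoly_of_ne hK hK' hF hF' hne h2]
    exact hj F (mem_edges.2 ⟨K, hK, hF, h2⟩) hxF
  · intro K hK F hFK h2 hxF huniq
    have hF : F ∈ T.edges := mem_edges.2 ⟨K, hK, hFK, h2⟩
    have hp := huniq _ (plus_mem hF).1 (plus_mem hF).2
    have ho : T.others F = ∅ := Finset.eq_empty_of_forall_notMem fun L hL => by
      obtain ⟨a, b, c⟩ := mem_others.1 hL
      exact c ((huniq L a b).trans hp.symm)
    have := hj F hF hxF
    rwa [ev_jumpPoly, ho, Finset.sum_empty, sub_zero, hp] at this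

/-- The case of zero jumps in `exists_value_bound`: element-wise polynomials in H¹₀ are continuous.
The next lemma gives their boundary values in the same way. -/
lemma Represents.eq_of_H10 {v : L2 Ω} (h : T.Represents l v p) (hΩ : IsOpen Ω)
    (hΩ' : interior (closure Ω) = Ω) (hv : v ∈ H10 Ω) {K K' : Finset Plane} (hK : K ∈ T.cells)
    (hK' : K' ∈ T.cells) {x : Plane} (hx : x ∈ hull K) (hx' : x ∈ hull K') (hxΩ : x ∈ Ω) :
    ev (p K) x = ev (p K') x := by
  obtain ⟨C, -, hC⟩ := exists_value_bound l
  have := (hC hΩ hΩ' h hK hx (E := 0) fun F hF _ => (edgeEnergy_H10 hΩ hΩ' hv hF).le).1 hxΩ K' hK' hx'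
  rw [mul_zero, Real.sqrt_zero, mul_zero] at this
  exact sub_eq_zero.1 (abs_nonpos_iff.1 this)

lemma Represents.eq_zero_of_H10 {v : L2 Ω} (h : T.Represents l v p) (hΩ : IsOpen Ω)
    (hΩ' : interior (closure Ω) = Ω) (hv : v ∈ H10 Ω) {K : Finset Plane} (hK : K ∈ T.cells)
    {x : Plane} (hx : x ∈ hull K) (hxΩ : x ∉ Ω) : ev (p K) x = 0 := by
  obtain ⟨C, -, hC⟩ := exists_value_bound l
  have := (hC hΩ hΩ' h hK hx (E := 0) fun F hF _ => (edgeEnergy_H10 hΩ hΩ' hv hF).le).2 hxΩ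
  rw [mul_zero, Real.sqrt_zero, mul_zero] at this
  exact abs_nonpos_iff.1 this

/-! ### Values on triangles -/

lemma eqOn_hull_of_ae_eq {K : Finset Plane} (hK : IsTri K) {p q : MvPolynomial (Fin 2) ℝ}
    (h : ev p =ᵐ[volume.restrict (hull K)] ev q) : EqOn (ev p) (ev q) (hull K) :=
  Measure.eqOn_of_ae_eq h (continuous_ev p).continuousOn (continuous_ev q).continuousOn
    (closure_interior_hull hK).ge

/-- The choice in `cellValue` is harmless: polynomials that agree a.e. on a triangle agree
everywhere on it. -/
lemma cellValue_eq {K : Finset Plane} (hK : IsTri K) {v : Plane → ℝ} {p : MvPolynomial (Fin 2) ℝ}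
    (h : v =ᵐ[volume.restrict (hull K)] ev p) {x : Plane} (hx : x ∈ hull K) :
    cellValue K v x = ev p x := by
  have he : ∃ p : MvPolynomial (Fin 2) ℝ,
      ∀ᵐ y ∂(volume.restrict (hull K)), v y = MvPolynomial.eval (fun i => y i) p := ⟨p, h⟩
  rw [cellValue, dif_pos he]
  exact eqOn_hull_of_ae_eq hK (EventuallyEq.trans (EventuallyEq.symm he.choose_spec) h) hx

end Triangulation

/-! ### Lagrange basis functions. -/

/-- The Lagrange basis polynomial on `K` associated with the node of `K₀` with coordinates
`α z / l`. -/
def lagPoly (l : ℕ) (K₀ : Finset Plane) (α : Plane → ℕ) (K : Finset Plane) :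
    MvPolynomial (Fin 2) ℝ :=
  ∏ z ∈ K₀, ∏ j ∈ Finset.range (α z), MvPolynomial.C ((α z : ℝ) - j)⁻¹ *
    affinePoly ((l : ℝ) • bary K z - AffineMap.const ℝ Plane (j : ℝ))

lemma totalDegree_lagPoly_le (l : ℕ) (K₀ : Finset Plane) (α : Plane → ℕ) (K : Finset Plane) :
    (lagPoly l K₀ α K).totalDegree ≤ ∑ z ∈ K₀, α z := by
  refine (MvPolynomial.totalDegree_finsetProd _ _).trans (Finset.sum_le_sum fun z _ => ?_)
  refine (MvPolynomial.totalDegree_finsetProd _ _).trans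
    ((Finset.sum_le_sum (g := fun _ => 1) fun j _ => ?_).trans (by simp))
  refine (MvPolynomial.totalDegree_mul _ _).trans ?_
  rw [MvPolynomial.totalDegree_C, zero_add]
  exact totalDegree_affinePoly_le _

/-- For a vertex `z` outside `K` the coordinate is zero, so the factor `j = 0` kills the product as
soon as `α z > 0`. One formula thus serves all triangles, including those that do not contain the
node. -/
lemma ev_lagPoly (l : ℕ) (K₀ : Finset Plane) (α : Plane → ℕ) (K : Finset Plane) (x : Plane) :
    ev (lagPoly l K₀ α K) x = ∏ z ∈ K₀, ∏ j ∈ Finset.range (α z),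
      ((α z : ℝ) - j)⁻¹ * (l * bary K z x - j) := by
  simp only [lagPoly, ev_prod, ev_C_mul, Pi.smul_apply, smul_eq_mul, ev_affinePoly]
  simp

namespace Triangulation

variable {Ω : Set Plane} {T : Triangulation Ω} {K K' F : Finset Plane} {l : ℕ} {x ν : Plane}

lemma bary_node_of_mem (hl : 0 < l) (hK : K ∈ T.cells) (hK' : K' ∈ T.cells) {α : Plane → ℕ}
    (hα : ∑ z ∈ K, α z = l) (h0 : ∀ z, α z ≠ 0 → z ∈ K) (hx : node l K α ∈ hull K') (z : Plane) :
    bary K' z (node l K α) = (α z : ℝ) / l := by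
  rw [← bary_eq hK hK' (node_mem_hull (T.isTri hK) hl hα) hx]
  by_cases hz : z ∈ K
  · exact bary_node (T.isTri hK) hl hα hz
  · rw [bary_notMem hz, show α z = 0 by by_contra h; exact hz (h0 z h)]
    simp

lemma mem_interiorNodes : ν ∈ T.interiorNodes l ↔ ν ∈ Ω ∧ ∃ K ∈ T.cells, ∃ α : Plane → ℕ,
    ∑ z ∈ K, α z = l ∧ (∀ z, α z ≠ 0 → z ∈ K) ∧ node l K α = ν := by
  simp only [interiorNodes, Finset.mem_filter, Finset.mem_biUnion, Finset.mem_image,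
    Finset.mem_piAntidiag, node]
  constructor
  · rintro ⟨⟨K, hK, α, ⟨h1, h2⟩, h3⟩, h4⟩
    exact ⟨h4, K, hK, α, h1, h2, h3⟩
  · rintro ⟨h4, K, hK, α, h1, h2, h3⟩
    exact ⟨⟨K, hK, α, ⟨h1, h2⟩, h3⟩, h4⟩

lemma node_mem_interiorNodes (hK : K ∈ T.cells) {α : Plane → ℕ} (hα : ∑ z ∈ K, α z = l)
    (hΩ : node l K α ∈ Ω) : node l K α ∈ T.interiorNodes l := by
  classical
  have h : ∀ z ∈ K, (if z ∈ K then α z else 0) = α z := fun z hz => if_pos hz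
  refine mem_interiorNodes.2 ⟨hΩ, K, hK, fun z => if z ∈ K then α z else 0, ?_, ?_, ?_⟩
  · rw [← hα]; exact Finset.sum_congr rfl h
  · intro z hz
    by_contra h'
    simp [h'] at hz
  · exact Finset.sum_congr rfl fun z hz => by simp only [h z hz]

/-- The explicit Lagrange basis polynomials vanish on the boundary. -/
lemma ev_lagPoly_eq_zero (hl : 0 < l) (hΩ : IsOpen Ω) (hΩ' : interior (closure Ω) = Ω)
    {K₀ : Finset Plane} (hK₀ : K₀ ∈ T.cells) {α : Plane → ℕ} (hα : ∑ z ∈ K₀, α z = l)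
    (h0 : ∀ z, α z ≠ 0 → z ∈ K₀) (hν : node l K₀ α ∈ Ω) (hK : K ∈ T.cells) (hx : x ∈ hull K)
    (hxΩ : x ∉ Ω) : ev (lagPoly l K₀ α K) x = 0 := by
  classical
  by_contra hne
  rw [ev_lagPoly] at hne
  -- A nonzero value forces the smallest face containing `x` to contain the node as well; since the
  -- node lies in `Ω`, so does `x`.
  have hpos : ∀ z, α z ≠ 0 → bary K z x ≠ 0 := fun z hz hb => by
    refine hne (Finset.prod_eq_zero (h0 z hz)
      (Finset.prod_eq_zero (Finset.mem_range.2 (Nat.pos_of_ne_zero hz)) ?_))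
    simp [hb]
  have hK₀t := T.isTri hK₀
  have hmem : node l K₀ α ∈ hull K := by
    have h1 : K₀.filter (fun z => α z ≠ 0) ⊆ K := fun z hz => by
      by_contra h
      exact hpos z (Finset.mem_filter.1 hz).2 (bary_notMem h x)
    refine hull_mono h1 ((mem_hull_face_iff hK₀t (Finset.filter_subset _ _)).2
      ⟨node_mem_hull hK₀t hl hα, fun z hz => ?_⟩)
    by_cases hzK : z ∈ K₀
    · rw [bary_node hK₀t hl hα hzK]
      have : α z = 0 := by
        by_contra h
        exact hz (Finset.mem_filter.2 ⟨hzK, h⟩)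
      simp [this]
    · exact bary_notMem hzK _
  refine hxΩ (mem_of_support_subset hΩ hΩ' hK hx hmem hν fun z hz => ?_)
  rw [bary_node_of_mem hl hK₀ hK hα h0 hmem]
  have : α z = 0 := by
    by_contra h
    exact hpos z h hz
  simp [this]

/-- The values of the explicit Lagrange basis polynomials at the Lagrange nodes. -/
lemma ev_lagPoly_node (hl : 0 < l) {K₀ : Finset Plane} (hK₀ : K₀ ∈ T.cells) {α : Plane → ℕ}
    (hα : ∑ z ∈ K₀, α z = l) (h0 : ∀ z, α z ≠ 0 → z ∈ K₀) (hK' : K' ∈ T.cells) {β : Plane → ℕ}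
    (hβ : ∑ z ∈ K', β z = l) (hβ0 : ∀ z, β z ≠ 0 → z ∈ K') (hK : K ∈ T.cells)
    (hx : node l K' β ∈ hull K) : (node l K' β = node l K₀ α → ev (lagPoly l K₀ α K) (node l K' β) = 1) ∧
      (node l K' β ≠ node l K₀ α → ev (lagPoly l K₀ α K) (node l K' β) = 0) := by
  classical
  have hl' : (l : ℝ) ≠ 0 := by positivity
  have hev : ev (lagPoly l K₀ α K) (node l K' β) = ∏ z ∈ K₀, ∏ j ∈ Finset.range (α z),
      ((α z : ℝ) - j)⁻¹ * ((β z : ℝ) - j) := by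
    rw [ev_lagPoly]
    refine Finset.prod_congr rfl fun z _ => Finset.prod_congr rfl fun j _ => ?_
    rw [bary_node_of_mem hl hK' hK hβ hβ0 hx, mul_div_cancel₀ _ hl']
  have heq : (∀ z ∈ K₀, β z = α z) → ev (lagPoly l K₀ α K) (node l K' β) = 1 := fun h => by
    rw [hev]
    refine Finset.prod_eq_one fun z hz => Finset.prod_eq_one fun j hj => ?_
    rw [h z hz]
    refine inv_mul_cancel₀ (sub_ne_zero.2 ?_)
    exact_mod_cast (Finset.mem_range.1 hj).ne'
  constructor
  · intro he
    refine heq fun z _ => ?_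
    have h1 := bary_node_of_mem hl hK' hK hβ hβ0 hx z
    rw [he] at h1 hx
    rw [bary_node_of_mem hl hK₀ hK hα h0 hx, div_left_inj' hl'] at h1
    exact_mod_cast h1.symm
  · intro hne
    by_contra h
    -- If `β z < α z`, the factor with `j = β z` vanishes. Since both families of weights add up to
    -- `l`, domination implies equality.
    have hle : ∀ z ∈ K₀, α z ≤ β z := fun z hz => by
      by_contra hlt
      refine h ?_
      rw [hev]
      refine Finset.prod_eq_zero hz (Finset.prod_eq_zero (i := β z)
        (Finset.mem_range.2 (not_le.1 hlt)) ?_)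
      simp
    have hu : ∀ (S : Finset Plane) (γ : Plane → ℕ), S ⊆ K₀ ∪ K' → (∀ z, γ z ≠ 0 → z ∈ S) →
        ∑ z ∈ K₀ ∪ K', γ z = ∑ z ∈ S, γ z := fun S γ hS hγ =>
      (Finset.sum_subset hS fun z _ hz => by by_contra h'; exact hz (hγ z h')).symm
    have e1 := (hu K₀ α Finset.subset_union_left h0).trans hα
    have e2 := (hu K' β Finset.subset_union_right hβ0).trans hβ
    have hle' : ∀ z ∈ K₀ ∪ K', α z ≤ β z := fun z _ => by
      by_cases hz : z ∈ K₀
      · exact hle z hz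
      · rw [show α z = 0 by by_contra h'; exact hz (h0 z h')]; exact Nat.zero_le _
    have e3 := (Finset.sum_eq_sum_iff_of_le hle').1 (e1.trans e2.symm)
    refine hne ?_
    have n1 : ∀ (S : Finset Plane) (γ : Plane → ℕ), S ⊆ K₀ ∪ K' → (∀ z, γ z ≠ 0 → z ∈ S) →
        node l S γ = node l (K₀ ∪ K') γ := fun S γ hS hγ =>
      Finset.sum_subset hS fun z _ hz => by
        rw [show γ z = 0 by by_contra h'; exact hz (hγ z h')]; simp
    rw [n1 K₀ α Finset.subset_union_left h0, n1 K' β Finset.subset_union_right hβ0]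
    exact Finset.sum_congr rfl fun z hz => by rw [e3 z hz]

theorem isPolyOn_of_represents {v : L2 Ω} {p : Finset Plane → MvPolynomial (Fin 2) ℝ}
    (h : T.Represents l v p) : ∀ K ∈ T.cells, IsPolyOn l K v := fun K hK =>
  ⟨p K, (h K hK).1, (h K hK).2⟩

theorem exists_represents {v : Plane → ℝ} (h : ∀ K ∈ T.cells, IsPolyOn l K v) :
    ∃ p, T.Represents l v p := by
  choose! p h1 h2 using h
  exact ⟨p, fun K hK => ⟨h1 K hK, h2 K hK⟩⟩

/-- The explicit polynomials depend on barycentric coordinates only, so they agree on common points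
of triangles and can be glued. -/
theorem exists_isLagrangeBasis (hl : 0 < l) (hΩ : IsOpen Ω) (hΩ' : interior (closure Ω) = Ω)
    (hν : ν ∈ T.interiorNodes l) : ∃ φ : L2 Ω, T.IsLagrangeBasis l ν φ := by
  obtain ⟨hνΩ, K₀, hK₀, α, hα, h0, rfl⟩ := mem_interiorNodes.1 hν
  obtain ⟨φ, hφ, hφK⟩ := T.exists_H10_of_compatible hΩ hΩ'
    (P := fun K => ev (lagPoly l K₀ α K)) (fun K _ => contDiff_ev _)
    (fun K hK K' hK' x hx hx' => by
      rw [ev_lagPoly, ev_lagPoly]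
      simp only [bary_eq hK hK' hx hx'])
    fun K hK x hx hxΩ => ev_lagPoly_eq_zero hl hΩ hΩ' hK₀ hα h0 hνΩ hK hx hxΩ
  refine ⟨φ, ⟨hφ, fun K hK => ⟨lagPoly l K₀ α K, (totalDegree_lagPoly_le _ _ _ _).trans hα.le,
    hφK K hK⟩⟩, fun ν' hν' K hK hx => ?_⟩
  obtain ⟨-, K', hK', β, hβ, hβ0, rfl⟩ := mem_interiorNodes.1 hν'
  rw [cellValue_eq (T.isTri hK) (hφK K hK) hx]
  exact ev_lagPoly_node hl hK₀ hα h0 hK' hβ hβ0 hK hx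

open Classical in
/-- The Lagrange basis functions are element-wise polynomials with the expected nodal values. -/
theorem exists_lagrangeBasis_represents (hl : 0 < l) (hΩ : IsOpen Ω)
    (hΩ' : interior (closure Ω) = Ω) (hν : ν ∈ T.interiorNodes l) :
    T.lagrangeBasis l ν ∈ H10 Ω ∧ ∃ p, T.Represents l (T.lagrangeBasis l ν) p ∧
      ∀ K ∈ T.cells, ∀ α : Plane → ℕ, ∑ z ∈ K, α z = l →
        ev (p K) (node l K α) = if node l K α = ν then 1 else 0 := by
  have hex := exists_isLagrangeBasis hl hΩ hΩ' hν
  have hφ : T.IsLagrangeBasis l ν (T.lagrangeBasis l ν) := by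
    rw [lagrangeBasis, dif_pos hex]; exact hex.choose_spec
  obtain ⟨⟨h1, h2⟩, h3⟩ := hφ
  obtain ⟨p, hp⟩ := exists_represents h2
  refine ⟨h1, p, hp, fun K hK α hα => ?_⟩
  have hx := node_mem_hull (T.isTri hK) hl hα
  by_cases hΩx : node l K α ∈ Ω
  · have h4 := h3 _ (node_mem_interiorNodes hK hα hΩx) K hK hx
    rw [cellValue_eq (T.isTri hK) (hp K hK).2 hx] at h4
    split_ifs with h
    exacts [h4.1 h, h4.2 h]
  -- The defining conditions say nothing about boundary nodes; there the value vanishes because the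
  -- function lies in H¹₀.
  · rw [if_neg fun h : node l K α = ν => hΩx (by rw [h]; exact (mem_interiorNodes.1 hν).1)]
    exact hp.eq_zero_of_H10 hΩ hΩ' h1 hK hx hΩx

/-! ### Midpoints of edges -/

open Classical in
lemma midpt_eq_node (hFK : F ⊆ K) : midpt F = node 2 K fun z => if z ∈ F then 1 else 0 := by
  rw [midpt, node, Finset.smul_sum, ← Finset.sum_subset hFK fun z _ hz => by simp [hz]]
  exact Finset.sum_congr rfl fun z hz => by simp [hz]

open Classical in
lemma sum_indicator_edge (hFK : F ⊆ K) (h2 : F.card = 2) :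
    ∑ z ∈ K, (if z ∈ F then 1 else 0) = 2 := by
  rw [Finset.sum_ite_mem, Finset.inter_eq_right.2 hFK]; simp [h2]

lemma midpt_mem_interiorNodes (hΩ' : interior (closure Ω) = Ω) (hF : F ∈ T.interiorEdges) :
    midpt F ∈ T.interiorNodes 2 := by
  classical
  obtain ⟨h2, K, hK, K', hK', hne, hFK, hFK'⟩ := mem_interiorEdges.1 hF
  have hm : midpt F ∈ Ω := mem_of_shared hΩ' hK hK' hne hFK hFK' h2 (midpt_mem_hull h2)
    fun z hz => by rw [bary_midpt (T.isTri hK) hFK h2 z (hFK hz), if_pos hz]; norm_num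
  rw [midpt_eq_node hFK] at hm ⊢
  exact node_mem_interiorNodes hK (sum_indicator_edge hFK h2) hm

/-- The endpoints are recovered from the midpoint as the vertices whose barycentric coordinates
there are nonzero. -/
lemma midpt_injective (hK : K ∈ T.cells) (hK' : K' ∈ T.cells) {F' : Finset Plane} (hF : F ⊆ K)
    (hF' : F' ⊆ K') (h2 : F.card = 2) (h2' : F'.card = 2) (h : midpt F = midpt F') : F = F' := by
  have key : ∀ {K K' F F' : Finset Plane}, K ∈ T.cells → K' ∈ T.cells → F ⊆ K → F' ⊆ K' →
      F.card = 2 → F'.card = 2 → midpt F = midpt F' → F ⊆ F' := by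
    intro K K' F F' hK hK' hF hF' h2 h2' h z hz
    have hm := hull_mono hF (midpt_mem_hull h2)
    have hm' := hull_mono hF' (midpt_mem_hull h2')
    have h1 := bary_midpt (T.isTri hK) hF h2 z (hF hz)
    rw [if_pos hz] at h1
    have h1' : bary K z (midpt F) ≠ 0 := by rw [h1]; norm_num
    rw [← h] at hm'
    have hz' := mem_of_bary_ne_zero hK hK' hm hm' h1'
    have h3 := bary_midpt (T.isTri hK') hF' h2' z hz'
    rw [← h, ← bary_eq hK hK' hm hm'] at h3
    by_contra hcon
    rw [if_neg hcon] at h3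
    exact h1' h3
  exact (key hK hK' hF hF' h2 h2' h).antisymm (key hK' hK hF' hF h2' h2 h.symm)

lemma vertex_eq_node [DecidableEq Plane] {z : Plane} (hz : z ∈ K) :
    z = node 2 K fun w => if w = z then 2 else 0 := by
  rw [node, Finset.sum_eq_single_of_mem z hz fun w _ hw => by simp [hw]]
  simp

open Classical in
/-- The quadratic Lagrange function of an edge midpoint has mean `2 / 3` on this edge and `0` on
the other edges. -/
lemma integral_quadratic_edge {p : MvPolynomial (Fin 2) ℝ} (hp : p.totalDegree ≤ 2)
    {E : Finset Plane} (hFK : F ⊆ K) (h2 : F.card = 2)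
    (hE : ∀ z ∈ F, z ≠ midpt E) (hpn : ∀ α : Plane → ℕ, ∑ z ∈ K, α z = 2 →
      ev p (node 2 K α) = if node 2 K α = midpt E then 1 else 0) :
    ∫ x, ev p x ∂edgeMeasure F =
      Metric.diam (hull F) * if midpt F = midpt E then 2 / 3 else 0 := by
  have hm := hpn _ (sum_indicator_edge hFK h2)
  rw [← midpt_eq_node hFK] at hm
  have hv : ∀ z ∈ F, ev p z = 0 := fun z hz => by
    have h1 := hpn (fun w => if w = z then 2 else 0) (by simp [hFK hz])
    rwa [← vertex_eq_node (hFK hz), if_neg (hE z hz)] at h1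
  obtain ⟨a, b, hab, rfl⟩ := Finset.card_eq_two.1 h2
  obtain ⟨q, hq, hqe⟩ := exists_seg_coeffs 2 p hp a b
  rw [integral_edge_pair_of_continuous a b (continuous_ev p), diam_hull_pair]
  simp only [hqe]
  have hmid : midpt {a, b} = seg a b (1 / 2) := by
    rw [midpt, Finset.sum_pair hab, seg, smul_add]
    norm_num
  -- The endpoint values vanish, so the mean is `4/6` times the midpoint value.
  rw [simpson hq, ← hqe, ← hqe, ← hqe, seg_zero, seg_one, hv a (by simp), hv b (by simp), ← hmid,
    hm]
  congr 1
  split_ifs <;> norm_num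

/-- Both endpoints have coordinate 1/2 at the midpoint, but a vertex only has coordinates 0 and 1.
-/
lemma vertex_ne_midpt (hK : K ∈ T.cells) (hK' : K' ∈ T.cells) {E : Finset Plane} (hE : E ⊆ K')
    (h2 : E.card = 2) {z : Plane} (hz : z ∈ K) : z ≠ midpt E := by
  rintro rfl
  have hm' := hull_mono hE (midpt_mem_hull h2)
  have hm := vertex_mem_hull hz
  obtain ⟨a, b, hab, rfl⟩ := Finset.card_eq_two.1 h2
  have h1 : ∀ w ∈ ({a, b} : Finset Plane), w = midpt {a, b} := fun w hw => by
    by_contra hne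
    have h3 := bary_midpt (T.isTri hK') hE h2 w (hE hw)
    rw [if_pos hw, ← bary_eq hK hK' hm hm', bary_of_ne (T.isTri hK) hz hne] at h3
    norm_num at h3
  exact hab ((h1 a (by simp)).trans (h1 b (by simp)).symm)

end Triangulation

/-! ### The linear structure of H¹₀. -/

lemma IsTestFunction.add {U : Set Plane} {φ ψ : Plane → ℝ} (hφ : IsTestFunction U φ)
    (hψ : IsTestFunction U ψ) : IsTestFunction U (φ + ψ) :=
  ⟨hφ.1.add hψ.1, hφ.2.1.add hψ.2.1, (tsupport_add φ ψ).trans (union_subset hφ.2.2 hψ.2.2)⟩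

lemma IsTestFunction.const_smul {U : Set Plane} {φ : Plane → ℝ} (hφ : IsTestFunction U φ) (a : ℝ) :
    IsTestFunction U (a • φ) :=
  ⟨hφ.1.const_smul a, hφ.2.1.smul_left (f := fun _ => a),
    (tsupport_smul_subset_right (fun _ => a) φ).trans hφ.2.2⟩

lemma pderiv_add {f g : Plane → ℝ} (hf : Differentiable ℝ f) (hg : Differentiable ℝ g)
    (i : Fin 2) : pderiv i (f + g) = pderiv i f + pderiv i g := by
  ext x
  simp [pderiv, fderiv_add (hf x) (hg x)]

lemma pderiv_const_smul {f : Plane → ℝ} (hf : Differentiable ℝ f) (a : ℝ) (i : Fin 2) :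
    pderiv i (a • f) = a • pderiv i f := by
  ext x
  simp [pderiv, fderiv_const_smul (hf x) a]

lemma tendsto_eLpNorm_lincomb {α : Type*} [MeasurableSpace α] {μ : Measure α} {f g : ℕ → α → ℝ}
    {F G : α → ℝ} (hf : ∀ n, AEStronglyMeasurable (f n) μ) (hg : ∀ n, AEStronglyMeasurable (g n) μ)
    (hF : AEStronglyMeasurable F μ) (hG : AEStronglyMeasurable G μ)
    (h1 : Tendsto (fun n => eLpNorm (f n - F) 2 μ) atTop (𝓝 0))
    (h2 : Tendsto (fun n => eLpNorm (g n - G) 2 μ) atTop (𝓝 0)) (a : ℝ) :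
    Tendsto (fun n => eLpNorm ((a • f n + g n) - (a • F + G)) 2 μ) atTop (𝓝 0) := by
  have h3 := (ENNReal.Tendsto.const_mul h1 (Or.inr (enorm_ne_top (x := a)))).add h2
  rw [mul_zero, add_zero] at h3
  refine tendsto_of_tendsto_of_tendsto_of_le_of_le tendsto_const_nhds h3 (fun n => zero_le)
    fun n => ?_
  have e : (a • f n + g n) - (a • F + G) = a • (f n - F) + (g n - G) := by
    rw [smul_sub]; abel
  rw [e]
  refine (eLpNorm_add_le (((hf n).sub hF).const_smul a) ((hg n).sub hG) (by norm_num)).trans ?_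
  rw [eLpNorm_const_smul]

/-- `H¹₀(Ω)` is a linear subspace. -/
lemma H10_smul_add {Ω : Set Plane} {v w : L2 Ω} (hv : v ∈ H10 Ω) (hw : w ∈ H10 Ω) (a : ℝ) :
    a • v + w ∈ H10 Ω := by
  obtain ⟨φ, G, hφ, h1, h2⟩ := hv
  obtain ⟨ψ, H, hψ, k1, k2⟩ := hw
  have hφd : ∀ n, Differentiable ℝ (φ n) := fun n => (hφ n).1.differentiable (by simp)
  have hψd : ∀ n, Differentiable ℝ (ψ n) := fun n => (hψ n).1.differentiable (by simp)
  refine ⟨fun n => a • φ n + ψ n, fun i => a • G i + H i,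
    fun n => ((hφ n).const_smul a).add (hψ n), ?_, fun i =>
      ⟨((h2 i).1.const_smul a).add (k2 i).1, ?_⟩⟩
  · have := tendsto_eLpNorm_lincomb (fun n => (hφ n).1.continuous.aestronglyMeasurable)
      (fun n => (hψ n).1.continuous.aestronglyMeasurable) (Lp.aestronglyMeasurable v)
      (Lp.aestronglyMeasurable w) h1 k1 a
    refine this.congr fun n => eLpNorm_congr_ae ?_
    filter_upwards [Lp.coeFn_add (a • v) w, Lp.coeFn_smul a v] with x e1 e2
    rw [Pi.sub_apply, Pi.sub_apply, e1, Pi.add_apply (a • v : L2 Ω), e2]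
    rfl
  · have := tendsto_eLpNorm_lincomb (fun n => ((hφ n).continuous_pderiv i).aestronglyMeasurable)
      (fun n => ((hψ n).continuous_pderiv i).aestronglyMeasurable) (h2 i).1.aestronglyMeasurable
      (k2 i).1.aestronglyMeasurable (h2 i).2 (k2 i).2 a
    refine this.congr fun n => ?_
    rw [pderiv_add ((hφd n).const_smul a) (hψd n), pderiv_const_smul (hφd n)]

lemma H10_zero {Ω : Set Plane} : (0 : L2 Ω) ∈ H10 Ω := by
  refine ⟨fun _ => 0, fun _ => 0, fun _ => ⟨contDiff_const, HasCompactSupport.zero, by simp⟩, ?_,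
    fun i => ⟨MemLp.zero, ?_⟩⟩
  · refine tendsto_const_nhds.congr fun n => ?_
    rw [eLpNorm_congr_ae (EventuallyEq.rfl.sub (Lp.coeFn_zero ℝ 2 _))]
    simp
  · have : pderiv i (0 : Plane → ℝ) = 0 := by
      ext x; simp [pderiv]
    simp [this]

lemma H10_add {Ω : Set Plane} {v w : L2 Ω} (hv : v ∈ H10 Ω) (hw : w ∈ H10 Ω) : v + w ∈ H10 Ω := by
  simpa using H10_smul_add hv hw 1

lemma H10_sum_smul {Ω : Set Plane} {ι : Type*} (s : Finset ι) (a : ι → ℝ) {v : ι → L2 Ω}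
    (hv : ∀ i ∈ s, v i ∈ H10 Ω) : ∑ i ∈ s, a i • v i ∈ H10 Ω := by
  classical
  induction s using Finset.induction_on with
  | empty => simpa using H10_zero
  | insert i s hi ih =>
    rw [Finset.sum_insert hi]
    exact H10_smul_add (hv i (by simp)) (ih fun j hj => hv j (by simp [hj])) _

/-! ### Linear combinations and weak derivatives of element-wise polynomials. -/

namespace Triangulation

variable {Ω : Set Plane} {T : Triangulation Ω} {K F : Finset Plane} {l : ℕ}
variable {p q : Finset Plane → MvPolynomial (Fin 2) ℝ}

lemma Represents.mono {v : Plane → ℝ} (h : T.Represents l v p) {m : ℕ} (hlm : l ≤ m) :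
    T.Represents m v p := fun K hK => ⟨(h K hK).1.trans hlm, (h K hK).2⟩

lemma Represents.smul_add (hΩ' : interior (closure Ω) = Ω) {v w : L2 Ω} (h : T.Represents l v p)
    (h' : T.Represents l w q) (a : ℝ) :
    T.Represents l (a • v + w : L2 Ω) fun K => MvPolynomial.C a * p K + q K := fun K hK => by
  constructor
  · refine (MvPolynomial.totalDegree_add _ _).trans (max_le
      ((MvPolynomial.totalDegree_mul _ _).trans ?_) (h' K hK).1)
    rw [MvPolynomial.totalDegree_C, zero_add]
    exact (h K hK).1
  · filter_upwards [T.ae_restrict_hull hΩ' hK (Lp.coeFn_add (a • v) w),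
      T.ae_restrict_hull hΩ' hK (Lp.coeFn_smul a v), (h K hK).2, (h' K hK).2] with x e1 e2 e3 e4
    rw [e1, Pi.add_apply, e2, Pi.smul_apply, e3, e4, ev_add, ev_C_mul]
    rfl

lemma Represents.add (hΩ' : interior (closure Ω) = Ω) {v w : L2 Ω} (h : T.Represents l v p)
    (h' : T.Represents l w q) : T.Represents l (v + w : L2 Ω) fun K => p K + q K := by
  have := h.smul_add hΩ' h' 1
  simpa using this

lemma Represents.sub (hΩ' : interior (closure Ω) = Ω) {v w : L2 Ω} (h : T.Represents l v p)
    (h' : T.Represents l w q) : T.Represents l (v - w : L2 Ω) fun K => p K - q K := by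
  have := h'.smul_add hΩ' h (-1)
  have e : (-1 : ℝ) • w + v = v - w := by rw [neg_one_smul]; abel
  rw [e] at this
  have e' : (fun K => MvPolynomial.C (-1 : ℝ) * q K + p K) = fun K => p K - q K := by
    ext1 K; rw [map_neg, map_one]; ring
  rwa [e'] at this

lemma represents_zero (hΩ' : interior (closure Ω) = Ω) :
    T.Represents l (0 : L2 Ω) fun _ => 0 := fun K hK =>
  ⟨by simp, by rw [ev_zero]; exact T.ae_restrict_hull hΩ' hK (Lp.coeFn_zero ℝ 2 _)⟩

lemma represents_sum_smul (hΩ' : interior (closure Ω) = Ω) {ι : Type*} (s : Finset ι)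
    (a : ι → ℝ) {v : ι → L2 Ω} {p : ι → Finset Plane → MvPolynomial (Fin 2) ℝ}
    (h : ∀ i ∈ s, T.Represents l (v i) (p i)) :
    T.Represents l (∑ i ∈ s, a i • v i : L2 Ω) fun K => ∑ i ∈ s, MvPolynomial.C (a i) * p i K := by
  classical
  induction s using Finset.induction_on with
  | empty => simpa using represents_zero hΩ'
  | insert i s hi ih =>
    simp only [Finset.sum_insert hi]
    exact (h i (by simp)).smul_add hΩ' (ih fun j hj => h j (by simp [hj])) _

lemma Represents.weakPartial_ae_eq {v : Plane → ℝ} (h : T.Represents l v p) (hK : K ∈ T.cells)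
    (j : Fin 2) : weakPartial (interior (hull K)) j v =ᵐ[volume.restrict (hull K)]
      pderiv j (ev (p K)) := by
  have hc : ContDiff ℝ 1 (ev (p K)) := contDiff_ev _
  have hv := (h K hK).2
  rw [restrict_hull_eq_interior] at hv ⊢
  have hm : ∀ j, MemLp (pderiv j (ev (p K))) 2 (volume.restrict (interior (hull K))) := fun j => by
    rw [← restrict_hull_eq_interior]
    exact memLp_hull_of_continuous K (continuous_pderiv hc j)
  exact CrouzeixRaviart.weakPartial_ae_eq isOpen_interior
    ((isWeakPartial_of_contDiff hc (hm j)).congr hv.symm)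

/-- A weak derivative in `Ω` restricts to one in the interior of a triangle, where it is unique.
This links the global divergence of the operator with element-wise polynomials. -/
lemma Represents.weakPartial_H10_ae_eq {v : L2 Ω} (h : T.Represents l v p)
    (hΩ' : interior (closure Ω) = Ω) (hv : v ∈ H10 Ω) (hK : K ∈ T.cells)
    (j : Fin 2) : weakPartial Ω j v =ᵐ[volume.restrict (hull K)] pderiv j (ev (p K)) := by
  have hex := H10_exists_weakPartial hv j
  have h1 : IsWeakPartial Ω j v (weakPartial Ω j v) := by
    rw [weakPartial, dif_pos hex]; exact hex.choose_spec
  have h2 := h1.mono (interior_hull_subset hΩ' hK)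
  have h3 := CrouzeixRaviart.weakPartial_ae_eq isOpen_interior h2
  rw [← restrict_hull_eq_interior] at h3
  exact h3.symm.trans (h.weakPartial_ae_eq hK j)

end Triangulation

/-! ### The averaging, bubble and mean mass preserving operators. -/

namespace Triangulation

variable {Ω : Set Plane} {T : Triangulation Ω} {K F : Finset Plane} {l : ℕ}
variable {p q : Finset Plane → MvPolynomial (Fin 2) ℝ} {κ : Plane → Finset Plane}

variable (T) in
/-- The averaging operator on scalar functions. -/
def scalarAveraging (l : ℕ) (κ : Plane → Finset Plane) (v : L2 Ω) : L2 Ω :=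
  ∑ ν ∈ T.interiorNodes l, cellValue (κ ν) v ν • T.lagrangeBasis l ν

variable (T) in
/-- The bubble operator on scalar functions. -/
def scalarBubbleOp (v : L2 Ω) : L2 Ω :=
  ∑ F ∈ T.interiorEdges, (∫ x, trace (T.plus F) F v x ∂(edgeMeasure F)) • T.edgeBubble F

variable (T) in
/-- The mean mass preserving operator on scalar functions. -/
def scalarMeanOp (l : ℕ) (κ : Plane → Finset Plane) (v : L2 Ω) : L2 Ω :=
  T.scalarAveraging l κ v + T.scalarBubbleOp (v - T.scalarAveraging l κ v)

-- At a Lagrange node at most one basis function is nonzero, so the sum collapses to the value from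
-- the selected triangle, or to 0 at a boundary node.
open Classical in
theorem exists_represents_averaging (hl : 0 < l) (hΩ : IsOpen Ω) (hΩ' : interior (closure Ω) = Ω)
    (hκ : T.IsNodeSelection l κ) {v : L2 Ω} (hv : T.Represents l v p) :
    T.scalarAveraging l κ v ∈ H10 Ω ∧ ∃ A, T.Represents l (T.scalarAveraging l κ v) A ∧
      ∀ K ∈ T.cells, ∀ α : Plane → ℕ, ∑ z ∈ K, α z = l →
        ev (A K) (node l K α) =
          if node l K α ∈ Ω then ev (p (κ (node l K α))) (node l K α) else 0 := by
  choose! h1 P hP hPn using fun ν (hν : ν ∈ T.interiorNodes l) =>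
    exists_lagrangeBasis_represents hl hΩ hΩ' hν
  refine ⟨H10_sum_smul _ _ h1, _, represents_sum_smul hΩ' _ _ hP, fun K hK α hα => ?_⟩
  rw [ev_sum]
  simp only [ev_C_mul, Pi.smul_apply, smul_eq_mul]
  set x := node l K α
  have hterm : ∀ ν ∈ T.interiorNodes l, cellValue (κ ν) v ν * ev (P ν K) x =
      if x = ν then ev (p (κ ν)) ν else 0 := fun ν hν => by
    rw [hPn ν hν K hK α hα, cellValue_eq (T.isTri (hκ ν hν).1) (hv _ (hκ ν hν).1).2 (hκ ν hν).2,
      mul_ite, mul_one, mul_zero]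
  rw [Finset.sum_congr rfl hterm, Finset.sum_ite_eq]
  refine if_congr ⟨fun h => (mem_interiorNodes.1 h).1, fun h => node_mem_interiorNodes hK hα h⟩
    rfl rfl

open Classical in
/-- The bubble part is an element-wise quadratic polynomial with prescribed means on the edges. -/
theorem exists_represents_bubbleOp (hΩ : IsOpen Ω) (hΩ' : interior (closure Ω) = Ω) {w : L2 Ω}
    (hw : T.Represents l w p) :
    T.scalarBubbleOp w ∈ H10 Ω ∧ ∃ B, T.Represents 2 (T.scalarBubbleOp w) B ∧
      (∀ K ∈ T.cells, ∀ F ⊆ K, F.card = 2 → ∫ x, ev (B K) x ∂edgeMeasure F =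
        if F ∈ T.interiorEdges then ∫ x, ev (p (T.plus F)) x ∂edgeMeasure F else 0) ∧
      ∀ K ∈ T.cells, ∀ M : ℝ, 0 ≤ M →
        (∀ F ∈ T.interiorEdges, F ⊆ K → |∫ x, ev (p (T.plus F)) x ∂edgeMeasure F| ≤
          Metric.diam (hull F) * M) →
        ∀ α : Plane → ℕ, ∑ z ∈ K, α z = 2 → |ev (B K) (node 2 K α)| ≤ 3 / 2 * M := by
  have hnode : ∀ F ∈ T.interiorEdges, midpt F ∈ T.interiorNodes 2 := fun F hF =>
    midpt_mem_interiorNodes hΩ' hF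
  choose! h1 P hP hPn using fun F (hF : F ∈ T.interiorEdges) =>
    exists_lagrangeBasis_represents (T := T) two_pos hΩ hΩ' (hnode F hF)
  set I : Finset Plane → ℝ := fun F => ∫ x, ev (p (T.plus F)) x ∂edgeMeasure F with hI
  have hedge : ∀ F ∈ T.interiorEdges, F ∈ T.edges := fun F hF => by
    obtain ⟨h2, K, hK, K', -, -, hFK, -⟩ := mem_interiorEdges.1 hF
    exact mem_edges.2 ⟨K, hK, hFK, h2⟩
  set a : Finset Plane → ℝ := fun F => I F * (3 / (2 * Metric.diam (hull F)))
  have hB : T.scalarBubbleOp w = ∑ F ∈ T.interiorEdges, a F • T.lagrangeBasis 2 (midpt F) := by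
    refine Finset.sum_congr rfl fun F hF => ?_
    have hFp := plus_mem (hedge F hF)
    rw [edgeBubble, smul_smul,
      integral_congr_ae (hw.trace_ae_eq hFp.1 hFp.2 (card_of_mem_edges (hedge F hF)))]
  rw [hB]
  refine ⟨H10_sum_smul _ _ h1, _, represents_sum_smul hΩ' _ _ hP, fun K hK F hFK h2 => ?_,
    fun K hK M hM0 hM α hα => ?_⟩
  · have hFe : F ∈ T.edges := mem_edges.2 ⟨K, hK, hFK, h2⟩
    simp only [ev_sum, ev_C_mul, Pi.smul_apply, smul_eq_mul]
    have := edgeMeasure_univ_lt_top h2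
    have hint : ∀ E ∈ T.interiorEdges, Integrable (fun x => a E * ev (P E K) x) (edgeMeasure F) :=
      fun E _ => ((memLp_edge_of_continuous h2 (continuous_ev _)).integrable
        (by norm_num)).const_mul _
    rw [integral_finsetSum _ hint]
    have hterm : ∀ E ∈ T.interiorEdges, ∫ x, a E * ev (P E K) x ∂edgeMeasure F =
        if F = E then I E else 0 := fun E hE => by
      obtain ⟨hE2, L, hL, L', -, -, hEL, -⟩ := mem_interiorEdges.1 hE
      have hinj : midpt F = midpt E ↔ F = E :=
        ⟨midpt_injective hK hL hFK hEL h2 hE2, fun h => by rw [h]⟩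
      rw [integral_const_mul, integral_quadratic_edge (hP E hE K hK).1 hFK h2
        (fun z hz => vertex_ne_midpt hK hL hEL hE2 (hFK hz)) (hPn E hE K hK)]
      simp only [hinj]
      split_ifs with h
      -- The normalization `3 / (2|F|)` is the inverse of the integral `2|F| / 3` of the quadratic
      -- function over its edge.
      · subst h
        have := (diam_edge_pos h2).ne'
        simp only [a]
        field_simp
      · ring
    rw [Finset.sum_congr rfl hterm, Finset.sum_ite_eq]
  · rw [ev_sum]
    simp only [ev_C_mul, Pi.smul_apply, smul_eq_mul]
    set x := node 2 K α
    have hterm : ∀ E ∈ T.interiorEdges, a E * ev (P E K) x = if x = midpt E then a E else 0 :=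
      fun E hE => by rw [hPn E hE K hK α hα, mul_ite, mul_one, mul_zero]
    rw [Finset.sum_congr rfl hterm]
    by_cases hex : ∃ E ∈ T.interiorEdges, x = midpt E
    · obtain ⟨E, hE, hxE⟩ := hex
      obtain ⟨hE2, L, hL, L', -, -, hEL, -⟩ := mem_interiorEdges.1 hE
      -- The midpoint lies in `K` and has nonzero coordinates at both endpoints, so the hypothesis
      -- on the edges of `K` applies to `E`.
      have hEK : E ⊆ K := fun z hz => by
        have hx1 : midpt E ∈ hull K := hxE ▸ node_mem_hull (T.isTri hK) two_pos hα
        refine mem_of_bary_ne_zero hL hK (hull_mono hEL (midpt_mem_hull hE2)) hx1 (z := z) ?_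
        rw [bary_midpt (T.isTri hL) hEL hE2 z (hEL hz), if_pos hz]
        norm_num
      rw [Finset.sum_eq_single_of_mem E hE, if_pos hxE]
      · have hd := diam_edge_pos hE2
        simp only [a]
        rw [abs_mul, abs_of_pos (by positivity : 0 < 3 / (2 * Metric.diam (hull E)))]
        calc |I E| * (3 / (2 * Metric.diam (hull E)))
            ≤ Metric.diam (hull E) * M * (3 / (2 * Metric.diam (hull E))) :=
              mul_le_mul_of_nonneg_right (hM E hE hEK) (by positivity)
          _ = 3 / 2 * M := by field_simp
      · intro E' hE' hne
        obtain ⟨hE2', L₂, hL₂, -, -, -, hEL₂, -⟩ := mem_interiorEdges.1 hE'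
        exact if_neg fun h => hne (midpt_injective hL₂ hL hEL₂ hEL hE2' hE2 (h.symm.trans hxE))
    · push Not at hex
      rw [Finset.sum_eq_zero fun E hE => if_neg (hex E hE), abs_zero]
      positivity

/-- The traces of an `H¹₀` function that is an element-wise polynomial coincide. -/
lemma Represents.eqOn_edge_of_H10 {v : L2 Ω} (h : T.Represents l v p) (hΩ : IsOpen Ω)
    (hΩ' : interior (closure Ω) = Ω) (hv : v ∈ H10 Ω) {K K' : Finset Plane} (hK : K ∈ T.cells)
    (hK' : K' ∈ T.cells) (hF : F ⊆ K) (hF' : F ⊆ K') : EqOn (ev (p K)) (ev (p K')) (hull F) :=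
  fun x hx => by
    have h1 := hull_mono hF hx
    have h2 := hull_mono hF' hx
    by_cases hxΩ : x ∈ Ω
    · exact h.eq_of_H10 hΩ hΩ' hv hK hK' h1 h2 hxΩ
    · rw [h.eq_zero_of_H10 hΩ hΩ' hv hK h1 hxΩ, h.eq_zero_of_H10 hΩ hΩ' hv hK' h2 hxΩ]

lemma setIntegral_edge_congr {f g : Plane → ℝ} (h : EqOn f g (hull F)) :
    ∫ x, f x ∂edgeMeasure F = ∫ x, g x ∂edgeMeasure F :=
  integral_congr_ae ((ae_edge_mem F).mono fun _ hx => h hx)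

lemma integral_ev_sub (h2 : F.card = 2) (p q : MvPolynomial (Fin 2) ℝ) :
    ∫ x, ev (p - q) x ∂edgeMeasure F =
      ∫ x, ev p x ∂edgeMeasure F - ∫ x, ev q x ∂edgeMeasure F := by
  have := edgeMeasure_univ_lt_top h2
  have hint : ∀ p, Integrable (ev p) (edgeMeasure F) := fun p =>
    (memLp_edge_of_continuous h2 (continuous_ev p)).integrable (by norm_num)
  rw [← integral_sub (hint p) (hint q), ev_sub]
  rfl

/-- The mean on an edge of a Crouzeix-Raviart function is the same from both sides. -/
lemma Represents.integral_eq_of_crSpace {v : L2 Ω} (h : T.Represents l v p) (hv : v ∈ T.crSpace l)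
    (hK : K ∈ T.cells) (hFK : F ⊆ K) (h2 : F.card = 2) :
    (T.others F = ∅ → ∫ x, ev (p K) x ∂edgeMeasure F = 0) ∧
      ∫ x, ev (p K) x ∂edgeMeasure F = ∫ x, ev (p (T.plus F)) x ∂edgeMeasure F := by
  have hF : F ∈ T.edges := mem_edges.2 ⟨K, hK, hFK, h2⟩
  have h0 : ∫ x, ev (T.jumpPoly p F) x ∂edgeMeasure F = 0 := by
    -- Of the Crouzeix-Raviart conditions only the one with constant test function is used.
    have := hv.2 F hF 1 (by simp)
    simp only [map_one, mul_one] at this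
    rw [← this]
    exact integral_congr_ae (h.jump_ae_eq hF).symm
  by_cases hp : K = T.plus F
  · refine ⟨fun ho => ?_, by rw [← hp]⟩
    rwa [jumpPoly, ho, Finset.sum_empty, sub_zero, ← hp] at h0
  · have ho := others_eq_singleton hF hK hFK hp
    refine ⟨fun he => ?_, ?_⟩
    · rw [he] at ho; exact absurd ho.symm (Finset.singleton_ne_empty _)
    · rw [jumpPoly, ho, Finset.sum_singleton, integral_ev_sub h2] at h0
      linarith

lemma mem_interiorEdges_iff_others (hF : F ∈ T.edges) :
    F ∈ T.interiorEdges ↔ T.others F ≠ ∅ := by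
  rw [mem_interiorEdges, ← Finset.nonempty_iff_ne_empty]
  obtain ⟨hp, hFp⟩ := plus_mem hF
  constructor
  · rintro ⟨-, K, hK, K', hK', hne, h1, h2⟩
    by_cases h : K = T.plus F
    · exact ⟨K', mem_others.2 ⟨hK', h2, fun e => hne (h.trans e.symm)⟩⟩
    · exact ⟨K, mem_others.2 ⟨hK, h1, h⟩⟩
  · rintro ⟨K, hK⟩
    obtain ⟨a, b, c⟩ := mem_others.1 hK
    exact ⟨card_of_mem_edges hF, K, a, _, hp, c, b, hFp⟩

/-- A description of the operator: the nodal averages `A` and the bubbles `B`. -/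
theorem exists_represents_meanOp (hl : 2 ≤ l) (hΩ : IsOpen Ω) (hΩ' : interior (closure Ω) = Ω)
    (hκ : T.IsNodeSelection l κ) {v : L2 Ω} (hv : T.Represents l v p) (hcr : v ∈ T.crSpace l) :
    T.scalarMeanOp l κ v ∈ H10 Ω ∧ ∃ A B : Finset Plane → MvPolynomial (Fin 2) ℝ,
      T.Represents l (T.scalarMeanOp l κ v) (fun K => A K + B K) ∧
      (∀ K ∈ T.cells, (A K).totalDegree ≤ l ∧ (B K).totalDegree ≤ 2) ∧
      (∀ K ∈ T.cells, ∀ α : Plane → ℕ, ∑ z ∈ K, α z = l →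
        (node l K α ∈ Ω → ev (A K) (node l K α) = ev (p (κ (node l K α))) (node l K α)) ∧
        (node l K α ∉ Ω → ev (A K) (node l K α) = 0)) ∧
      (∀ K ∈ T.cells, ∀ F ⊆ K, F.card = 2 → ∫ x, ev (p K - (A K + B K)) x ∂edgeMeasure F = 0) ∧
      ∀ K ∈ T.cells, ∀ M : ℝ, 0 ≤ M → (∀ x ∈ hull K, |ev (p K - A K) x| ≤ M) →
        ∀ α : Plane → ℕ, ∑ z ∈ K, α z = 2 → |ev (B K) (node 2 K α)| ≤ 3 / 2 * M := by
  classical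
  obtain ⟨hA0, A, hA, hAn⟩ := exists_represents_averaging (by omega) hΩ hΩ' hκ hv
  obtain ⟨hB0, B, hB, hBI, hBn⟩ := exists_represents_bubbleOp hΩ hΩ' (hv.sub hΩ' hA)
  -- The bubbles use the edge integral from `plus F`; it equals the one from `K` because `v` has the
  -- same mean from both sides and `A` is continuous.
  have hIeq : ∀ K ∈ T.cells, ∀ F ⊆ K, F.card = 2 → ∫ x, ev (p K - A K) x ∂edgeMeasure F =
      ∫ x, ev (p (T.plus F) - A (T.plus F)) x ∂edgeMeasure F := fun K hK F hFK h2 => by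
    have hF : F ∈ T.edges := mem_edges.2 ⟨K, hK, hFK, h2⟩
    have hp := plus_mem hF
    rw [integral_ev_sub h2, integral_ev_sub h2, (hv.integral_eq_of_crSpace hcr hK hFK h2).2,
      setIntegral_edge_congr (hA.eqOn_edge_of_H10 hΩ hΩ' hA0 hK hp.1 hFK hp.2)]
  refine ⟨H10_add hA0 hB0, A, B, hA.add hΩ' (hB.mono hl), fun K hK => ⟨(hA K hK).1, (hB K hK).1⟩,
    fun K hK α hα => ⟨fun h => by rw [hAn K hK α hα, if_pos h],
      fun h => by rw [hAn K hK α hα, if_neg h]⟩, fun K hK F hFK h2 => ?_,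
    fun K hK M hM0 hM => hBn K hK M hM0 fun F hF hFK => ?_⟩
  · have hF : F ∈ T.edges := mem_edges.2 ⟨K, hK, hFK, h2⟩
    rw [← sub_sub, integral_ev_sub h2, hBI K hK F hFK h2]
    split_ifs with hint
    · rw [hIeq K hK F hFK h2, sub_self]
    · have ho : T.others F = ∅ := by
        by_contra h
        exact hint ((mem_interiorEdges_iff_others hF).2 h)
      -- There is no bubble on a boundary edge and none is needed: `A` vanishes there and `v` has
      -- mean zero.
      have hbd : hull F ∩ Ω = ∅ := by
        rcases others_cases (T := T) hΩ hF with ⟨L, hL⟩ | ⟨-, h⟩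
        · rw [ho] at hL; exact absurd hL.symm (Finset.singleton_ne_empty _)
        · exact h
      have hAz : EqOn (ev (A K)) (ev 0) (hull F) := fun x hx => by
        rw [ev_zero, Pi.zero_apply]
        exact hA.eq_zero_of_H10 hΩ hΩ' hA0 hK (hull_mono hFK hx) fun h =>
          (hbd.subset ⟨hx, h⟩ : x ∈ (∅ : Set Plane))
      rw [integral_ev_sub h2, (hv.integral_eq_of_crSpace hcr hK hFK h2).1 ho,
        setIntegral_edge_congr hAz, ev_zero]
      simp
  · obtain ⟨h2, -⟩ := mem_interiorEdges.1 hF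
    rw [← hIeq K hK F hFK h2]
    exact abs_integral_edge_le h2 (continuous_ev _) fun x hx => hM x (hull_mono hFK hx)

/-! ### Linearity -/

/-- Additivity of `cellValue` holds because the arguments are polynomials on each triangle; for
general functions its default value would break it. -/
lemma scalarAveraging_smul_add (hκ : T.IsNodeSelection l κ) (hΩ' : interior (closure Ω) = Ω)
    {v w : L2 Ω} (hv : T.Represents l v p) (hw : T.Represents l w q) (a : ℝ) :
    T.scalarAveraging l κ (a • v + w) =
      a • T.scalarAveraging l κ v + T.scalarAveraging l κ w := by
  rw [scalarAveraging, scalarAveraging, scalarAveraging, Finset.smul_sum, ← Finset.sum_add_distrib]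
  refine Finset.sum_congr rfl fun ν hν => ?_
  obtain ⟨hK, hx⟩ := hκ ν hν
  have hKt := T.isTri hK
  rw [cellValue_eq hKt (hv _ hK).2 hx, cellValue_eq hKt (hw _ hK).2 hx,
    cellValue_eq hKt (hv.smul_add hΩ' hw a _ hK).2 hx, ev_add, ev_C_mul, smul_smul, ← add_smul]
  rfl

lemma scalarBubbleOp_smul_add (hΩ' : interior (closure Ω) = Ω)
    {v w : L2 Ω} (hv : T.Represents l v p) (hw : T.Represents l w q) (a : ℝ) :
    T.scalarBubbleOp (a • v + w) = a • T.scalarBubbleOp v + T.scalarBubbleOp w := by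
  rw [scalarBubbleOp, scalarBubbleOp, scalarBubbleOp, Finset.smul_sum, ← Finset.sum_add_distrib]
  refine Finset.sum_congr rfl fun F hF => ?_
  obtain ⟨h2, K, hK, -, -, -, hFK, -⟩ := mem_interiorEdges.1 hF
  have hp := plus_mem (mem_edges.2 ⟨K, hK, hFK, h2⟩ : F ∈ T.edges)
  have := edgeMeasure_univ_lt_top h2
  have hint : ∀ p, Integrable (ev p) (edgeMeasure F) := fun p =>
    (memLp_edge_of_continuous h2 (continuous_ev p)).integrable (by norm_num)
  rw [integral_congr_ae (hv.trace_ae_eq hp.1 hp.2 h2), integral_congr_ae (hw.trace_ae_eq hp.1 hp.2 h2),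
    integral_congr_ae ((hv.smul_add hΩ' hw a).trace_ae_eq hp.1 hp.2 h2), ev_add, ev_C_mul,
    smul_smul, ← add_smul]
  congr 1
  rw [integral_add' ((hint _).smul a) (hint _)]
  simp only [Pi.smul_apply, smul_eq_mul, integral_const_mul]

lemma scalarMeanOp_smul_add (hl : 0 < l) (hΩ : IsOpen Ω) (hΩ' : interior (closure Ω) = Ω)
    (hκ : T.IsNodeSelection l κ) {v w : L2 Ω} (hv : T.Represents l v p)
    (hw : T.Represents l w q) (a : ℝ) :
    T.scalarMeanOp l κ (a • v + w) = a • T.scalarMeanOp l κ v + T.scalarMeanOp l κ w := by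
  obtain ⟨-, A, hA, -⟩ := exists_represents_averaging hl hΩ hΩ' hκ hv
  obtain ⟨-, B, hB, -⟩ := exists_represents_averaging hl hΩ hΩ' hκ hw
  have h1 := scalarAveraging_smul_add hκ hΩ' hv hw a
  rw [scalarMeanOp, scalarMeanOp, scalarMeanOp, h1,
    show a • v + w - (a • T.scalarAveraging l κ v + T.scalarAveraging l κ w) =
      a • (v - T.scalarAveraging l κ v) + (w - T.scalarAveraging l κ w) by rw [smul_sub]; abel,
    scalarBubbleOp_smul_add hΩ' (hv.sub hΩ' hA) (hw.sub hΩ' hB), smul_add]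
  abel

end Triangulation

/-! ### Error estimates and preservation of the divergence. -/

namespace Triangulation

variable {Ω : Set Plane} {T : Triangulation Ω} {K F : Finset Plane} {l : ℕ}
variable {p q : Finset Plane → MvPolynomial (Fin 2) ℝ} {κ : Plane → Finset Plane}

open Classical in
variable (T) in
/-- The contribution of the edges touching the triangle `K` to the squared jump seminorm. -/
def cellEnergy (K : Finset Plane) (v : Plane → ℝ) : ℝ :=
  ∑ F ∈ T.edges with ¬Disjoint F K, T.edgeEnergy F v

lemma cellEnergy_nonneg (K : Finset Plane) (v : Plane → ℝ) : 0 ≤ T.cellEnergy K v :=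
  Finset.sum_nonneg fun F _ => edgeEnergy_nonneg F v

/-- A common point has a nonzero coordinate at some endpoint of `F`, and this endpoint is then a
vertex of `K`. -/
lemma edgeEnergy_le_cellEnergy (hK : K ∈ T.cells) (hF : F ∈ T.edges) {x : Plane}
    (hx : x ∈ hull K) (hxF : x ∈ hull F) (v : Plane → ℝ) :
    T.edgeEnergy F v ≤ T.cellEnergy K v := by
  classical
  refine Finset.single_le_sum (f := fun F => T.edgeEnergy F v)
    (fun F _ => edgeEnergy_nonneg F v) (Finset.mem_filter.2 ⟨hF, ?_⟩)
  obtain ⟨L, hL, hFL, h2⟩ := mem_edges.1 hF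
  obtain ⟨hxL, hzero⟩ := (mem_hull_face_iff (T.isTri hL) hFL).1 hxF
  obtain ⟨z, -, hz⟩ : ∃ z ∈ L, bary L z x ≠ 0 := by
    refine Finset.exists_ne_zero_of_sum_ne_zero ?_
    rw [sum_bary (T.isTri hL)]; exact one_ne_zero
  rw [Finset.not_disjoint_iff]
  refine ⟨z, ?_, mem_of_bary_ne_zero hL hK hxL hx hz⟩
  by_contra h
  exact hz (hzero z h)

/-- Each edge touches a bounded number of triangles. -/
lemma sum_cellEnergy_le (v : Plane → ℝ) : ∑ K ∈ T.cells, T.cellEnergy K v ≤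
    32 * T.shapeParameter ^ 2 * ∑ F ∈ T.edges, T.edgeEnergy F v := by
  classical
  simp only [cellEnergy, Finset.sum_filter]
  rw [Finset.sum_comm, Finset.mul_sum]
  refine Finset.sum_le_sum fun F hF => ?_
  rw [← Finset.sum_filter, Finset.sum_const, nsmul_eq_mul]
  refine mul_le_mul_of_nonneg_right ?_ (edgeEnergy_nonneg F v)
  obtain ⟨a, b, -, rfl⟩ := Finset.card_eq_two.1 (card_of_mem_edges hF)
  -- A triangle touching the edge contains one of its endpoints, and each endpoint lies in at most
  -- `16σ²` triangles.
  have hsub : T.cells.filter (fun K => ¬Disjoint ({a, b} : Finset Plane) K) ⊆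
      T.cellsAt a ∪ T.cellsAt b := fun K hK => by
    obtain ⟨hKc, h⟩ := Finset.mem_filter.1 hK
    obtain ⟨z, hz, hzK⟩ := Finset.not_disjoint_iff.1 h
    rw [Finset.mem_union, mem_cellsAt, mem_cellsAt]
    rcases Finset.mem_insert.1 hz with rfl | hz
    · exact Or.inl ⟨hKc, vertex_mem_hull hzK⟩
    · rw [Finset.mem_singleton] at hz
      subst hz
      exact Or.inr ⟨hKc, vertex_mem_hull hzK⟩
  have h1 := (Finset.card_le_card hsub).trans (Finset.card_union_le _ _)
  have h2 : ((T.cells.filter (fun K => ¬Disjoint ({a, b} : Finset Plane) K)).card : ℝ) ≤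
      (T.cellsAt a).card + (T.cellsAt b).card := by exact_mod_cast h1
  linarith [T.card_cellsAt_le a, T.card_cellsAt_le b]

/-- The local error of the operator is bounded by the jumps. -/
theorem exists_cell_error_bound (hl : 2 ≤ l) : ∃ C : ℝ, 0 ≤ C ∧ ∀ {Ω : Set Plane}
    {T : Triangulation Ω} {κ : Plane → Finset Plane} {v : L2 Ω}, IsOpen Ω →
    interior (closure Ω) = Ω → T.IsNodeSelection l κ → v ∈ T.crSpace l → ∀ K ∈ T.cells, ∀ j,
    ∫ x in hull K, weakPartial (interior (hull K)) j (v - T.scalarMeanOp l κ v : L2 Ω) x ^ 2 ≤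
      C * T.shapeParameter ^ 6 * T.cellEnergy K v := by
  obtain ⟨C₁, hC₁, hval⟩ := exists_value_bound l
  obtain ⟨C₂, hC₂, hloc⟩ := exists_local_bound (l := l) (by omega)
  obtain ⟨C₃, hC₃, hloc2⟩ := exists_local_bound (l := 2) two_pos
  -- The first term bounds the gradient of `p K - A K`; the second bounds that of the bubble part,
  -- whose nodal values are at most 3/2 of the maximum of `|p K - A K|`.
  set C₄ := C₂ + C₃ * (3 / 2 * C₂) with hC₄
  refine ⟨Real.pi * C₄ ^ 2 * 256 * C₁, by positivity,
    fun {Ω T κ v} hΩ hΩ' hκ hv K hK j => ?_⟩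
  obtain ⟨p, hp⟩ := exists_represents hv.1
  obtain ⟨-, A, B, hAB, hdeg, hA, -, hB⟩ := exists_represents_meanOp hl hΩ hΩ' hκ hp hv
  have hKt := T.isTri hK
  set σ := T.shapeParameter with hσ
  have hσ0 : 0 < σ := T.shapeParameter_pos hK
  set b := T.cellEnergy K v with hb
  have hb0 : 0 ≤ b := cellEnergy_nonneg K v
  -- Number of triangles at a node times the largest jump near it.
  set M := 16 * σ ^ 2 * √(C₁ * b) with hM
  have hM0 : 0 ≤ M := by positivity
  have hN : ∀ x, ((T.cellsAt x).card : ℝ) * √(C₁ * b) ≤ M := fun x =>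
    mul_le_mul_of_nonneg_right (T.card_cellsAt_le x) (Real.sqrt_nonneg _)
  have hnode : ∀ α : Plane → ℕ, ∑ z ∈ K, α z = l → |ev (p K - A K) (node l K α)| ≤ M := by
    intro α hα
    have hx := node_mem_hull hKt (by omega) hα
    set x := node l K α
    have h1 := hval hΩ hΩ' hp hK hx (E := b) fun F hF hxF =>
      edgeEnergy_le_cellEnergy hK hF hx hxF v
    rw [ev_sub, Pi.sub_apply]
    by_cases hxΩ : x ∈ Ω
    · have hκx := hκ x (node_mem_interiorNodes hK hα hxΩ)
      rw [(hA K hK α hα).1 hxΩ]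
      exact (h1.1 hxΩ _ hκx.1 hκx.2).trans (hN x)
    · rw [(hA K hK α hα).2 hxΩ, sub_zero]
      exact (h1.2 hxΩ).trans (hN x)
  have hd1 : (p K - A K).totalDegree ≤ l :=
    (MvPolynomial.totalDegree_sub _ _).trans (max_le (hp K hK).1 (hdeg K hK).1)
  have hloc' := hloc K hKt _ hd1 M hnode
  have hB' := hloc2 K hKt _ (hdeg K hK).2 _
    (hB K hK (C₂ * M) (by positivity) fun x hx => (hloc' x hx).1)
  have hin := inDiam_pos hKt
  have hgrad : ∀ x ∈ hull K, pderiv j (ev (p K - (A K + B K))) x ^ 2 ≤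
      (C₄ * M / inDiam K) ^ 2 := fun x hx => by
    rw [← sub_sub, ev_sub, pderiv_sub (contDiff_ev _) (contDiff_ev _), Pi.sub_apply, sq_le_sq,
      abs_of_nonneg (by positivity : 0 ≤ C₄ * M / inDiam K)]
    refine (abs_sub _ _).trans ((add_le_add ((hloc' x hx).2 j) ((hB' x hx).2 j)).trans
      (le_of_eq ?_))
    rw [hC₄]; ring
  have hw := (hp.sub hΩ' hAB).weakPartial_ae_eq hK j
  have hfin : IsFiniteMeasure ((volume : Measure Plane).restrict (hull K)) :=
    isFiniteMeasure_restrict.2 (volume_hull_lt_top K).ne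
  have hcont : Continuous fun x => pderiv j (ev (p K - (A K + B K))) x ^ 2 :=
    (continuous_pderiv (contDiff_ev _) j).pow 2
  calc ∫ x in hull K, weakPartial (interior (hull K)) j (v - T.scalarMeanOp l κ v : L2 Ω) x ^ 2
      = ∫ x in hull K, pderiv j (ev (p K - (A K + B K))) x ^ 2 := by
        refine integral_congr_ae ?_
        filter_upwards [hw] with x hx
        rw [hx]
    _ ≤ ∫ _ in hull K, (C₄ * M / inDiam K) ^ 2 :=
        setIntegral_mono_on (hcont.continuousOn.integrableOn_compact (isCompact_hull K))
          (integrable_const _) (isClosed_hull K).measurableSet hgrad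
    _ = (volume (hull K)).toReal * (C₄ * M / inDiam K) ^ 2 := by
        rw [setIntegral_const, smul_eq_mul]; rfl
    _ ≤ Real.pi * Metric.diam (hull K) ^ 2 * (C₄ * M / inDiam K) ^ 2 :=
        mul_le_mul_of_nonneg_right (volume_hull_toReal_le hKt) (sq_nonneg _)
    _ = Real.pi * C₄ ^ 2 * M ^ 2 * (Metric.diam (hull K) / inDiam K) ^ 2 := by
        field_simp
    -- The area is of order `h²` and the squared gradient of order `1/ρ²`, so only the ratio `h/ρ ≤
    -- σ` remains. Together with `σ⁴` from `M²` this gives `σ⁶`.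
    _ ≤ Real.pi * C₄ ^ 2 * M ^ 2 * σ ^ 2 := by
        refine mul_le_mul_of_nonneg_left (pow_le_pow_left₀
          (div_nonneg Metric.diam_nonneg hin.le) (T.diam_div_inDiam_le hK) 2) (by positivity)
    _ = Real.pi * C₄ ^ 2 * 256 * C₁ * σ ^ 6 * b := by
        rw [hM, mul_pow, Real.sq_sqrt (by positivity)]
        ring

/-- The squared jump seminorm of a vector field. -/
def jumpEnergy (T : Triangulation Ω) (v : Fin 2 → L2 Ω) : ℝ :=
  ∑ i, ∑ F ∈ T.edges, T.edgeEnergy F (v i)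

lemma crNorm_eq (T : Triangulation Ω) (w : Fin 2 → L2 Ω) : T.crNorm w =
    √((∑ K ∈ T.cells, ∑ i, ∑ j,
      ∫ x in hull K, weakPartial (interior (hull K)) j (w i) x ^ 2) + T.jumpEnergy w) := by
  rw [crNorm, jumpEnergy, Finset.sum_comm (s := Finset.univ) (t := T.edges)]
  congr 2
  exact Finset.sum_congr rfl fun F _ => by rw [Finset.mul_sum]; rfl

/-- The jumps are bounded by the distance to `H¹₀`. -/
lemma sqrt_jumpEnergy_le_crNorm (hΩ : IsOpen Ω) (hΩ' : interior (closure Ω) = Ω)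
    {v u : Fin 2 → L2 Ω} (hv : ∀ i, v i ∈ T.crSpace l) (hu : ∀ i, u i ∈ H10 Ω) :
    √(T.jumpEnergy v) ≤ T.crNorm (u - v) := by
  rw [crNorm_eq]
  refine Real.sqrt_le_sqrt ?_
  have h1 : T.jumpEnergy (u - v) = T.jumpEnergy v := by
    refine Finset.sum_congr rfl fun i _ => Finset.sum_congr rfl fun F hF => ?_
    obtain ⟨p, hp⟩ := exists_represents (hv i).1
    exact hp.edgeEnergy_H10_sub hΩ hΩ' (hu i)
      (fun K hK => T.ae_restrict_hull hΩ' hK (Lp.coeFn_sub (u i) (v i))) hF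
  rw [h1]
  exact le_add_of_nonneg_left (Finset.sum_nonneg fun K _ => Finset.sum_nonneg fun i _ =>
    Finset.sum_nonneg fun j _ => integral_nonneg fun x => sq_nonneg _)

/-- The rule for an H¹₀ function minus an element-wise polynomial is applied twice: to `m - v`, and
to `0 - (v - m)`, which is the same function. -/
lemma Represents.edgeEnergy_sub_H10 {v m : L2 Ω} (hv : T.Represents l v p)
    (hm : T.Represents l m q) (hΩ : IsOpen Ω) (hΩ' : interior (closure Ω) = Ω) (hm0 : m ∈ H10 Ω)
    (hF : F ∈ T.edges) : T.edgeEnergy F (v - m : L2 Ω) = T.edgeEnergy F v := by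
  rw [← hv.edgeEnergy_H10_sub hΩ hΩ' hm0 (w := (m - v : L2 Ω))
    (fun K hK => T.ae_restrict_hull hΩ' hK (Lp.coeFn_sub m v)) hF]
  refine ((hv.sub hΩ' hm).edgeEnergy_H10_sub hΩ hΩ' H10_zero (fun K hK => ?_) hF).symm
  have h := T.ae_restrict_hull hΩ' hK (Lp.coeFn_sub (0 : L2 Ω) (v - m))
  rwa [zero_sub, neg_sub] at h

/-- Stability of the operator in terms of the jumps. -/
theorem exists_crNorm_meanOp_bound (hl : 2 ≤ l) : ∃ C : ℝ, 0 ≤ C ∧ ∀ {Ω : Set Plane}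
    {T : Triangulation Ω} {κ : Plane → Finset Plane} {v : Fin 2 → L2 Ω}, IsOpen Ω →
    interior (closure Ω) = Ω → T.IsNodeSelection l κ → (∀ i, v i ∈ T.crSpace l) →
    T.crNorm (v - T.meanOp l κ v) ≤
      √(1 + C * T.shapeParameter ^ 8) * √(T.jumpEnergy v) := by
  obtain ⟨C, hC, h⟩ := exists_cell_error_bound hl
  -- The 64 is 2 for the partial derivatives times 32 for the overlap of the edge neighbourhoods,
  -- which also contributes `σ²`. The 1 in the stability constant accounts for the unchanged jumps.
  refine ⟨64 * C, by positivity, fun {Ω T κ v} hΩ hΩ' hκ hv => ?_⟩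
  have hσ : 0 ≤ T.shapeParameter ^ 8 := by positivity
  rw [crNorm_eq, ← Real.sqrt_mul (by positivity)]
  refine Real.sqrt_le_sqrt ?_
  have h1 : T.jumpEnergy (v - T.meanOp l κ v) = T.jumpEnergy v := by
    refine Finset.sum_congr rfl fun i _ => Finset.sum_congr rfl fun F hF => ?_
    obtain ⟨p, hp⟩ := exists_represents (hv i).1
    obtain ⟨hm0, A, B, hAB, -⟩ := exists_represents_meanOp hl hΩ hΩ' hκ hp (hv i)
    exact hp.edgeEnergy_sub_H10 hAB hΩ hΩ' hm0 hF
  have h2 : (∑ K ∈ T.cells, ∑ i, ∑ j, ∫ x in hull K,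
      weakPartial (interior (hull K)) j ((v - T.meanOp l κ v) i) x ^ 2) ≤
      64 * C * T.shapeParameter ^ 8 * T.jumpEnergy v := by
    calc _ ≤ ∑ K ∈ T.cells, ∑ i, ∑ _j : Fin 2,
          C * T.shapeParameter ^ 6 * T.cellEnergy K (v i) :=
        Finset.sum_le_sum fun K hK => Finset.sum_le_sum fun i _ => Finset.sum_le_sum fun j _ =>
          h hΩ hΩ' hκ (hv i) K hK j
      _ = 2 * (C * T.shapeParameter ^ 6) * ∑ i, ∑ K ∈ T.cells, T.cellEnergy K (v i) := by
        rw [Finset.sum_comm, Finset.mul_sum]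
        refine Finset.sum_congr rfl fun i _ => ?_
        rw [Finset.mul_sum]
        refine Finset.sum_congr rfl fun K _ => ?_
        rw [Finset.sum_const, Finset.card_univ, Fintype.card_fin, nsmul_eq_mul]
        push_cast; ring
      _ ≤ 2 * (C * T.shapeParameter ^ 6) * ∑ i, 32 * T.shapeParameter ^ 2 *
          ∑ F ∈ T.edges, T.edgeEnergy F (v i) := by
        refine mul_le_mul_of_nonneg_left (Finset.sum_le_sum fun i _ => sum_cellEnergy_le _) ?_
        have : 0 ≤ T.shapeParameter ^ 6 := by positivity
        positivity
      _ = _ := by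
        rw [← Finset.mul_sum, jumpEnergy]; ring
  rw [h1]
  linarith

/-- The operator preserves the means of the divergence. -/
theorem integral_weakDiv_meanOp (hl : 2 ≤ l) (hΩ : IsOpen Ω) (hΩ' : interior (closure Ω) = Ω)
    (hκ : T.IsNodeSelection l κ) {v : Fin 2 → L2 Ω} (hv : ∀ i, v i ∈ T.crSpace l)
    (hK : K ∈ T.cells) : ∫ x in hull K, weakDiv Ω (fun i => T.meanOp l κ v i) x =
      ∫ x in hull K, weakDiv (interior (hull K)) (fun i => v i) x := by
  have key : ∀ i, ∃ f g : MvPolynomial (Fin 2) ℝ,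
      weakPartial Ω i (T.meanOp l κ v i) =ᵐ[volume.restrict (hull K)] pderiv i (ev f) ∧
      weakPartial (interior (hull K)) i (v i) =ᵐ[volume.restrict (hull K)] pderiv i (ev g) ∧
      ∫ x in hull K, pderiv i (ev (g - f)) x = 0 := fun i => by
    obtain ⟨p, hp⟩ := exists_represents (hv i).1
    obtain ⟨hm0, A, B, hAB, -, -, hI, -⟩ := exists_represents_meanOp hl hΩ hΩ' hκ hp (hv i)
    exact ⟨A K + B K, p K, hAB.weakPartial_H10_ae_eq hΩ' hm0 hK i, hp.weakPartial_ae_eq hK i,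
      integral_pderiv_eq_zero (T.isTri hK) (contDiff_ev _) (fun F hF h2 => hI K hK F hF h2) i⟩
  choose f g hf hg hfg using key
  have hint : ∀ i (p : MvPolynomial (Fin 2) ℝ),
      Integrable (pderiv i (ev p)) (volume.restrict (hull K)) := fun i p =>
    (continuous_pderiv (contDiff_ev _) i).continuousOn.integrableOn_compact (isCompact_hull K)
  have e : ∀ (U : Fin 2 → Plane → ℝ) (r : Fin 2 → MvPolynomial (Fin 2) ℝ),
      (∀ i, U i =ᵐ[volume.restrict (hull K)] pderiv i (ev (r i))) →
      ∫ x in hull K, ∑ i, U i x = ∑ i, ∫ x in hull K, pderiv i (ev (r i)) x := fun U r h => by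
    rw [← integral_finsetSum _ fun i _ => hint i _]
    refine integral_congr_ae ?_
    filter_upwards [ae_all_iff.2 h] with x hx
    exact Finset.sum_congr rfl fun i _ => hx i
  simp only [weakDiv]
  rw [e (fun i => weakPartial Ω i (T.meanOp l κ v i)) f hf,
    e (fun i => weakPartial (interior (hull K)) i (v i)) g hg]
  refine Finset.sum_congr rfl fun i _ => ?_
  have h1 := hfg i
  rw [ev_sub, pderiv_sub (contDiff_ev _) (contDiff_ev _)] at h1
  rw [integral_sub' (hint i _) (hint i _)] at h1
  linarith

end Triangulation

end CrouzeixRaviart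

end

/-! ### The theorem. -/

theorem mainTheorem7 (l : ℕ) (hl : 2 ≤ l) :
    ∃ c : ℝ → ℝ, Monotone c ∧ (∀ s, 0 ≤ c s) ∧
      ∀ (Ω : Set Plane), IsOpen Ω → interior (closure Ω) = Ω →
      ∀ (T : Triangulation Ω) (κ : Plane → Finset Plane), T.IsNodeSelection l κ →
        -- the operator is linear from the vector Crouzeix-Raviart space to the conforming space
        (∀ v : Fin 2 → L2 Ω, (∀ i, v i ∈ T.crSpace l) →
          ∀ i, T.meanOp l κ v i ∈ T.polyH10 l) ∧
        (∀ (a b : ℝ) (v w : Fin 2 → L2 Ω), (∀ i, v i ∈ T.crSpace l) → (∀ i, w i ∈ T.crSpace l) →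
          T.meanOp l κ (a • v + b • w) = a • T.meanOp l κ v + b • T.meanOp l κ w) ∧
        -- preservation of the element-wise mean of the divergence
        (∀ v : Fin 2 → L2 Ω, (∀ i, v i ∈ T.crSpace l) → ∀ K ∈ T.cells,
          ∫ x in hull K, weakDiv Ω (fun i => T.meanOp l κ v i) x =
            ∫ x in hull K, weakDiv (interior (hull K)) (fun i => v i) x) ∧
        -- quasi-optimal stability
        (∀ v : Fin 2 → L2 Ω, (∀ i, v i ∈ T.crSpace l) →
          T.crNorm (v - T.meanOp l κ v) ≤
            c (T.shapeParameter) *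
              ⨅ u : {u : Fin 2 → L2 Ω // ∀ i, u i ∈ H10 Ω}, T.crNorm (u.1 - v)) := by
  obtain ⟨C, hC, hstab⟩ := Triangulation.exists_crNorm_meanOp_bound hl
  -- Truncating at 0 makes the even power nondecreasing on the whole line; shape parameters are
  -- nonnegative, so nothing changes there.
  refine ⟨fun s => √(1 + C * max s 0 ^ 8), fun s t hst => ?_, fun s => Real.sqrt_nonneg _,
    fun Ω hΩ hΩ' T κ hκ => ⟨fun v hv i => ?_, fun a b v w hv hw => ?_,
      fun v hv K hK => Triangulation.integral_weakDiv_meanOp hl hΩ hΩ' hκ hv hK, fun v hv => ?_⟩⟩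
  · exact Real.sqrt_le_sqrt (add_le_add le_rfl (mul_le_mul_of_nonneg_left
      (pow_le_pow_left₀ (le_max_right _ _) (max_le_max hst le_rfl) 8) hC))
  · obtain ⟨p, hp⟩ := Triangulation.exists_represents (hv i).1
    obtain ⟨h1, A, B, h2, -⟩ :=
      Triangulation.exists_represents_meanOp hl hΩ hΩ' hκ hp (hv i)
    exact ⟨h1, Triangulation.isPolyOn_of_represents h2⟩
  · have hl0 : 0 < l := by omega
    funext i
    obtain ⟨p, hp⟩ := Triangulation.exists_represents (hv i).1
    obtain ⟨q, hq⟩ := Triangulation.exists_represents (hw i).1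
    have h0 := Triangulation.represents_zero (T := T) (l := l) hΩ'
    have hlin := fun {v w : L2 Ω} {p q} (hv : T.Represents l v p) (hw : T.Represents l w q) =>
      Triangulation.scalarMeanOp_smul_add hl0 hΩ hΩ' hκ hv hw
    -- The linearity rule has the form `a • v + w`; two applications with this value at 0 give the
    -- form with two coefficients.
    have hz : T.scalarMeanOp l κ 0 = 0 := by
      have := hlin h0 h0 1
      rwa [one_smul, one_smul, add_zero, left_eq_add] at this
    have hb : T.Represents l (b • w i + 0 : L2 Ω) _ := hq.smul_add hΩ' h0 b
    have e1 := hlin hp hb a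
    have e2 := hlin hq h0 b
    rw [e2, hz, add_zero, add_zero] at e1
    exact e1
  · have hbdd : (0 : ℝ) ≤ T.shapeParameter :=
      Real.iSup_nonneg fun K => div_nonneg Metric.diam_nonneg
        (inDiam_pos (T.isTri K.2)).le
    -- A lower bound for each `u` passes to the real infimum only over a nonempty index set.
    have : Nonempty {u : Fin 2 → L2 Ω // ∀ i, u i ∈ H10 Ω} := ⟨⟨0, fun _ => H10_zero⟩⟩
    refine (hstab hΩ hΩ' hκ hv).trans ?_
    simp only [max_eq_left hbdd]
    exact mul_le_mul_of_nonneg_left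
      (le_ciInf fun u => Triangulation.sqrt_jumpEnergy_le_crNorm hΩ hΩ' hv u.2) (Real.sqrt_nonneg _)
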